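/- For integers $k \ge 3$ and $r \ge 1$ let $\mathrm{SC}(k,r)$ be the planar set of $kr$ points that consists of the $k$ vertices of a regular $k$-gon together with, on each of its $k$ sides, the $r-1$ points that divide the side into $r$ equal parts. A triangulation of a finite planar point set $S$ is a dissection of the convex hull of $S$ into (nondegenerate) triangles with vertices in $S$ and pairwise disjoint interiors, such that no triangle contains a point of $S$ other than its three vertices. Let $\mathsf{tr}(k,r)$ be the number of triangulations of $\mathrm{SC}(k,r)$. Theorem. For every fixed $k \ge 3$, the improper integral $\int_{-\infty}^{\infty} \frac{\sin^k(2u)}{u^{k-2}}\,du = \lim_{a\to-\infty,\ b\to\infty} \int_a^b \frac{\sin^k(2u)}{u^{k-2}}\,du$ converges, and $$\mathsf{tr}(k,r) = \frac{2^{(r-1)k}\, r^{k-3}}{\pi} \left(\int_{-\infty}^{\infty} \frac{\sin^k(2u)}{u^{k-2}}\,du\right)\bigl(1+o(1)\bigr) \qquad \text{as } r \to \infty.$$ -/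

import Mathlib

open Filter Topology Asymptotics

/-- The `i`-th corner of the regular `k`-gon inscribed in the unit circle of the plane `ℂ`. -/
noncomputable def corner (k i : ℕ) : ℂ :=
  Complex.exp (2 * Real.pi * Complex.I * (i / k : ℝ))

/-- The `j`-th of the evenly spaced points that divide the side from `corner k i` to
`corner k (i + 1)` into `r` equal parts; `j = 0` gives `corner k i` itself. -/
noncomputable def sidePoint (k r i j : ℕ) : ℂ :=
  AffineMap.lineMap (corner k i) (corner k (i + 1)) (j / r : ℝ)

/-- The balanced subdivided convex polygon: the `k * r` points that consist of the corners of a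
regular `k`-gon and of `r - 1` further points on each of its `k` sides. -/
def subdividedPolygon (k r : ℕ) : Set ℂ :=
  {z | ∃ i < k, ∃ j < r, z = sidePoint k r i j}

/-- `T` is (the set of vertex triples of the triangles of) a triangulation of the planar point
set `S`: a dissection of the convex hull of `S` into nondegenerate triangles with vertices in `S`
that have pairwise disjoint interiors, such that no triangle contains a point of `S` other than
its own vertices, neither in its interior nor on its sides. -/
structure IsTriangulation (S : Set ℂ) (T : Set (Finset ℂ)) : Prop where
  vertices_mem : ∀ t ∈ T, (t : Set ℂ) ⊆ S
  card_eq_three : ∀ t ∈ T, t.card = 3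
  nondegenerate : ∀ t ∈ T, AffineIndependent ℝ (fun p : t => (p : ℂ))
  no_other_point : ∀ t ∈ T, convexHull ℝ (t : Set ℂ) ∩ S = t
  covers : ⋃ t ∈ T, convexHull ℝ (t : Set ℂ) = convexHull ℝ S
  noncrossing : ∀ s ∈ T, ∀ t ∈ T, s ≠ t →
    Disjoint (interior (convexHull ℝ (s : Set ℂ))) (interior (convexHull ℝ (t : Set ℂ)))

/-- The number of triangulations of the balanced subdivided polygon with `k` corners whose
sides are divided into `r` parts each. -/
noncomputable def tr (k r : ℕ) : ℕ :=
  {T : Set (Finset ℂ) | IsTriangulation (subdividedPolygon k r) T}.ncard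

/-! Number the points counterclockwise from 1 to `k * r`, with corner 0 last, and take the polygon
edge from point 1 to corner 0 as base. In a triangulation exactly one triangle rests on the base;
its apex `m` splits the rest into triangulations of two shorter chains, each relative to its own
base. This gives the recursion "sum over `m` of the product of two counts" (`chainCount_eq_sum`). It
differs from that of a strictly convex polygon only in that a chord between two points of one side
is not allowed unless it is an edge.

The flat sides are handled algebraically. Let the functional L send X^(n+1) to the Catalan number
C_n, the count for a strictly convex chain of n+1 edges. By inclusion-exclusion over disjoint flat
ears, a side of n parts contributes the polynomial P_n with P_(n+2) = X (P_(n+1) - P_n), and the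
count for a chain is L of the product of the polynomials of its side pieces. The proof does not
carry out the inclusion-exclusion. It checks that L of these products obeys the same recursion
(`catalanFunctional_chainPoly_of_lt`), using a coproduct `splitPoly` that cuts a chain at each of
its points, and that it vanishes on flat chains of at least two edges
(`catalanFunctional_sidePoly`).

Catalan numbers are moments of sin^2 x dx in the variable 4 cos^2 x, and in this variable P_n is a
Chebyshev polynomial of the second kind up to a power of 2 cos x. Hence `tr_eq_integral`: the count
is an explicit constant times the integral over [0, π/2] of cos^(kr-4) x sin^k((r+1)x) / sin^(k-2)
x. With x = 2u/(r+1) the integrand tends to sin^k(2u) / u^(k-2). Dominated convergence handles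
bounded intervals, and a tail bound uniform in r handles the rest; for k = 3 the convergence is only
conditional and the bound comes from integration by parts. The limit is positive, so the result is a
genuine asymptotic equivalence. -/

/-! ### Orientation, half-planes and triangles -/

/-- Twice the signed area of the triangle `a b c`; it is positive if the triangle is traversed
counterclockwise. -/
def orient (a b c : ℂ) : ℝ :=
  (b.re - a.re) * (c.im - a.im) - (b.im - a.im) * (c.re - a.re)

theorem orient_rotate (a b c : ℂ) : orient b c a = orient a b c := by
  simp only [orient]; ring

theorem orient_swap (a b c : ℂ) : orient a c b = -orient a b c := by
  simp only [orient]; ring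

theorem orient_swap' (a b c : ℂ) : orient b a c = -orient a b c := by
  simp only [orient]; ring

@[simp] theorem orient_self_left (a b : ℂ) : orient a a b = 0 := by
  simp [orient]

@[simp] theorem orient_self_right (a b : ℂ) : orient a b b = 0 := by
  simp only [orient]; ring

@[simp] theorem orient_self_outer (a b : ℂ) : orient a b a = 0 := by
  simp [orient]

theorem orient_lineMap (p q a b : ℂ) (s : ℝ) :
    orient p q (AffineMap.lineMap a b s) = (1 - s) * orient p q a + s * orient p q b := by
  simp [orient, AffineMap.lineMap_apply]; ring

theorem orient_combo (p q a b : ℂ) {s t : ℝ} (h : s + t = 1) :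
    orient p q (s • a + t • b) = s * orient p q a + t * orient p q b := by
  obtain rfl : s = 1 - t := by linarith
  simp [orient]; ring

theorem orient_sum {ι : Type*} (I : Finset ι) (w : ι → ℝ) (z : ι → ℂ) (hw : ∑ i ∈ I, w i = 1)
    (p q : ℂ) : orient p q (∑ i ∈ I, w i • z i) = ∑ i ∈ I, w i * orient p q (z i) := by
  have h : ∀ i ∈ I, w i * orient p q (z i) = (q.re - p.re) * (w i * (z i).im)
      - (q.im - p.im) * (w i * (z i).re)
      - w i * ((q.re - p.re) * p.im - (q.im - p.im) * p.re) := by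
    intro i _; simp only [orient]; ring
  rw [Finset.sum_congr rfl h, Finset.sum_sub_distrib, Finset.sum_sub_distrib, ← Finset.mul_sum,
    ← Finset.mul_sum, ← Finset.sum_mul, hw]
  simp [orient]; ring

theorem continuous_orient (a b : ℂ) : Continuous (orient a b) := by
  unfold orient; fun_prop

theorem convex_orient_nonneg (a b : ℂ) : Convex ℝ {z | 0 ≤ orient a b z} := by
  intro x hx y hy s t hs ht hst
  simp only [Set.mem_ofPred_eq] at *
  rw [orient_combo _ _ _ _ hst]; positivity

theorem orient_nonneg_of_mem_convexHull {a b z : ℂ} {S : Set ℂ} (h : ∀ x ∈ S, 0 ≤ orient a b x)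
    (hz : z ∈ convexHull ℝ S) : 0 ≤ orient a b z :=
  convexHull_min (t := {z | 0 ≤ orient a b z}) h (convex_orient_nonneg a b) hz

theorem exists_lineMap_of_orient_eq_zero {a b z : ℂ} (hab : a ≠ b) (h : orient a b z = 0) :
    ∃ s : ℝ, z = AffineMap.lineMap a b s := by
  have hN : 0 < (b.re - a.re) ^ 2 + (b.im - a.im) ^ 2 := by
    by_contra hc
    apply hab
    have h1 : b.re - a.re = 0 := by nlinarith [sq_nonneg (b.re - a.re), sq_nonneg (b.im - a.im)]
    have h2 : b.im - a.im = 0 := by nlinarith [sq_nonneg (b.re - a.re), sq_nonneg (b.im - a.im)]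
    apply Complex.ext <;> linarith
  -- The parameter of the orthogonal projection of `z` onto the line.
  obtain ⟨s, hs⟩ : ∃ s : ℝ, s * ((b.re - a.re) ^ 2 + (b.im - a.im) ^ 2) =
      (z.re - a.re) * (b.re - a.re) + (z.im - a.im) * (b.im - a.im) :=
    ⟨_, div_mul_cancel₀ _ hN.ne'⟩
  refine ⟨s, ?_⟩
  simp only [orient] at h
  apply Complex.ext
  · simp [AffineMap.lineMap_apply]
    apply mul_right_cancel₀ hN.ne'
    linear_combination (-(b.im - a.im)) * h - (b.re - a.re) * hs
  · simp [AffineMap.lineMap_apply]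
    apply mul_right_cancel₀ hN.ne'
    linear_combination (b.re - a.re) * h - (b.im - a.im) * hs

theorem lineMap_mem_segment_of_le {a b : ℂ} {s : ℝ} (h0 : 0 ≤ s) (h1 : s ≤ 1) :
    AffineMap.lineMap a b s ∈ segment ℝ a b := by
  rw [segment_eq_image_lineMap]; exact ⟨s, ⟨h0, h1⟩, rfl⟩

theorem mem_convexHull_triple {a b c z : ℂ} (h : 0 < orient a b c) :
    z ∈ convexHull ℝ ({a, b, c} : Set ℂ) ↔
      0 ≤ orient a b z ∧ 0 ≤ orient b c z ∧ 0 ≤ orient c a z := by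
  have hb : orient b c a = orient a b c := orient_rotate a b c
  have hc : orient c a b = orient a b c := by rw [← orient_rotate, orient_rotate]
  constructor
  · intro hz
    refine ⟨orient_nonneg_of_mem_convexHull ?_ hz, orient_nonneg_of_mem_convexHull ?_ hz,
      orient_nonneg_of_mem_convexHull ?_ hz⟩ <;>
    simp [h.le, hb, hc]
  · rintro ⟨h1, h2, h3⟩
    have hs : orient a b z + orient b c z + orient c a z = orient a b c := by
      simp only [orient]; ring
    -- The barycentric coordinates are ratios of areas; by `hs` they sum to 1.
    have key : z = ∑ i : Fin 3, (![orient b c z / orient a b c, orient c a z / orient a b c,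
        orient a b z / orient a b c] i) • (![a, b, c] i) := by
      simp only [Fin.sum_univ_three, Matrix.cons_val]
      apply Complex.ext
      · simp only [Complex.add_re, Complex.real_smul, Complex.mul_re, Complex.ofReal_re,
          Complex.ofReal_im, zero_mul, sub_zero]
        field_simp
        simp only [orient]; ring
      · simp only [Complex.add_im, Complex.real_smul, Complex.mul_im, Complex.ofReal_re,
          Complex.ofReal_im, zero_mul, add_zero]
        field_simp
        simp only [orient]; ring
    rw [key]
    apply (convex_convexHull ℝ _).sum_mem
    · intro i _; fin_cases i <;> simp <;> positivity
    · simp [Fin.sum_univ_three]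
      field_simp
      linarith
    · intro i _; apply subset_convexHull; fin_cases i <;> simp

theorem mem_interior_convexHull_triple {a b c z : ℂ} (h1 : 0 < orient a b z)
    (h2 : 0 < orient b c z) (h3 : 0 < orient c a z) :
    z ∈ interior (convexHull ℝ ({a, b, c} : Set ℂ)) := by
  have h : 0 < orient a b c := by
    have hs : orient a b z + orient b c z + orient c a z = orient a b c := by
      simp only [orient]; ring
    linarith
  refine mem_interior.2 ⟨{w | 0 < orient a b w} ∩ ({w | 0 < orient b c w} ∩
    {w | 0 < orient c a w}), ?_, ?_, ⟨h1, h2, h3⟩⟩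
  · rintro w ⟨hw1, hw2, hw3⟩
    exact (mem_convexHull_triple h).2 ⟨le_of_lt hw1, le_of_lt hw2, le_of_lt hw3⟩
  · exact (isOpen_lt continuous_const (continuous_orient _ _)).inter
      ((isOpen_lt continuous_const (continuous_orient _ _)).inter
        (isOpen_lt continuous_const (continuous_orient _ _)))

/-- A convex set with points in the interior of another set and itself of nonempty interior
overlaps it. -/
theorem Convex.interior_inter_nonempty {A B : Set ℂ} (hA : Convex ℝ A)
    (hne : (interior A).Nonempty) {z : ℂ} (hzA : z ∈ A) (hzB : z ∈ interior B) :
    (interior A ∩ interior B).Nonempty := by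
  have h : z ∈ closure (interior A) := by
    rw [hA.closure_interior_eq_closure_of_nonempty_interior hne]
    exact subset_closure hzA
  rw [mem_closure_iff] at h
  obtain ⟨w, hw⟩ := h _ isOpen_interior hzB
  exact ⟨w, hw.2, hw.1⟩

/-- A point on the line itself is not interior: a small step along the normal towards the negative
side leaves `A`. -/
theorem interior_orient_nonneg {a b : ℂ} (hab : a ≠ b) {A : Set ℂ}
    (hA : ∀ z ∈ A, 0 ≤ orient a b z) {z : ℂ} (hz : z ∈ interior A) : 0 < orient a b z := by
  rcases (hA z (interior_subset hz)).lt_or_eq with h | h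
  · exact h
  exfalso
  have hN : 0 < (b.re - a.re) ^ 2 + (b.im - a.im) ^ 2 := by
    by_contra hc
    apply hab
    have h1 : b.re - a.re = 0 := by nlinarith [sq_nonneg (b.re - a.re), sq_nonneg (b.im - a.im)]
    have h2 : b.im - a.im = 0 := by nlinarith [sq_nonneg (b.re - a.re), sq_nonneg (b.im - a.im)]
    apply Complex.ext <;> linarith
  have hc : Tendsto (fun e : ℝ => z + (e : ℂ) * (⟨b.im - a.im, -(b.re - a.re)⟩ : ℂ)) (𝓝[>] 0)
      (𝓝 z) := by
    have : ContinuousAt (fun e : ℝ => z + (e : ℂ) * (⟨b.im - a.im, -(b.re - a.re)⟩ : ℂ)) 0 := by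
      fun_prop
    have h2 := this.tendsto.mono_left (nhdsWithin_le_nhds (s := Set.Ioi 0))
    simpa using h2
  have h1 := hc.eventually (mem_interior_iff_mem_nhds.1 hz)
  obtain ⟨e, he, he0⟩ := (h1.and self_mem_nhdsWithin).exists
  have := hA _ he
  have he0 : 0 < e := he0
  have h3 : orient a b (z + (e : ℂ) * (⟨b.im - a.im, -(b.re - a.re)⟩ : ℂ)) =
      orient a b z - e * ((b.re - a.re) ^ 2 + (b.im - a.im) ^ 2) := by
    simp [orient]; ring
  rw [h3, ← h] at this
  nlinarith [mul_pos he0 hN]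

theorem disjoint_interior_of_orient {a b : ℂ} (hab : a ≠ b) {A B : Set ℂ}
    (hA : ∀ z ∈ A, 0 ≤ orient a b z) (hB : ∀ z ∈ B, orient a b z ≤ 0) :
    Disjoint (interior A) (interior B) := by
  rw [Set.disjoint_left]
  intro z hzA hzB
  have h1 := interior_orient_nonneg hab hA hzA
  have h2 := interior_orient_nonneg hab.symm (A := B)
    (fun z hz => by have := hB z hz; have h := orient_swap' a b z; linarith) hzB
  have h := orient_swap' a b z
  linarith

theorem affineIndependent_triple_iff {a b c : ℂ} :
    AffineIndependent ℝ ![a, b, c] ↔ orient a b c ≠ 0 := by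
  rw [affineIndependent_iff_not_collinear_set, not_iff_comm, not_not]
  constructor
  · intro h
    by_cases hab : a = b
    · subst hab; simp [collinear_pair]
    · obtain ⟨s, rfl⟩ := exists_lineMap_of_orient_eq_zero hab h
      rw [collinear_iff_of_mem (p₀ := a) (by simp)]
      refine ⟨b - a, ?_⟩
      simp only [Set.mem_insert_iff, Set.mem_singleton_iff, forall_eq_or_imp, forall_eq]
      exact ⟨⟨0, by simp⟩, ⟨1, by simp⟩, ⟨s, by simp [AffineMap.lineMap_apply]⟩⟩
  · intro h
    rw [collinear_iff_of_mem (p₀ := a) (by simp)] at h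
    obtain ⟨v, hv⟩ := h
    obtain ⟨s, hs⟩ := hv b (by simp)
    obtain ⟨t, ht⟩ := hv c (by simp)
    rw [hs, ht]
    simp [orient]; ring

open Classical in
theorem affineIndependent_coe_triple {a b c : ℂ} (h : orient a b c ≠ 0) :
    AffineIndependent ℝ (fun p : ({a, b, c} : Finset ℂ) => (p : ℂ)) := by
  have h1 := (affineIndependent_triple_iff.2 h).range
  have h2 : Set.range ![a, b, c] = (({a, b, c} : Finset ℂ) : Set ℂ) := by
    ext x; simp [eq_comm (a := x)]; tauto
  rw [h2] at h1
  exact h1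

theorem orient_ne_zero_of_affineIndependent {t : Finset ℂ}
    (ht : AffineIndependent ℝ (fun p : t => (p : ℂ))) {x y z : ℂ} (hx : x ∈ t) (hy : y ∈ t)
    (hz : z ∈ t) (hxy : x ≠ y) (hxz : x ≠ z) (hyz : y ≠ z) : orient x y z ≠ 0 := by
  rw [← affineIndependent_triple_iff]
  have hinj : Function.Injective (![⟨x, hx⟩, ⟨y, hy⟩, ⟨z, hz⟩] : Fin 3 → t) := by
    intro i j hij
    fin_cases i <;> fin_cases j <;> simp_all
  have := ht.comp_embedding ⟨_, hinj⟩
  convert this using 1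
  ext i
  fin_cases i <;> simp

theorem interior_convexHull_nonempty {t : Finset ℂ} (hc : t.card = 3)
    (ht : AffineIndependent ℝ (fun p : t => (p : ℂ))) :
    (interior (convexHull ℝ (t : Set ℂ))).Nonempty := by
  rw [interior_convexHull_nonempty_iff_affineSpan_eq_top]
  have h := ht.affineSpan_eq_top_iff_card_eq_finrank_add_one.2
    (by simp [hc, Complex.finrank_real_complex])
  simpa using h

theorem orient_lineMap_mid (p q a b : ℂ) (s : ℝ) :
    orient p (AffineMap.lineMap a b s) q = (1 - s) * orient p a q + s * orient p b q := by
  simp [orient, AffineMap.lineMap_apply]; ring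

theorem orient_lineMap_left (p q a b : ℂ) (s : ℝ) :
    orient (AffineMap.lineMap a b s) p q = (1 - s) * orient a p q + s * orient b p q := by
  simp [orient, AffineMap.lineMap_apply]; ring

/-! ### Weakly convex chains and the triangle on the base edge -/

/-- The points `q i, …, q j` are in weakly convex position, in counterclockwise order. -/
structure WeaklyConvex (q : ℕ → ℂ) (i j : ℕ) : Prop where
  injOn : Set.InjOn q (Set.Icc i j)
  orient_nonneg : ∀ a b c, i ≤ a → a < b → b < c → c ≤ j → 0 ≤ orient (q a) (q b) (q c)

theorem WeaklyConvex.mono {q : ℕ → ℂ} {i j i' j' : ℕ} (h : WeaklyConvex q i j) (hi : i ≤ i')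
    (hj : j' ≤ j) : WeaklyConvex q i' j' :=
  ⟨h.injOn.mono (Set.Icc_subset_Icc hi hj),
    fun a b c ha hab hbc hc => h.orient_nonneg a b c (hi.trans ha) hab hbc (hc.trans hj)⟩

/-- A triangulation of `q i, …, q j` relative to the base edge from `q i` to `q j`: the base edge
itself need not be covered, so that the two ends of an edge have the empty triangulation. -/
structure IsChainTriangulation (q : ℕ → ℂ) (i j : ℕ) (T : Set (Finset ℂ)) : Prop where
  vertices_mem : ∀ t ∈ T, (t : Set ℂ) ⊆ q '' Set.Icc i j
  card_eq_three : ∀ t ∈ T, t.card = 3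
  nondegenerate : ∀ t ∈ T, AffineIndependent ℝ (fun p : t => (p : ℂ))
  no_other_point : ∀ t ∈ T, convexHull ℝ (t : Set ℂ) ∩ q '' Set.Icc i j ⊆ t
  covers : ∀ z ∈ convexHull ℝ (q '' Set.Icc i j), z ∉ segment ℝ (q i) (q j) →
    ∃ t ∈ T, z ∈ convexHull ℝ (t : Set ℂ)
  noncrossing : ∀ s ∈ T, ∀ t ∈ T, s ≠ t →
    Disjoint (interior (convexHull ℝ (s : Set ℂ))) (interior (convexHull ℝ (t : Set ℂ)))

/-- The triangle on the base edge with apex `q m` is nondegenerate and contains no further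
points. -/
structure IsApex (q : ℕ → ℂ) (i m j : ℕ) : Prop where
  left_lt : i < m
  lt_right : m < j
  orient_pos : 0 < orient (q i) (q m) (q j)
  empty : ∀ w ∈ Set.Icc i j, q w ∈ convexHull ℝ ({q i, q m, q j} : Set ℂ) →
    w = i ∨ w = m ∨ w = j

section apex

variable {q : ℕ → ℂ} {i m j : ℕ}

theorem IsApex.of_mem_segment_left (h : IsApex q i m j) {w : ℕ} (hw : w ∈ Set.Icc i j)
    (hs : q w ∈ segment ℝ (q i) (q m)) : w = i ∨ w = m ∨ w = j :=
  h.empty w hw (segment_subset_convexHull (by simp) (by simp) hs)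

theorem IsApex.of_mem_segment_right (h : IsApex q i m j) {w : ℕ} (hw : w ∈ Set.Icc i j)
    (hs : q w ∈ segment ℝ (q m) (q j)) : w = i ∨ w = m ∨ w = j :=
  h.empty w hw (segment_subset_convexHull (by simp) (by simp) hs)

theorem IsApex.ne_left (h : IsApex q i m j) : q i ≠ q m := by
  intro h'; have := h.orient_pos; simp [h'] at this

theorem IsApex.ne_right (h : IsApex q i m j) : q m ≠ q j := by
  intro h'; have := h.orient_pos; simp [h'] at this

/-- A chain point on the line of a leg is forced onto the leg itself, where it contradicts
emptiness: two weak convexity inequalities bound its parameter by 0 and 1. The next three lemmas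
argue in the same way. -/
theorem IsApex.orient_left (hq : WeaklyConvex q i j) (h : IsApex q i m j) {u : ℕ} (hiu : i < u)
    (hum : u < m) : 0 < orient (q i) (q u) (q m) := by
  have hmj := h.lt_right
  have hp := h.orient_pos
  rcases (hq.orient_nonneg i u m le_rfl hiu hum hmj.le).lt_or_eq with h0 | h0
  · exact h0
  exfalso
  rw [orient_swap, zero_eq_neg] at h0
  obtain ⟨s, hs⟩ := exists_lineMap_of_orient_eq_zero h.ne_left h0
  have h1 := hq.orient_nonneg i u j le_rfl hiu (by omega) le_rfl
  have h2 := hq.orient_nonneg u m j hiu.le hum hmj le_rfl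
  rw [hs, orient_lineMap_mid, orient_self_left] at h1
  rw [hs, orient_lineMap_left, orient_self_left] at h2
  have h3 : 0 ≤ s := by by_contra hc; push Not at hc; nlinarith
  have h4 : s ≤ 1 := by by_contra hc; push Not at hc; nlinarith
  have := h.of_mem_segment_left (w := u) ⟨hiu.le, by omega⟩ (hs ▸ lineMap_mem_segment_of_le h3 h4)
  omega

theorem IsApex.orient_right (hq : WeaklyConvex q i j) (h : IsApex q i m j) {v : ℕ} (hmv : m < v)
    (hvj : v < j) : 0 < orient (q m) (q v) (q j) := by
  have him := h.left_lt
  have hp := h.orient_pos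
  rcases (hq.orient_nonneg m v j him.le hmv hvj le_rfl).lt_or_eq with h0 | h0
  · exact h0
  exfalso
  rw [orient_swap, zero_eq_neg] at h0
  obtain ⟨s, hs⟩ := exists_lineMap_of_orient_eq_zero h.ne_right h0
  have h1 := hq.orient_nonneg i m v le_rfl him hmv hvj.le
  have h2 := hq.orient_nonneg i v j le_rfl (by omega) hvj le_rfl
  rw [hs, orient_lineMap, orient_self_right] at h1
  rw [hs, orient_lineMap_mid, orient_self_right] at h2
  have h3 : 0 ≤ s := by by_contra hc; push Not at hc; nlinarith
  have h4 : s ≤ 1 := by by_contra hc; push Not at hc; nlinarith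
  have := h.of_mem_segment_right (w := v) ⟨by omega, hvj.le⟩
    (hs ▸ lineMap_mem_segment_of_le h3 h4)
  omega

/-- The point `u` cut off by the leg is needed: if the leg is an edge, later points may continue
straight along its line. -/
theorem IsApex.orient_cut_left (hq : WeaklyConvex q i j) (h : IsApex q i m j) {u v : ℕ}
    (hiu : i < u) (hum : u < m) (hmv : m < v) (hvj : v ≤ j) :
    0 < orient (q i) (q m) (q v) := by
  rcases hvj.lt_or_eq with hvj | rfl
  swap
  · exact h.orient_pos
  have him := h.left_lt
  have hp := h.orient_pos
  have hu := h.orient_left hq hiu hum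
  rcases (hq.orient_nonneg i m v le_rfl him hmv hvj.le).lt_or_eq with h0 | h0
  · exact h0
  exfalso
  obtain ⟨s, hs⟩ := exists_lineMap_of_orient_eq_zero h.ne_left h0.symm
  have h1 := hq.orient_nonneg i v j le_rfl (by omega) hvj le_rfl
  have h2 := hq.orient_nonneg u m v hiu.le hum hmv hvj.le
  rw [hs, orient_lineMap_mid, orient_self_left] at h1
  rw [hs, orient_lineMap, orient_self_right, orient_rotate] at h2
  have h3 : 0 ≤ s := by by_contra hc; push Not at hc; nlinarith
  have h4 : s ≤ 1 := by by_contra hc; push Not at hc; nlinarith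
  have := h.of_mem_segment_left (w := v) ⟨by omega, hvj.le⟩
    (hs ▸ lineMap_mem_segment_of_le h3 h4)
  omega

theorem IsApex.orient_cut_right (hq : WeaklyConvex q i j) (h : IsApex q i m j) {u v : ℕ}
    (hiu : i ≤ u) (hum : u < m) (hmv : m < v) (hvj : v < j) :
    0 < orient (q u) (q m) (q j) := by
  rcases hiu.lt_or_eq with hiu | rfl
  swap
  · exact h.orient_pos
  have hp := h.orient_pos
  have hv := h.orient_right hq hmv hvj
  rcases (hq.orient_nonneg u m j hiu.le hum h.lt_right le_rfl).lt_or_eq with h0 | h0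
  · exact h0
  exfalso
  rw [← orient_rotate] at h0
  obtain ⟨s, hs⟩ := exists_lineMap_of_orient_eq_zero h.ne_right h0.symm
  have h1 := hq.orient_nonneg i u j le_rfl hiu (by omega) le_rfl
  have h2 := hq.orient_nonneg u m v hiu.le hum hmv hvj.le
  rw [hs, orient_lineMap_mid, orient_self_right] at h1
  rw [hs, orient_lineMap_left, orient_self_left] at h2
  rw [orient_rotate] at hv
  have h3 : 0 ≤ s := by by_contra hc; push Not at hc; nlinarith
  have h4 : s ≤ 1 := by by_contra hc; push Not at hc; nlinarith
  have := h.of_mem_segment_right (w := u) ⟨hiu.le, by omega⟩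
    (hs ▸ lineMap_mem_segment_of_le h3 h4)
  omega

theorem IsApex.image_Icc (h : IsApex q i m j) :
    q '' Set.Icc i j = q '' Set.Icc i m ∪ q '' Set.Icc m j := by
  have := h.left_lt
  have := h.lt_right
  rw [← Set.image_union, Set.Icc_union_Icc_eq_Icc (by omega) (by omega)]

theorem WeaklyConvex.orient_base_nonneg (hq : WeaklyConvex q i j) {z : ℂ}
    (hz : z ∈ convexHull ℝ (q '' Set.Icc i j)) : 0 ≤ orient (q j) (q i) z := by
  refine orient_nonneg_of_mem_convexHull ?_ hz
  rintro _ ⟨w, hw, rfl⟩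
  rcases hw.1.eq_or_lt with rfl | h1
  · simp
  rcases hw.2.eq_or_lt with rfl | h2
  · simp
  rw [← orient_rotate]
  exact hq.orient_nonneg i w j le_rfl h1 h2 le_rfl

theorem IsApex.orient_left_hull (hq : WeaklyConvex q i j) (h : IsApex q i m j) {z : ℂ}
    (hz : z ∈ convexHull ℝ (q '' Set.Icc i m)) : orient (q i) (q m) z ≤ 0 := by
  have h1 := WeaklyConvex.orient_base_nonneg (hq.mono le_rfl h.lt_right.le) hz
  rw [orient_swap'] at h1
  linarith

theorem IsApex.orient_right_hull (hq : WeaklyConvex q i j) (h : IsApex q i m j) {z : ℂ}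
    (hz : z ∈ convexHull ℝ (q '' Set.Icc m j)) : orient (q m) (q j) z ≤ 0 := by
  have h1 := WeaklyConvex.orient_base_nonneg (hq.mono h.left_lt.le le_rfl) hz
  rw [orient_swap'] at h1
  linarith

theorem IsApex.orient_left_hull' (hq : WeaklyConvex q i j) (h : IsApex q i m j) {z : ℂ}
    (hz : z ∈ convexHull ℝ (q '' Set.Icc m j)) : 0 ≤ orient (q i) (q m) z := by
  refine orient_nonneg_of_mem_convexHull ?_ hz
  rintro _ ⟨w, hw, rfl⟩
  rcases hw.1.eq_or_lt with rfl | h1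
  · simp
  exact hq.orient_nonneg i m w le_rfl h.left_lt h1 hw.2

theorem IsApex.orient_right_hull' (hq : WeaklyConvex q i j) (h : IsApex q i m j) {z : ℂ}
    (hz : z ∈ convexHull ℝ (q '' Set.Icc i m)) : 0 ≤ orient (q m) (q j) z := by
  refine orient_nonneg_of_mem_convexHull ?_ hz
  rintro _ ⟨w, hw, rfl⟩
  rcases hw.2.eq_or_lt with rfl | h1
  · simp
  rw [orient_rotate]
  exact hq.orient_nonneg w m j hw.1 h1 h.lt_right le_rfl

/-- The segment from `a` to `b` crosses the line at a point of `A`, and `z` lies between `a` and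
that crossing point. -/
theorem Convex.mem_of_orient_neg {A : Set ℂ} (hA : Convex ℝ A) {p r a b z : ℂ} (ha : a ∈ A)
    (hb : 0 ≤ orient p r b) (hz : z ∈ segment ℝ a b) (hz0 : orient p r z < 0)
    (h : ∀ x ∈ segment ℝ a b, orient p r x = 0 → x ∈ A) : z ∈ A := by
  rw [segment_eq_image_lineMap] at hz
  obtain ⟨s, ⟨hs0, hs1⟩, rfl⟩ := hz
  rw [orient_lineMap] at hz0
  set α := orient p r a with hα
  set β := orient p r b with hβ
  have hα' : α < 0 := by
    by_contra hc
    nlinarith [mul_nonneg hs0 hb, mul_nonneg (sub_nonneg.2 hs1) (not_lt.1 hc)]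
  have hd : 0 < β - α := by linarith
  have hX := h (AffineMap.lineMap a b (-α / (β - α)))
    (lineMap_mem_segment_of_le (by apply div_nonneg <;> linarith)
      (by rw [div_le_one hd]; linarith))
    (by rw [orient_lineMap, ← hα, ← hβ]; field_simp; ring)
  have hsx : s * (β - α) / -α ≤ 1 := by
    rw [div_le_one (by linarith)]; nlinarith
  have : AffineMap.lineMap a b s = AffineMap.lineMap a
      (AffineMap.lineMap a b (-α / (β - α))) (s * (β - α) / -α) := by
    have hα2 : α ≠ 0 := hα'.ne
    have hd2 : β - α ≠ 0 := hd.ne'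
    have : s = s * (β - α) / -α * (-α / (β - α)) := by field_simp
    simp only [AffineMap.lineMap_apply, vsub_eq_sub, vadd_eq_add, add_sub_cancel_right, smul_smul,
      ← this]
  rw [this]
  exact hA.segment_subset ha hX
    (lineMap_mem_segment_of_le (div_nonneg (mul_nonneg hs0 hd.le) (by linarith)) hsx)

theorem IsApex.exists_segment (h : IsApex q i m j) {z : ℂ}
    (hz : z ∈ convexHull ℝ (q '' Set.Icc i j)) :
    ∃ a ∈ convexHull ℝ (q '' Set.Icc i m), ∃ b ∈ convexHull ℝ (q '' Set.Icc m j),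
      z ∈ segment ℝ a b ∧ segment ℝ a b ⊆ convexHull ℝ (q '' Set.Icc i j) := by
  have him := h.left_lt
  have hmj := h.lt_right
  rw [h.image_Icc, convexHull_union ((Set.nonempty_Icc.2 him.le).image q)
    ((Set.nonempty_Icc.2 hmj.le).image q), mem_convexJoin] at hz
  obtain ⟨a, ha, b, hb, hab⟩ := hz
  exact ⟨a, ha, b, hb, hab, (convex_convexHull ℝ _).segment_subset
      (convexHull_mono (Set.image_mono (Set.Icc_subset_Icc le_rfl hmj.le)) ha)
      (convexHull_mono (Set.image_mono (Set.Icc_subset_Icc him.le le_rfl)) hb)⟩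

theorem WeaklyConvex.orient_succ_nonneg (hq : WeaklyConvex q i j) {l : ℕ} (hl : i ≤ l)
    (hlj : l + 1 ≤ j) {z : ℂ} (hz : z ∈ convexHull ℝ (q '' Set.Icc i j)) :
    0 ≤ orient (q l) (q (l + 1)) z := by
  refine orient_nonneg_of_mem_convexHull ?_ hz
  rintro _ ⟨w, hw, rfl⟩
  rcases lt_trichotomy w l with h1 | rfl | h1
  · rw [orient_rotate]
    exact hq.orient_nonneg _ _ _ hw.1 h1 (by omega) hlj
  · simp
  · rcases (Nat.succ_le_of_lt h1).eq_or_lt with h2 | h2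
    · simp [← h2]
    · exact hq.orient_nonneg _ _ _ (by omega) (by omega) h2 hw.2

theorem segment_subset_hull {a b : ℕ} (hab : a ≤ b) :
    segment ℝ (q a) (q b) ⊆ convexHull ℝ (q '' Set.Icc a b) :=
  segment_subset_convexHull (Set.mem_image_of_mem q (Set.left_mem_Icc.2 hab))
    (Set.mem_image_of_mem q (Set.right_mem_Icc.2 hab))

/-- The part of the hull beyond the left leg of the triangle is the hull of the left points. -/
theorem IsApex.mem_hull_left (hq : WeaklyConvex q i j) (h : IsApex q i m j) {z : ℂ}
    (hz : z ∈ convexHull ℝ (q '' Set.Icc i j)) (hz0 : orient (q i) (q m) z < 0) :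
    z ∈ convexHull ℝ (q '' Set.Icc i m) := by
  have him := h.left_lt
  have hmj := h.lt_right
  have hp := h.orient_pos
  obtain ⟨u, hiu, hum⟩ : ∃ u, i < u ∧ u < m := by
    by_contra hc
    have : 0 ≤ orient (q i) (q m) z := by
      refine orient_nonneg_of_mem_convexHull ?_ hz
      rintro _ ⟨w, hw, rfl⟩
      rcases hw.1.eq_or_lt with rfl | h1
      · simp
      rcases lt_trichotomy w m with h2 | rfl | h2
      · exact absurd ⟨w, h1, h2⟩ hc
      · simp
      · exact hq.orient_nonneg _ _ _ le_rfl him h2 hw.2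
    linarith
  obtain ⟨a, ha, b, hb, hab, hsub⟩ := h.exists_segment hz
  refine (convex_convexHull ℝ _).mem_of_orient_neg ha (h.orient_left_hull' hq hb) hab hz0
    fun X hX hX0 => ?_
  have hXh := hsub hX
  obtain ⟨x, hx⟩ := exists_lineMap_of_orient_eq_zero h.ne_left hX0
  have hx0 : 0 ≤ x := by
    have := hq.orient_base_nonneg hXh
    rw [hx, orient_lineMap, orient_self_right, orient_rotate, orient_rotate] at this
    by_contra hc; push Not at hc; nlinarith
  -- The hull lies to the left of the edge that ends at `q m`, and `q i` strictly so; hence the line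
  -- of the leg leaves the hull at `q m`.
  have hx1 : x ≤ 1 := by
    obtain ⟨l, rfl⟩ : ∃ l, m = l + 1 := ⟨m - 1, by omega⟩
    have h1 := hq.orient_succ_nonneg (l := l) (by omega) hmj.le hXh
    have h2 := h.orient_left hq (u := l) (by omega) (by omega)
    rw [hx, orient_lineMap, orient_self_right, orient_rotate] at h1
    by_contra hc; push Not at hc; nlinarith
  rw [hx]
  exact segment_subset_hull him.le (lineMap_mem_segment_of_le hx0 hx1)

/-- The part of the hull beyond the right leg of the triangle is the hull of the right points. -/
theorem IsApex.mem_hull_right (hq : WeaklyConvex q i j) (h : IsApex q i m j) {z : ℂ}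
    (hz : z ∈ convexHull ℝ (q '' Set.Icc i j)) (hz0 : orient (q m) (q j) z < 0) :
    z ∈ convexHull ℝ (q '' Set.Icc m j) := by
  have him := h.left_lt
  have hmj := h.lt_right
  have hp := h.orient_pos
  obtain ⟨u, hmu, huj⟩ : ∃ u, m < u ∧ u < j := by
    by_contra hc
    have : 0 ≤ orient (q m) (q j) z := by
      refine orient_nonneg_of_mem_convexHull ?_ hz
      rintro _ ⟨w, hw, rfl⟩
      rcases hw.2.eq_or_lt with rfl | h1
      · simp
      rcases lt_trichotomy w m with h2 | rfl | h2
      · rw [orient_rotate]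
        exact hq.orient_nonneg _ _ _ hw.1 h2 hmj le_rfl
      · simp
      · exact absurd ⟨w, h2, h1⟩ hc
    linarith
  obtain ⟨a, ha, b, hb, hab, hsub⟩ := h.exists_segment hz
  rw [segment_symm] at hab hsub
  refine (convex_convexHull ℝ _).mem_of_orient_neg hb (h.orient_right_hull' hq ha) hab hz0
    fun X hX hX0 => ?_
  have hXh := hsub hX
  obtain ⟨x, hx⟩ := exists_lineMap_of_orient_eq_zero h.ne_right hX0
  -- The mirror image: here the edge that starts at `q m` bounds the parameter.
  have hx0 : 0 ≤ x := by
    have h1 := hq.orient_succ_nonneg (l := m) (by omega) (by omega) hXh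
    have h2 := h.orient_right hq (v := m + 1) (by omega) (by omega)
    rw [hx, orient_lineMap, orient_self_outer] at h1
    by_contra hc; push Not at hc; nlinarith
  have hx1 : x ≤ 1 := by
    have := hq.orient_base_nonneg hXh
    rw [hx, orient_lineMap, orient_self_outer] at this
    rw [← orient_rotate, ← orient_rotate] at hp
    by_contra hc; push Not at hc; nlinarith
  rw [hx]
  exact segment_subset_hull hmj.le (lineMap_mem_segment_of_le hx0 hx1)

end apex

/-! ### Existence of the base triangle -/

section triangulation

variable {q : ℕ → ℂ} {i m j : ℕ} {T : Set (Finset ℂ)}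

theorem IsChainTriangulation.finite (hT : IsChainTriangulation q i j T) : T.Finite := by
  have hS : (q '' Set.Icc i j).Finite := (Set.finite_Icc i j).image q
  refine (hS.toFinset.powerset.finite_toSet).subset fun t ht => ?_
  simp only [Finset.coe_powerset, Set.mem_preimage, Set.mem_powerset_iff, Set.Finite.coe_toFinset]
  exact hT.vertices_mem t ht

/-- Only the base edge may be missed by `covers`. Its points are limits of hull points shifted
towards `q u`, and a finite union of triangles is closed. -/
theorem IsChainTriangulation.iUnion_eq (hT : IsChainTriangulation q i j T) {u : ℕ}
    (hq : WeaklyConvex q i j) (hu : u ∈ Set.Icc i j) (hpos : 0 < orient (q i) (q u) (q j)) :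
    ⋃ t ∈ T, convexHull ℝ (t : Set ℂ) = convexHull ℝ (q '' Set.Icc i j) := by
  apply Set.Subset.antisymm
  · exact Set.iUnion₂_subset fun t ht => convexHull_mono (hT.vertices_mem t ht)
  · intro z hz
    have hcl : IsClosed (⋃ t ∈ T, convexHull ℝ (t : Set ℂ)) :=
      hT.finite.isClosed_biUnion fun t _ => t.finite_toSet.isClosed_convexHull (𝕜 := ℝ)
    have hc : Tendsto (fun e : ℝ => (AffineMap.lineMap z (q u) e : ℂ)) (𝓝[>] 0) (𝓝 z) := by
      have : ContinuousAt (fun e : ℝ => (AffineMap.lineMap z (q u) e : ℂ)) 0 :=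
        AffineMap.lineMap_continuous.continuousAt
      have h2 := this.tendsto.mono_left (nhdsWithin_le_nhds (s := Set.Ioi 0))
      simpa using h2
    refine hcl.mem_of_tendsto hc ?_
    filter_upwards [Ioo_mem_nhdsGT (show (0 : ℝ) < 1 by norm_num)] with e he
    have hm : (AffineMap.lineMap z (q u) e : ℂ) ∈ convexHull ℝ (q '' Set.Icc i j) :=
      (convex_convexHull ℝ _).segment_subset hz (subset_convexHull _ _ (Set.mem_image_of_mem q hu))
        (lineMap_mem_segment_of_le he.1.le he.2.le)
    have hns : (AffineMap.lineMap z (q u) e : ℂ) ∉ segment ℝ (q i) (q j) := by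
      intro hs
      rw [segment_eq_image_lineMap] at hs
      obtain ⟨s, _, hs⟩ := hs
      have h0 : orient (q j) (q i) (AffineMap.lineMap z (q u) e) = 0 := by
        rw [← hs, orient_lineMap]; simp
      rw [orient_lineMap] at h0
      have h1 := hq.orient_base_nonneg hz
      have h2 : 0 < orient (q j) (q i) (q u) := by rwa [← orient_rotate]
      have := mul_pos he.1 h2
      have := mul_nonneg (sub_nonneg.2 he.2.le) h1
      linarith
    obtain ⟨t, ht, hzt⟩ := hT.covers _ hm hns
    exact Set.mem_biUnion ht hzt

/-- Some triangle covers the midpoint of the base. Since the whole chain lies on one side of the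
base line, the vertices carrying positive weight in the midpoint lie on that line. None is strictly
between the ends, so there is one beyond or at each end; the triangle then contains both ends, which
must be vertices. -/
theorem exists_base_triangle (hT : IsChainTriangulation q i j T) (hq : WeaklyConvex q i j)
    (hij : i < j) (hclean : ∀ w ∈ Set.Icc i j, q w ∈ segment ℝ (q i) (q j) → w = i ∨ w = j) {u : ℕ}
    (hu : u ∈ Set.Icc i j) (hpos : 0 < orient (q i) (q u) (q j)) :
    ∃ t ∈ T, q i ∈ t ∧ q j ∈ t := by
  have hne : q i ≠ q j := by intro h; simp [h] at hpos
  have hiS : q i ∈ q '' Set.Icc i j := Set.mem_image_of_mem q (Set.left_mem_Icc.2 hij.le)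
  have hjS : q j ∈ q '' Set.Icc i j := Set.mem_image_of_mem q (Set.right_mem_Icc.2 hij.le)
  have hM : (AffineMap.lineMap (q i) (q j) (1 / 2 : ℝ) : ℂ) ∈ convexHull ℝ (q '' Set.Icc i j) :=
    segment_subset_hull hij.le (lineMap_mem_segment_of_le (by norm_num) (by norm_num))
  rw [← hT.iUnion_eq hq hu hpos] at hM
  simp only [Set.mem_iUnion] at hM
  obtain ⟨t, ht, hMt⟩ := hM
  refine ⟨t, ht, ?_⟩
  rw [Finset.mem_convexHull'] at hMt
  obtain ⟨w, hw0, hw1, hwM⟩ := hMt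
  have hl : ∀ x ∈ t, 0 ≤ orient (q j) (q i) x := fun x hx =>
    hq.orient_base_nonneg (subset_convexHull _ _ (hT.vertices_mem t ht hx))
  have hsum : ∑ x ∈ t, w x * orient (q j) (q i) x = 0 := by
    have := orient_sum t w id hw1 (q j) (q i)
    simp only [id] at this
    rw [← this, hwM, orient_lineMap]; simp
  rw [Finset.sum_eq_zero_iff_of_nonneg fun x hx => mul_nonneg (hw0 x hx) (hl x hx)] at hsum
  -- A vertex of weight zero need not lie on the line; it gets the dummy parameter 0.
  have hline : ∀ x ∈ t, ∃ s : ℝ, (w x ≠ 0 → x = AffineMap.lineMap (q i) (q j) s) ∧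
      (w x = 0 → s = 0) ∧ (s ≤ 0 ∨ 1 ≤ s) := by
    intro x hx
    by_cases hwx : w x = 0
    · exact ⟨0, by simp [hwx]⟩
    · have h0 := (mul_eq_zero.1 (hsum x hx)).resolve_left hwx
      rw [orient_swap', neg_eq_zero] at h0
      obtain ⟨s, hs⟩ := exists_lineMap_of_orient_eq_zero hne h0
      refine ⟨s, fun _ => hs, fun h => absurd h hwx, ?_⟩
      by_contra hc
      push Not at hc
      obtain ⟨v, hv, rfl⟩ := hT.vertices_mem t ht hx
      rcases hclean v hv (hs ▸ lineMap_mem_segment_of_le hc.1.le hc.2.le) with rfl | rfl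
      · rw [eq_comm, AffineMap.lineMap_eq_left_iff] at hs
        rcases hs with hs | hs
        · exact hne hs
        · linarith
      · rw [eq_comm, AffineMap.lineMap_eq_right_iff] at hs
        rcases hs with hs | hs
        · exact hne hs
        · linarith
  choose! s hs hs' hs'' using hline
  have hs1 : ∑ x ∈ t, w x * s x = 1 / 2 := by
    have h1 : ∑ x ∈ t, w x • x = AffineMap.lineMap (q i) (q j) (∑ x ∈ t, w x * s x) := by
      have h2 : ∀ x ∈ t, w x • x = w x • q i + (w x * s x) • (q j - q i) := by
        intro x hx
        by_cases hwx : w x = 0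
        · simp [hwx]
        · have e := hs x hx hwx
          revert e
          generalize w x = a
          generalize s x = b
          rintro rfl
          simp [AffineMap.lineMap_apply]; ring
      rw [Finset.sum_congr rfl h2, Finset.sum_add_distrib, ← Finset.sum_smul, ← Finset.sum_smul,
        hw1]
      simp [AffineMap.lineMap_apply]; ring
    rw [hwM] at h1
    exact (AffineMap.lineMap_injective ℝ hne h1).symm
  have hlo : ∃ x ∈ t, w x ≠ 0 ∧ s x ≤ 0 := by
    by_contra hc
    push Not at hc
    have : ∑ x ∈ t, w x ≤ ∑ x ∈ t, w x * s x := by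
      refine Finset.sum_le_sum fun x hx => ?_
      by_cases hwx : w x = 0
      · simp [hwx]
      · have := (hs'' x hx).resolve_left (not_le.2 (hc x hx hwx))
        nlinarith [hw0 x hx]
    linarith
  have hhi : ∃ x ∈ t, w x ≠ 0 ∧ 1 ≤ s x := by
    by_contra hc
    push Not at hc
    have : ∑ x ∈ t, w x * s x ≤ 0 := by
      refine Finset.sum_nonpos fun x hx => ?_
      by_cases hwx : w x = 0
      · simp [hwx]
      · have := (hs'' x hx).resolve_right (not_le.2 (hc x hx hwx))
        nlinarith [hw0 x hx]
    linarith
  obtain ⟨x, hx, hwx, hsx⟩ := hlo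
  obtain ⟨y, hy, hwy, hsy⟩ := hhi
  have hseg : ∀ e : ℝ, 0 ≤ e → e ≤ 1 →
      (AffineMap.lineMap (q i) (q j) e : ℂ) ∈ convexHull ℝ (t : Set ℂ) := by
    intro e he0 he1
    have h1 : (AffineMap.lineMap (q i) (q j) e : ℂ) =
        AffineMap.lineMap x y ((e - s x) / (s y - s x)) := by
      have h3 : s y - s x ≠ 0 := by linarith
      have h2 : e = s x + (e - s x) / (s y - s x) * (s y - s x) := by field_simp; ring
      generalize (e - s x) / (s y - s x) = f at h2
      rw [hs x hx hwx, hs y hy hwy, h2]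
      simp [AffineMap.lineMap_apply]; ring
    rw [h1]
    refine segment_subset_convexHull hx hy (lineMap_mem_segment_of_le ?_ ?_)
    · apply div_nonneg <;> linarith
    · rw [div_le_one (by linarith)]; linarith
  constructor
  · have := hseg 0 le_rfl zero_le_one
    rw [AffineMap.lineMap_apply_zero] at this
    exact hT.no_other_point t ht ⟨this, hiS⟩
  · have := hseg 1 zero_le_one le_rfl
    rw [AffineMap.lineMap_apply_one] at this
    exact hT.no_other_point t ht ⟨this, hjS⟩

open Classical in
theorem exists_apex (hT : IsChainTriangulation q i j T) (hq : WeaklyConvex q i j)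
    (hij : i < j) (hclean : ∀ w ∈ Set.Icc i j, q w ∈ segment ℝ (q i) (q j) → w = i ∨ w = j) {u : ℕ}
    (hu : u ∈ Set.Icc i j) (hpos : 0 < orient (q i) (q u) (q j)) :
    ∃ m, IsApex q i m j ∧ ({q i, q m, q j} : Finset ℂ) ∈ T := by
  obtain ⟨t, ht, hti, htj⟩ := exists_base_triangle hT hq hij hclean hu hpos
  have hne : q i ≠ q j := by intro h; simp [h] at hpos
  have hc : ((t.erase (q i)).erase (q j)).card = 1 := by
    rw [Finset.card_erase_of_mem (by simp [hne.symm, htj]), Finset.card_erase_of_mem hti,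
      hT.card_eq_three t ht]
  obtain ⟨x, hx⟩ := Finset.card_eq_one.1 hc
  have hxm : x ∈ (t.erase (q i)).erase (q j) := by simp [hx]
  simp only [Finset.mem_erase] at hxm
  obtain ⟨hxj, hxi, hxt⟩ := hxm
  obtain ⟨m, hm, rfl⟩ := hT.vertices_mem t ht hxt
  have hmi : m ≠ i := by rintro rfl; exact hxi rfl
  have hmj : m ≠ j := by rintro rfl; exact hxj rfl
  have him : i < m := lt_of_le_of_ne hm.1 hmi.symm
  have hmj : m < j := lt_of_le_of_ne hm.2 hmj
  have htt : t = {q i, q m, q j} := by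
    rw [← Finset.insert_erase hti, ← Finset.insert_erase (s := t.erase (q i)) (a := q j)
      (by simp [hne.symm, htj]), hx]
    ext z; simp; tauto
  have h0 := orient_ne_zero_of_affineIndependent (hT.nondegenerate t ht) hti hxt htj hxi.symm hne
    hxj
  refine ⟨m, ⟨him, hmj, lt_of_le_of_ne (hq.orient_nonneg i m j le_rfl him hmj le_rfl) h0.symm,
    fun w hw hwt => ?_⟩, htt ▸ ht⟩
  have h1 : q w ∈ (t : Set ℂ) := hT.no_other_point t ht
    ⟨by rw [htt]; simpa using hwt, Set.mem_image_of_mem q hw⟩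
  rw [htt] at h1
  simp only [Finset.coe_insert, Finset.coe_singleton, Set.mem_insert_iff,
    Set.mem_singleton_iff] at h1
  rcases h1 with h1 | h1 | h1
  · exact Or.inl (hq.injOn hw ⟨le_rfl, hij.le⟩ h1)
  · exact Or.inr (Or.inl (hq.injOn hw hm h1))
  · exact Or.inr (Or.inr (hq.injOn hw ⟨hij.le, le_rfl⟩ h1))

theorem IsChainTriangulation.eq_of_mem_interior (hT : IsChainTriangulation q i j T)
    {s t : Finset ℂ} (hs : s ∈ T) (ht : t ∈ T) {z : ℂ} (hzs : z ∈ convexHull ℝ (s : Set ℂ))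
    (hzt : z ∈ interior (convexHull ℝ (t : Set ℂ))) : s = t := by
  by_contra hne
  obtain ⟨w, hw⟩ := (convex_convexHull ℝ (s : Set ℂ)).interior_inter_nonempty
    (interior_convexHull_nonempty (hT.card_eq_three s hs) (hT.nondegenerate s hs)) hzs hzt
  exact Set.disjoint_left.1 (hT.noncrossing s hs t ht hne) hw.1 hw.2

end triangulation

/-! ### The base triangle separates the others -/

theorem mem_segment_of_eq_lineMap {a b c : ℂ} {s : ℝ} (h : c = AffineMap.lineMap a b s)
    (hs : 1 < s) : b ∈ segment ℝ a c := by
  have : b = AffineMap.lineMap a c (1 / s) := by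
    have hs0 : (s : ℂ) ≠ 0 := by exact_mod_cast (by linarith : s ≠ 0)
    rw [h]; simp [AffineMap.lineMap_apply]; field_simp; ring
  rw [this]
  exact lineMap_mem_segment_of_le (by positivity) (by rw [div_le_one (by linarith)]; exact hs.le)

theorem orient_eq_zero_of_mem_segment {a b c : ℂ} (h : c ∈ segment ℝ a b) :
    orient a b c = 0 := by
  rw [segment_eq_image_lineMap] at h
  obtain ⟨s, _, rfl⟩ := h
  rw [orient_lineMap]; simp

/-- An open half-plane together with a single point of its boundary line is still convex. -/
theorem eq_of_orient_eq_zero {S : Set ℂ} {a b p z : ℂ} (h : ∀ x ∈ S, x = p ∨ 0 < orient a b x)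
    (hp : orient a b p = 0) (hz : z ∈ convexHull ℝ S) (hz0 : orient a b z = 0) : z = p := by
  have hconv : Convex ℝ {x | x = p ∨ 0 < orient a b x} := by
    rintro x hx y hy s t hs ht hst
    simp only [Set.mem_ofPred_eq] at *
    rw [orient_combo _ _ _ _ hst]
    rcases hx with rfl | hx <;> rcases hy with rfl | hy
    · left; rw [← add_smul, hst, one_smul]
    · rcases ht.eq_or_lt with rfl | ht
      · left; simp at hst; simp [hst]
      · right; rw [hp]; have := mul_pos ht hy; linarith
    · rcases hs.eq_or_lt with rfl | hs
      · left; simp at hst; simp [hst]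
      · right; rw [hp]; have := mul_pos hs hx; linarith
    · right
      rcases hs.eq_or_lt with rfl | hs
      · simp at hst; simp [hst, hy]
      · have := mul_pos hs hx; have := mul_nonneg ht hy.le; linarith
  rcases convexHull_min h hconv hz with h1 | h1
  · exact h1
  · exact absurd h1 (by rw [hz0]; exact lt_irrefl 0)

section triangulation

variable {q : ℕ → ℂ} {i m j : ℕ} {T : Set (Finset ℂ)}

theorem IsChainTriangulation.not_between (hT : IsChainTriangulation q i j T)
    {t : Finset ℂ} (ht : t ∈ T) {x y : ℂ} (hx : x ∈ t) (hy : y ∈ t) {w : ℕ} (hw : w ∈ Set.Icc i j)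
    (hs : q w ∈ segment ℝ x y) (hxy : x ≠ y) : q w = x ∨ q w = y := by
  by_contra hc
  push Not at hc
  have hwt : q w ∈ t := hT.no_other_point t ht
    ⟨segment_subset_convexHull hx hy hs, Set.mem_image_of_mem q hw⟩
  exact orient_ne_zero_of_affineIndependent (hT.nondegenerate t ht) hx hy hwt hxy hc.1.symm
    hc.2.symm (orient_eq_zero_of_mem_segment hs)

theorem tendsto_lineMap_zero (a b : ℂ) :
    Tendsto (fun e : ℝ => (AffineMap.lineMap a b e : ℂ)) (𝓝[>] 0) (𝓝 a) := by
  have : ContinuousAt (fun e : ℝ => (AffineMap.lineMap a b e : ℂ)) 0 :=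
    AffineMap.lineMap_continuous.continuousAt
  have h2 := this.tendsto.mono_left (nhdsWithin_le_nhds (s := Set.Ioi 0))
  simpa using h2

theorem eventually_orient_lineMap_pos {p r a : ℂ} (b : ℂ) (h : 0 < orient p r a) :
    ∀ᶠ e : ℝ in 𝓝[>] 0, 0 < orient p r (AffineMap.lineMap a b e) :=
  (((continuous_orient p r).tendsto a).comp (tendsto_lineMap_zero a b)).eventually_const_lt h

open Classical in
-- A triangle with vertices `q u` and `q v`, `u < m < v`, would contain a point interior to the base
-- triangle and so coincide with it. Such a point is found on the segment from `q u` to `q v`, close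
-- to an end if that end is an end of the base; if both are, the midpoint is moved slightly towards
-- the third vertex. Collinear positions are excluded because no chain point lies inside a side of a
-- triangle.
theorem IsChainTriangulation.subset_or_subset (hT : IsChainTriangulation q i j T)
    (hq : WeaklyConvex q i j) (hm : IsApex q i m j) (h0 : ({q i, q m, q j} : Finset ℂ) ∈ T)
    {t : Finset ℂ} (ht : t ∈ T) (hne : t ≠ {q i, q m, q j}) :
    (t : Set ℂ) ⊆ q '' Set.Icc i m ∨ (t : Set ℂ) ⊆ q '' Set.Icc m j := by
  by_contra hc
  push Not at hc
  simp only [Set.not_subset] at hc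
  obtain ⟨⟨x, hxt, hx⟩, ⟨y, hyt, hy⟩⟩ := hc
  rw [Finset.mem_coe] at hxt hyt
  obtain ⟨v, hv, rfl⟩ := hT.vertices_mem t ht hxt
  obtain ⟨u, hu, rfl⟩ := hT.vertices_mem t ht hyt
  have him := hm.left_lt
  have hmj := hm.lt_right
  have hmI : m ∈ Set.Icc i j := ⟨him.le, hmj.le⟩
  have hiI : i ∈ Set.Icc i j := ⟨le_rfl, by omega⟩
  have hjI : j ∈ Set.Icc i j := ⟨by omega, le_rfl⟩
  have hmv : m < v := by
    by_contra h; exact hx ⟨v, ⟨hv.1, not_lt.1 h⟩, rfl⟩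
  have hum : u < m := by
    by_contra h; exact hy ⟨u, ⟨not_lt.1 h, hu.2⟩, rfl⟩
  have hp := hm.orient_pos
  have hp1 : 0 < orient (q m) (q j) (q i) := by rwa [orient_rotate]
  have hp2 : 0 < orient (q j) (q i) (q m) := by rwa [orient_rotate, orient_rotate]
  have hinj : ∀ a ∈ Set.Icc i j, ∀ b ∈ Set.Icc i j, a ≠ b → q a ≠ q b :=
    fun a ha b hb hab h => hab (hq.injOn ha hb h)
  have hnot : ∀ X ∈ convexHull ℝ (t : Set ℂ), 0 < orient (q i) (q m) X →
      0 < orient (q m) (q j) X → 0 < orient (q j) (q i) X → False := by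
    intro X hX h1 h2 h3
    refine hne (hT.eq_of_mem_interior ht h0 hX ?_)
    simpa using mem_interior_convexHull_triple h1 h2 h3
  have hbtw : ∀ w ∈ Set.Icc i j, w ≠ u → w ≠ v → q w ∉ segment ℝ (q u) (q v) := by
    intro w hw hwu hwv hs
    rcases hT.not_between ht hyt hxt hw hs (hinj u hu v hv (by omega)) with h | h
    · exact hinj w hw u hu hwu h
    · exact hinj w hw v hv hwv h
  rcases hu.1.eq_or_lt with rfl | hiu <;> rcases hv.2.eq_or_lt with rfl | hvj
  · have hcard : 0 < ((t.erase (q i)).erase (q v)).card := by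
      rw [Finset.card_erase_of_mem (by simp [(hinj i hiI v hjI (by omega)).symm, hxt]),
        Finset.card_erase_of_mem hyt, hT.card_eq_three t ht]
      norm_num
    obtain ⟨x, hx⟩ := Finset.card_pos.1 hcard
    simp only [Finset.mem_erase] at hx
    have hx0 := orient_ne_zero_of_affineIndependent (hT.nondegenerate t ht) hxt hyt hx.2.2
      (hinj _ hjI _ hiI (by omega)) (Ne.symm hx.1) (Ne.symm hx.2.1)
    have hx1 := lt_of_le_of_ne
      (hq.orient_base_nonneg (subset_convexHull _ _ (hT.vertices_mem t ht hx.2.2))) hx0.symm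
    have e1 : 0 < orient (q i) (q m) (AffineMap.lineMap (q i) (q v) (1 / 2 : ℝ)) := by
      rw [orient_lineMap, orient_self_outer]; linarith
    have e2 : 0 < orient (q m) (q v) (AffineMap.lineMap (q i) (q v) (1 / 2 : ℝ)) := by
      rw [orient_lineMap, orient_self_right]; linarith
    obtain ⟨e, ⟨⟨h1, h2⟩, he0, he1⟩⟩ := (((eventually_orient_lineMap_pos x e1).and
      (eventually_orient_lineMap_pos x e2)).and
      (Ioo_mem_nhdsGT (show (0 : ℝ) < 1 by norm_num))).exists
    refine hnot _ ?_ h1 h2 ?_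
    · refine (convex_convexHull ℝ _).segment_subset ?_ (subset_convexHull _ _ hx.2.2)
        (lineMap_mem_segment_of_le he0.le he1.le)
      exact segment_subset_convexHull hyt hxt
        (lineMap_mem_segment_of_le (by norm_num) (by norm_num))
    · rw [orient_lineMap, orient_lineMap]
      simp only [orient_self_outer, orient_self_right]
      have := mul_pos he0 hx1
      linarith
  · have h1 : 0 ≤ orient (q i) (q m) (q v) := hq.orient_nonneg i m v le_rfl him hmv hvj.le
    have h2 : 0 ≤ orient (q i) (q v) (q j) := hq.orient_nonneg i v j le_rfl (by omega) hvj le_rfl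
    rcases h1.eq_or_lt with h1 | h1
    · obtain ⟨s, hs⟩ := exists_lineMap_of_orient_eq_zero hm.ne_left h1.symm
      rw [hs, orient_lineMap_mid, orient_self_left] at h2
      have hs0 : 0 ≤ s := by by_contra hc; push Not at hc; nlinarith
      by_cases hs1 : s ≤ 1
      · have := hm.of_mem_segment_left hv (hs ▸ lineMap_mem_segment_of_le hs0 hs1)
        omega
      · exact hbtw m hmI (by omega) (by omega) (mem_segment_of_eq_lineMap hs (not_le.1 hs1))
    rcases h2.eq_or_lt with h2 | h2
    · rw [orient_swap, zero_eq_neg] at h2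
      obtain ⟨s, hs⟩ := exists_lineMap_of_orient_eq_zero (hinj i hiI j hjI (by omega)) h2
      rw [hs, orient_lineMap, orient_self_outer] at h1
      have hs0 : 0 ≤ s := by by_contra hc; push Not at hc; nlinarith
      by_cases hs1 : s ≤ 1
      · have := hm.empty v hv (segment_subset_convexHull (by simp) (by simp)
          (hs ▸ lineMap_mem_segment_of_le hs0 hs1))
        omega
      · exact hbtw j hjI (by omega) (by omega) (mem_segment_of_eq_lineMap hs (not_le.1 hs1))
    obtain ⟨e, ⟨h3, he0, he1⟩⟩ := ((eventually_orient_lineMap_pos (q v) hp1).and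
      (Ioo_mem_nhdsGT (show (0 : ℝ) < 1 by norm_num))).exists
    refine hnot _ (segment_subset_convexHull hyt hxt
      (lineMap_mem_segment_of_le he0.le he1.le)) ?_ h3 ?_
    · rw [orient_lineMap, orient_self_outer]
      have := mul_pos he0 h1
      linarith
    · rw [orient_lineMap, orient_self_right, ← orient_rotate]
      have := mul_pos he0 h2
      linarith
  · have h1 : 0 ≤ orient (q u) (q m) (q v) := hq.orient_nonneg u m v hiu.le hum hmj le_rfl
    have h2 : 0 ≤ orient (q i) (q u) (q v) := hq.orient_nonneg i u v le_rfl hiu (by omega) le_rfl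
    rcases h1.eq_or_lt with h1 | h1
    · have h1' : orient (q v) (q m) (q u) = 0 := by rw [orient_rotate, orient_swap, ← h1, neg_zero]
      obtain ⟨s, hs⟩ := exists_lineMap_of_orient_eq_zero hm.ne_right.symm h1'
      rw [hs, orient_lineMap_mid, orient_self_right] at h2
      have hs0 : 0 ≤ s := by by_contra hc; push Not at hc; nlinarith
      by_cases hs1 : s ≤ 1
      · have := hm.of_mem_segment_right hu
          (segment_symm ℝ (q v) (q m) ▸ hs ▸ lineMap_mem_segment_of_le hs0 hs1)
        omega
      · exact hbtw m hmI (by omega) (by omega)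
          (segment_symm ℝ (q v) (q u) ▸ mem_segment_of_eq_lineMap hs (not_le.1 hs1))
    have h2' : orient (q v) (q i) (q u) = orient (q i) (q u) (q v) := by
      rw [orient_rotate, orient_rotate]
    rw [← h2'] at h2
    rcases h2.eq_or_lt with h2 | h2
    · obtain ⟨s, hs⟩ := exists_lineMap_of_orient_eq_zero (hinj v hjI i hiI (by omega)) h2.symm
      rw [hs, orient_lineMap_left, orient_self_outer] at h1
      have hs0 : 0 ≤ s := by by_contra hc; push Not at hc; nlinarith
      by_cases hs1 : s ≤ 1
      · have := hm.empty u hu (segment_subset_convexHull (by simp) (by simp)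
          (hs ▸ lineMap_mem_segment_of_le hs0 hs1))
        omega
      · exact hbtw i hiI (by omega) (by omega)
          (segment_symm ℝ (q v) (q u) ▸ mem_segment_of_eq_lineMap hs (not_le.1 hs1))
    obtain ⟨e, ⟨h3, he0, he1⟩⟩ := ((eventually_orient_lineMap_pos (q u) hp).and
      (Ioo_mem_nhdsGT (show (0 : ℝ) < 1 by norm_num))).exists
    refine hnot _ (segment_subset_convexHull hxt hyt
      (lineMap_mem_segment_of_le he0.le he1.le)) h3 ?_ ?_
    · rw [orient_lineMap, orient_self_right, orient_rotate]
      have := mul_pos he0 h1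
      linarith
    · rw [orient_lineMap, orient_self_outer]
      have := mul_pos he0 h2
      linarith
  · have hA := hm.orient_left hq hiu hum
    have hB := hm.orient_cut_left hq hiu hum hmv hvj.le
    have hC := hm.orient_cut_right hq hiu.le hum hmv hvj
    have hD := hm.orient_right hq hmv hvj
    have hE := hq.orient_nonneg u m v hiu.le hum hmv hvj.le
    have hF := hq.orient_base_nonneg (subset_convexHull _ _ (Set.mem_image_of_mem q hu))
    have hG := hq.orient_base_nonneg (subset_convexHull _ _ (Set.mem_image_of_mem q hv))
    have hneum : q u ≠ q m := hinj u hu m hmI (by omega)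
    have hneij : q i ≠ q j := hinj i hiI j hjI (by omega)
    rcases hE.eq_or_lt with hE | hE
    · obtain ⟨s, hs⟩ := exists_lineMap_of_orient_eq_zero hneum hE.symm
      rw [hs, orient_lineMap, orient_self_right, orient_swap] at hB
      have hs1 : 1 < s := by by_contra hc; push Not at hc; nlinarith
      exact hbtw m hmI (by omega) (by omega) (mem_segment_of_eq_lineMap hs hs1)
    -- If both points were on the base line, they would lie beyond its two ends and `q i` would be
    -- between them.
    by_cases hFG : orient (q j) (q i) (q u) = 0 ∧ orient (q j) (q i) (q v) = 0
    · obtain ⟨hF0, hG0⟩ := hFG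
      rw [orient_swap', neg_eq_zero] at hF0 hG0
      obtain ⟨s, hs⟩ := exists_lineMap_of_orient_eq_zero hneij hF0
      obtain ⟨s', hs'⟩ := exists_lineMap_of_orient_eq_zero hneij hG0
      rw [hs, orient_lineMap_mid, orient_self_left, orient_swap] at hA
      have h1 : s < 0 := by by_contra hc; push Not at hc; nlinarith
      rw [hs', orient_lineMap_mid, orient_self_right, orient_swap'] at hD
      have h2 : 1 < s' := by by_contra hc; push Not at hc; nlinarith
      refine hbtw i hiI (by omega) (by omega) ?_
      have : q i = AffineMap.lineMap (q u) (q v) (-s / (s' - s)) := by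
        have h3 : s' - s ≠ 0 := by linarith
        have h4 : 0 = s + -s / (s' - s) * (s' - s) := by field_simp; ring
        generalize -s / (s' - s) = f at h4
        rw [hs, hs']
        have h5 : (0 : ℂ) = s + f * (s' - s) := by exact_mod_cast h4
        simp only [AffineMap.lineMap_apply, vsub_eq_sub, vadd_eq_add, Complex.real_smul]
        linear_combination (q j - q i) * h5
      rw [this]
      exact lineMap_mem_segment_of_le (by apply div_nonneg <;> linarith)
        (by rw [div_le_one (by linarith)]; linarith)
    -- The three-term Plücker relation; it gives `B * C - A * D > 0`.
    have hI : orient (q i) (q m) (q v) * orient (q u) (q m) (q j) -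
        orient (q i) (q u) (q m) * orient (q m) (q v) (q j) =
        orient (q u) (q m) (q v) * orient (q i) (q m) (q j) := by
      simp only [orient]; ring
    have hEp := mul_pos hE hp
    rw [← hI] at hEp
    set A := orient (q i) (q u) (q m) with hAd
    set B := orient (q i) (q m) (q v) with hBd
    set C := orient (q u) (q m) (q j) with hCd
    set D := orient (q m) (q v) (q j) with hDd
    have hS : 0 < A + B + C + D := by positivity
    -- The segment is beyond the line of the left leg after parameter A/(A+B) and before that of the
    -- right leg until C/(C+D). The mediant of these two fractions lies strictly between them.
    have hl0 : 0 < (A + C) / (A + B + C + D) := by positivity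
    have hl1 : (A + C) / (A + B + C + D) < 1 := by rw [div_lt_one hS]; linarith
    have hlm : (A + C) / (A + B + C + D) * (A + B + C + D) = A + C := div_mul_cancel₀ _ hS.ne'
    generalize (A + C) / (A + B + C + D) = l at hl0 hl1 hlm
    refine hnot _ (segment_subset_convexHull hyt hxt
      (lineMap_mem_segment_of_le hl0.le hl1.le)) ?_ ?_ ?_
    · rw [orient_lineMap, orient_swap, ← hAd, ← hBd]
      refine pos_of_mul_pos_left (b := A + B + C + D) ?_ hS.le
      have : ((1 - l) * -A + l * B) * (A + B + C + D) = B * C - A * D := by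
        linear_combination (A + B) * hlm
      rwa [this]
    · rw [orient_lineMap, orient_rotate, orient_swap (q m) (q v), ← hCd, ← hDd]
      refine pos_of_mul_pos_left (b := A + B + C + D) ?_ hS.le
      have : ((1 - l) * C + l * -D) * (A + B + C + D) = B * C - A * D := by
        linear_combination -(C + D) * hlm
      rwa [this]
    · rw [orient_lineMap]
      have h1 := mul_nonneg (sub_nonneg.2 hl1.le) hF
      have h2 := mul_nonneg hl0.le hG
      by_contra hc
      refine hFG ⟨?_, ?_⟩
      · have : (1 - l) * orient (q j) (q i) (q u) = 0 := by linarith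
        exact (mul_eq_zero.1 this).resolve_left (by linarith)
      · have : l * orient (q j) (q i) (q v) = 0 := by linarith
        exact (mul_eq_zero.1 this).resolve_left (by linarith)

end triangulation

/-! ### The recursion for chains -/

section recursion

variable {q : ℕ → ℂ} {i m j : ℕ} {T : Set (Finset ℂ)}

/-- The two hulls lie on opposite sides of the line of the leg. Either some left point is cut off,
and the right hull meets this line only in `q m`, or the left hull is just the leg. -/
theorem IsApex.mem_segment_left (hq : WeaklyConvex q i j) (hm : IsApex q i m j) {z : ℂ}
    (hl : z ∈ convexHull ℝ (q '' Set.Icc i m)) (hr : z ∈ convexHull ℝ (q '' Set.Icc m j)) :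
    z ∈ segment ℝ (q i) (q m) := by
  by_cases hu : ∃ u, i < u ∧ u < m
  · obtain ⟨u, hiu, hum⟩ := hu
    have h0 := le_antisymm (hm.orient_left_hull hq hl) (hm.orient_left_hull' hq hr)
    have : z = q m := by
      refine eq_of_orient_eq_zero ?_ (orient_self_right (q i) (q m)) hr h0
      rintro _ ⟨v, hv, rfl⟩
      rcases hv.1.eq_or_lt with rfl | hv1
      · exact Or.inl rfl
      · exact Or.inr (hm.orient_cut_left hq hiu hum hv1 hv.2)
    rw [this]; exact right_mem_segment _ _ _
  · rw [← convexHull_pair]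
    refine convexHull_mono ?_ hl
    rintro _ ⟨w, hw, rfl⟩
    rcases hw.1.eq_or_lt with rfl | hw1
    · simp
    rcases hw.2.eq_or_lt with rfl | hw2
    · simp
    exact absurd ⟨w, hw1, hw2⟩ hu

theorem IsApex.mem_segment_right (hq : WeaklyConvex q i j) (hm : IsApex q i m j) {z : ℂ}
    (hl : z ∈ convexHull ℝ (q '' Set.Icc i m)) (hr : z ∈ convexHull ℝ (q '' Set.Icc m j)) :
    z ∈ segment ℝ (q m) (q j) := by
  by_cases hv : ∃ v, m < v ∧ v < j
  · obtain ⟨v, hmv, hvj⟩ := hv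
    have h0 := le_antisymm (hm.orient_right_hull hq hr) (hm.orient_right_hull' hq hl)
    have : z = q m := by
      refine eq_of_orient_eq_zero ?_ (orient_self_outer (q m) (q j)) hl h0
      rintro _ ⟨u, hu, rfl⟩
      rcases hu.2.eq_or_lt with rfl | hu1
      · exact Or.inl rfl
      · rw [orient_rotate]
        exact Or.inr (hm.orient_cut_right hq hu.1 hu1 hmv hvj)
    rw [this]; exact left_mem_segment _ _ _
  · rw [← convexHull_pair]
    refine convexHull_mono ?_ hr
    rintro _ ⟨w, hw, rfl⟩
    rcases hw.1.eq_or_lt with rfl | hw1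
    · simp
    rcases hw.2.eq_or_lt with rfl | hw2
    · simp
    exact absurd ⟨w, hw1, hw2⟩ hv

theorem IsApex.not_mem_left (hq : WeaklyConvex q i j) (hm : IsApex q i m j) :
    q j ∉ q '' Set.Icc i m := by
  have := hm.left_lt
  have := hm.lt_right
  rintro ⟨w, hw, h⟩
  have := hq.injOn ⟨hw.1, by have := hw.2; omega⟩ ⟨by omega, le_rfl⟩ h
  have := hw.2; omega

theorem IsApex.not_mem_right (hq : WeaklyConvex q i j) (hm : IsApex q i m j) :
    q i ∉ q '' Set.Icc m j := by
  have := hm.left_lt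
  have := hm.lt_right
  rintro ⟨w, hw, h⟩
  have := hq.injOn ⟨by have := hw.1; omega, hw.2⟩ ⟨le_rfl, by omega⟩ h
  have := hw.1; omega

theorem IsApex.not_subset_both (hq : WeaklyConvex q i j) (hm : IsApex q i m j) {t : Finset ℂ}
    (ht : t.card = 3) (hl : (t : Set ℂ) ⊆ q '' Set.Icc i m) (hr : (t : Set ℂ) ⊆ q '' Set.Icc m j) :
    False := by
  have h1 : t ⊆ {q m} := by
    intro x hx
    obtain ⟨a, ha, rfl⟩ := hl hx
    obtain ⟨b, hb, hab⟩ := hr hx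
    have := hm.left_lt
    have := hm.lt_right
    have h1 := ha.1; have h2 := ha.2; have h3 := hb.1; have h4 := hb.2
    have := hq.injOn ⟨by omega, by omega⟩ ⟨by omega, by omega⟩ hab
    obtain rfl : a = m := by omega
    simp
  have := Finset.card_le_card h1
  rw [ht, Finset.card_singleton] at this
  omega

theorem IsApex.mem_segment_left_of_triangle (hm : IsApex q i m j) {z : ℂ}
    (hz : z ∈ convexHull ℝ ({q i, q m, q j} : Set ℂ)) (hz0 : orient (q i) (q m) z ≤ 0) :
    z ∈ segment ℝ (q i) (q m) := by
  have hp := hm.orient_pos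
  obtain ⟨h1, h2, h3⟩ := (mem_convexHull_triple hp).1 hz
  obtain ⟨s, rfl⟩ := exists_lineMap_of_orient_eq_zero hm.ne_left (le_antisymm hz0 h1)
  rw [orient_lineMap, orient_self_outer, orient_rotate] at h2
  rw [orient_lineMap, orient_self_right, orient_rotate, orient_rotate] at h3
  refine lineMap_mem_segment_of_le ?_ ?_ <;> by_contra hc <;> push Not at hc <;> nlinarith

theorem IsApex.mem_segment_right_of_triangle (hm : IsApex q i m j) {z : ℂ}
    (hz : z ∈ convexHull ℝ ({q i, q m, q j} : Set ℂ)) (hz0 : orient (q m) (q j) z ≤ 0) :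
    z ∈ segment ℝ (q m) (q j) := by
  have hp := hm.orient_pos
  obtain ⟨h1, h2, h3⟩ := (mem_convexHull_triple hp).1 hz
  obtain ⟨s, rfl⟩ := exists_lineMap_of_orient_eq_zero hm.ne_right (le_antisymm hz0 h2)
  rw [orient_lineMap, orient_self_right] at h1
  rw [orient_lineMap, orient_self_outer, orient_rotate, orient_rotate] at h3
  refine lineMap_mem_segment_of_le ?_ ?_ <;> by_contra hc <;> push Not at hc <;> nlinarith

open Classical in
-- A triangle that covers a point of the left hull off the leg is neither the base triangle nor a
-- right one, since those meet the left hull only within the leg.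
theorem IsChainTriangulation.left (hT : IsChainTriangulation q i j T) (hq : WeaklyConvex q i j)
    (hm : IsApex q i m j) (h0 : ({q i, q m, q j} : Finset ℂ) ∈ T) :
    IsChainTriangulation q i m {t ∈ T | (t : Set ℂ) ⊆ q '' Set.Icc i m} where
  vertices_mem t ht := ht.2
  card_eq_three t ht := hT.card_eq_three t ht.1
  nondegenerate t ht := hT.nondegenerate t ht.1
  no_other_point t ht := (Set.inter_subset_inter_right _
    (Set.image_mono (Set.Icc_subset_Icc le_rfl hm.lt_right.le))).trans (hT.no_other_point t ht.1)
  noncrossing s hs t ht := hT.noncrossing s hs.1 t ht.1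
  covers z hz hzs := by
    have hp := hm.orient_pos
    have hz' := convexHull_mono
      (Set.image_mono (f := q) (Set.Icc_subset_Icc le_rfl hm.lt_right.le)) hz
    have hz0 := hm.orient_left_hull hq hz
    obtain ⟨t, ht, hzt⟩ := hT.covers z hz' (by
      intro h
      rw [segment_eq_image_lineMap] at h
      obtain ⟨s, hs, rfl⟩ := h
      rw [orient_lineMap, orient_self_outer] at hz0
      have : s = 0 := le_antisymm (by by_contra hc; push Not at hc; nlinarith) hs.1
      rw [this, AffineMap.lineMap_apply_zero] at hzs
      exact hzs (left_mem_segment _ _ _))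
    refine ⟨t, ⟨ht, ?_⟩, hzt⟩
    by_cases htt : t = {q i, q m, q j}
    · refine absurd (hm.mem_segment_left_of_triangle ?_ hz0) hzs
      rw [htt] at hzt
      simpa using hzt
    · refine (hT.subset_or_subset hq hm h0 ht htt).resolve_right fun h => ?_
      exact hzs (hm.mem_segment_left hq hz (convexHull_mono h hzt))

open Classical in
theorem IsChainTriangulation.right (hT : IsChainTriangulation q i j T) (hq : WeaklyConvex q i j)
    (hm : IsApex q i m j) (h0 : ({q i, q m, q j} : Finset ℂ) ∈ T) :
    IsChainTriangulation q m j {t ∈ T | (t : Set ℂ) ⊆ q '' Set.Icc m j} where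
  vertices_mem t ht := ht.2
  card_eq_three t ht := hT.card_eq_three t ht.1
  nondegenerate t ht := hT.nondegenerate t ht.1
  no_other_point t ht := (Set.inter_subset_inter_right _
    (Set.image_mono (Set.Icc_subset_Icc hm.left_lt.le le_rfl))).trans (hT.no_other_point t ht.1)
  noncrossing s hs t ht := hT.noncrossing s hs.1 t ht.1
  covers z hz hzs := by
    have hp := hm.orient_pos
    have hz' := convexHull_mono
      (Set.image_mono (f := q) (Set.Icc_subset_Icc hm.left_lt.le le_rfl)) hz
    have hz0 := hm.orient_right_hull hq hz
    obtain ⟨t, ht, hzt⟩ := hT.covers z hz' (by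
      intro h
      rw [segment_eq_image_lineMap] at h
      obtain ⟨s, hs, rfl⟩ := h
      rw [orient_lineMap, orient_self_right, orient_rotate] at hz0
      have : s = 1 := le_antisymm hs.2 (by by_contra hc; push Not at hc; nlinarith)
      rw [this, AffineMap.lineMap_apply_one] at hzs
      exact hzs (right_mem_segment _ _ _))
    refine ⟨t, ⟨ht, ?_⟩, hzt⟩
    by_cases htt : t = {q i, q m, q j}
    · refine absurd (hm.mem_segment_right_of_triangle ?_ hz0) hzs
      rw [htt] at hzt
      simpa using hzt
    · refine (hT.subset_or_subset hq hm h0 ht htt).resolve_left fun h => ?_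
      exact hzs (hm.mem_segment_right hq (convexHull_mono h hzt) hz)

open Classical in
-- The lines of the two legs separate the three parts, and a hull point that is beyond neither leg
-- lies in the base triangle.
theorem IsChainTriangulation.join {A B : Set (Finset ℂ)} (hA : IsChainTriangulation q i m A)
    (hB : IsChainTriangulation q m j B) (hq : WeaklyConvex q i j) (hm : IsApex q i m j) :
    IsChainTriangulation q i j (insert {q i, q m, q j} (A ∪ B)) := by
  have him := hm.left_lt
  have hmj := hm.lt_right
  have hp := hm.orient_pos
  have hij : q i ≠ q j := by intro h; simp [h] at hp
  have hsl : q '' Set.Icc i m ⊆ q '' Set.Icc i j := Set.image_mono (Set.Icc_subset_Icc le_rfl hmj.le)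
  have hsr : q '' Set.Icc m j ⊆ q '' Set.Icc i j := Set.image_mono (Set.Icc_subset_Icc him.le le_rfl)
  have htri : ∀ z ∈ convexHull ℝ ((({q i, q m, q j} : Finset ℂ)) : Set ℂ),
      0 ≤ orient (q i) (q m) z ∧ 0 ≤ orient (q m) (q j) z := by
    intro z hz
    have := (mem_convexHull_triple hp).1 (by simpa using hz)
    exact ⟨this.1, this.2.1⟩
  have hAl : ∀ t ∈ A, ∀ z ∈ convexHull ℝ (t : Set ℂ), orient (q i) (q m) z ≤ 0 :=
    fun t ht z hz => hm.orient_left_hull hq (convexHull_mono (hA.vertices_mem t ht) hz)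
  have hBr : ∀ t ∈ B, ∀ z ∈ convexHull ℝ (t : Set ℂ), orient (q m) (q j) z ≤ 0 :=
    fun t ht z hz => hm.orient_right_hull hq (convexHull_mono (hB.vertices_mem t ht) hz)
  have hBl : ∀ t ∈ B, ∀ z ∈ convexHull ℝ (t : Set ℂ), 0 ≤ orient (q i) (q m) z :=
    fun t ht z hz => hm.orient_left_hull' hq (convexHull_mono (hB.vertices_mem t ht) hz)
  constructor
  · rintro t (rfl | ht | ht)
    · intro x hx
      simp only [Finset.coe_insert, Finset.coe_singleton, Set.mem_insert_iff,
        Set.mem_singleton_iff] at hx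
      rcases hx with rfl | rfl | rfl <;> exact Set.mem_image_of_mem q ⟨by omega, by omega⟩
    · exact (hA.vertices_mem t ht).trans hsl
    · exact (hB.vertices_mem t ht).trans hsr
  · rintro t (rfl | ht | ht)
    · rw [Finset.card_eq_three]
      exact ⟨_, _, _, hm.ne_left, hij, hm.ne_right, rfl⟩
    · exact hA.card_eq_three t ht
    · exact hB.card_eq_three t ht
  · rintro t (rfl | ht | ht)
    · exact affineIndependent_coe_triple hp.ne'
    · exact hA.nondegenerate t ht
    · exact hB.nondegenerate t ht
  · rintro t (rfl | ht | ht)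
    · rintro _ ⟨hz, w, hw, rfl⟩
      rcases hm.empty w hw (by simpa using hz) with rfl | rfl | rfl <;> simp
    · rintro _ ⟨hz, w, hw, rfl⟩
      by_cases hwm : w ≤ m
      · exact hA.no_other_point t ht ⟨hz, w, ⟨hw.1, hwm⟩, rfl⟩
      · exfalso
        have hs := hm.mem_segment_left hq (convexHull_mono (hA.vertices_mem t ht) hz)
          (subset_convexHull _ _ ⟨w, ⟨(not_le.1 hwm).le, hw.2⟩, rfl⟩)
        have := hm.of_mem_segment_left hw hs
        obtain rfl : w = j := by omega
        rw [orient_eq_zero_of_mem_segment hs] at hp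
        exact lt_irrefl _ hp
    · rintro _ ⟨hz, w, hw, rfl⟩
      by_cases hwm : m ≤ w
      · exact hB.no_other_point t ht ⟨hz, w, ⟨hwm, hw.2⟩, rfl⟩
      · exfalso
        have hs := hm.mem_segment_right hq
          (subset_convexHull _ _ ⟨w, ⟨hw.1, (not_le.1 hwm).le⟩, rfl⟩)
          (convexHull_mono (hB.vertices_mem t ht) hz)
        have := hm.of_mem_segment_right hw hs
        obtain rfl : w = i := by omega
        rw [← orient_rotate, orient_eq_zero_of_mem_segment hs] at hp
        exact lt_irrefl _ hp
  · intro z hz hzs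
    by_cases h1 : orient (q i) (q m) z < 0
    · obtain ⟨t, ht, hzt⟩ := hA.covers z (hm.mem_hull_left hq hz h1) (by
        intro h; rw [orient_eq_zero_of_mem_segment h] at h1; exact lt_irrefl _ h1)
      exact ⟨t, Or.inr (Or.inl ht), hzt⟩
    by_cases h2 : orient (q m) (q j) z < 0
    · obtain ⟨t, ht, hzt⟩ := hB.covers z (hm.mem_hull_right hq hz h2) (by
        intro h; rw [orient_eq_zero_of_mem_segment h] at h2; exact lt_irrefl _ h2)
      exact ⟨t, Or.inr (Or.inr ht), hzt⟩
    refine ⟨_, Or.inl rfl, ?_⟩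
    have := (mem_convexHull_triple hp).2 ⟨not_lt.1 h1, not_lt.1 h2, hq.orient_base_nonneg hz⟩
    simpa using this
  · rintro s (rfl | hs | hs) t (rfl | ht | ht) hst
    · exact absurd rfl hst
    · exact disjoint_interior_of_orient hm.ne_left (fun z hz => (htri z hz).1) (hAl t ht)
    · exact disjoint_interior_of_orient hm.ne_right (fun z hz => (htri z hz).2) (hBr t ht)
    · exact (disjoint_interior_of_orient hm.ne_left (fun z hz => (htri z hz).1) (hAl s hs)).symm
    · exact hA.noncrossing s hs t ht hst
    · exact (disjoint_interior_of_orient hm.ne_left (hBl t ht) (hAl s hs)).symm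
    · exact (disjoint_interior_of_orient hm.ne_right (fun z hz => (htri z hz).2) (hBr s hs)).symm
    · exact disjoint_interior_of_orient hm.ne_left (hBl s hs) (hAl t ht)
    · exact hB.noncrossing s hs t ht hst

/-- The number of triangulations of `q i, …, q j` relative to the base edge. -/
noncomputable def chainCount (q : ℕ → ℂ) (i j : ℕ) : ℕ :=
  Nat.card {T // IsChainTriangulation q i j T}

open Classical in
-- Gluing is a bijection from triples (apex, left part, right part). The apex is recovered from the
-- only triangle that contains both ends of the base, the parts by filtering the triangles by their
-- vertices.
theorem chainCount_eq_sum (hq : WeaklyConvex q i j)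
    (hij : i < j) (hclean : ∀ w ∈ Set.Icc i j, q w ∈ segment ℝ (q i) (q j) → w = i ∨ w = j) {u : ℕ}
    (hu : u ∈ Set.Icc i j) (hpos : 0 < orient (q i) (q u) (q j)) :
    chainCount q i j =
      ∑ m ∈ Finset.Ioo i j with IsApex q i m j, chainCount q i m * chainCount q m j := by
  let f : (Σ m : {m // m ∈ (Finset.Ioo i j).filter fun m => IsApex q i m j},
      {T // IsChainTriangulation q i m T} × {T // IsChainTriangulation q m j T}) →
      {T // IsChainTriangulation q i j T} := fun x =>
    ⟨insert {q i, q x.1, q j} (x.2.1.1 ∪ x.2.2.1),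
      x.2.1.2.join x.2.2.2 hq (Finset.mem_filter.1 x.1.2).2⟩
  have hf : Function.Bijective f := by
    constructor
    · rintro ⟨⟨m, hm⟩, ⟨A, hA⟩, ⟨B, hB⟩⟩ ⟨⟨m', hm'⟩, ⟨A', hA'⟩, ⟨B', hB'⟩⟩ h
      simp only [f, Subtype.mk.injEq] at h
      replace hm := (Finset.mem_filter.1 hm).2
      replace hm' := (Finset.mem_filter.1 hm').2
      have e : m = m' := by
        have h1 : ({q i, q m, q j} : Finset ℂ) ∈ insert {q i, q m', q j} (A' ∪ B') := by
          rw [← h]; exact Or.inl rfl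
        rcases h1 with h1 | h1 | h1
        · have h2 : q m ∈ ({q i, q m', q j} : Finset ℂ) := by rw [← h1]; simp
          simp only [Finset.mem_insert, Finset.mem_singleton] at h2
          rcases h2 with h2 | h2 | h2
          · exact absurd h2.symm hm.ne_left
          · exact hq.injOn ⟨hm.left_lt.le, hm.lt_right.le⟩ ⟨hm'.left_lt.le, hm'.lt_right.le⟩ h2
          · exact absurd h2 hm.ne_right
        · exact absurd (hA'.vertices_mem _ h1 (by simp)) (hm'.not_mem_left hq)
        · exact absurd (hB'.vertices_mem _ h1 (by simp)) (hm'.not_mem_right hq)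
      subst e
      have hl : ∀ {A B : Set (Finset ℂ)}, IsChainTriangulation q i m A →
          IsChainTriangulation q m j B →
          {t ∈ insert {q i, q m, q j} (A ∪ B) | (t : Set ℂ) ⊆ q '' Set.Icc i m} = A := by
        intro A B hA hB
        ext t
        constructor
        · rintro ⟨rfl | ht | ht, hs⟩
          · exact absurd (hs (by simp)) (hm.not_mem_left hq)
          · exact ht
          · exact (hm.not_subset_both hq (hB.card_eq_three t ht) hs (hB.vertices_mem t ht)).elim
        · exact fun ht => ⟨Or.inr (Or.inl ht), hA.vertices_mem t ht⟩
      have hr : ∀ {A B : Set (Finset ℂ)}, IsChainTriangulation q i m A →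
          IsChainTriangulation q m j B →
          {t ∈ insert {q i, q m, q j} (A ∪ B) | (t : Set ℂ) ⊆ q '' Set.Icc m j} = B := by
        intro A B hA hB
        ext t
        constructor
        · rintro ⟨rfl | ht | ht, hs⟩
          · exact absurd (hs (by simp)) (hm.not_mem_right hq)
          · exact (hm.not_subset_both hq (hA.card_eq_three t ht) (hA.vertices_mem t ht) hs).elim
          · exact ht
        · exact fun ht => ⟨Or.inr (Or.inr ht), hB.vertices_mem t ht⟩
      obtain rfl : A = A' := by rw [← hl hA hB, h, hl hA' hB']
      obtain rfl : B = B' := by rw [← hr hA hB, h, hr hA' hB']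
      rfl
    · rintro ⟨T, hT⟩
      obtain ⟨m, hm, hmT⟩ := exists_apex hT hq hij hclean hu hpos
      refine ⟨⟨⟨m, Finset.mem_filter.2 ⟨Finset.mem_Ioo.2 ⟨hm.left_lt, hm.lt_right⟩, hm⟩⟩,
        ⟨_, hT.left hq hm hmT⟩, ⟨_, hT.right hq hm hmT⟩⟩, ?_⟩
      simp only [f, Subtype.mk.injEq]
      ext t
      constructor
      · rintro (rfl | ht | ht)
        · exact hmT
        · exact ht.1
        · exact ht.1
      · intro ht
        by_cases htt : t = {q i, q m, q j}
        · exact Or.inl htt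
        · rcases hT.subset_or_subset hq hm hmT ht htt with h | h
          · exact Or.inr (Or.inl ⟨ht, h⟩)
          · exact Or.inr (Or.inr ⟨ht, h⟩)
  have hfin : ∀ a b, Finite {T // IsChainTriangulation q a b T} := by
    intro a b
    have hS : (q '' Set.Icc a b).Finite := (Set.finite_Icc a b).image q
    have hfin : {T | IsChainTriangulation q a b T}.Finite := by
      refine Set.Finite.subset (hS.toFinset.powerset.finite_toSet).finite_subsets ?_
      intro T hT t ht
      simp only [Finset.coe_powerset, Set.mem_preimage, Set.mem_powerset_iff,
        Set.Finite.coe_toFinset]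
      exact hT.vertices_mem t ht
    exact hfin
  rw [chainCount, ← Nat.card_congr (Equiv.ofBijective f hf), Nat.card_sigma]
  simp only [Nat.card_prod]
  exact Finset.sum_coe_sort ((Finset.Ioo i j).filter fun m => IsApex q i m j)
    (fun m => chainCount q i m * chainCount q m j)

theorem chainCount_succ (q : ℕ → ℂ) (i : ℕ) : chainCount q i (i + 1) = 1 := by
  have hS : q '' Set.Icc i (i + 1) = {q i, q (i + 1)} := by
    rw [show Set.Icc i (i + 1) = {i, i + 1} by ext x; simp; omega, Set.image_pair]
  rw [chainCount, Nat.card_eq_one_iff_unique]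
  refine ⟨⟨fun A B => ?_⟩, ⟨∅, by simp, by simp, by simp, by simp, ?_, by simp⟩⟩
  · have : ∀ T, IsChainTriangulation q i (i + 1) T → T = ∅ := by
      intro T hT
      by_contra hne
      obtain ⟨t, ht⟩ := Set.nonempty_iff_ne_empty.2 hne
      have h1 := hT.vertices_mem t ht
      classical
      have h2 : t ⊆ {q i, q (i + 1)} := by
        intro x hx
        have := h1 hx
        rw [hS] at this
        simpa using this
      have h3 := Finset.card_le_card h2
      rw [hT.card_eq_three t ht] at h3
      have := Finset.card_le_two (a := q i) (b := q (i + 1))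
      omega
    exact Subtype.ext ((this _ A.2).trans (this _ B.2).symm)
  · intro z hz hzs
    rw [hS, convexHull_pair] at hz
    exact absurd hz hzs

end recursion

/-! ### Geometry of the subdivided polygon -/

theorem orient_corner {k : ℕ} (a b c : ℕ) :
    orient (corner k a) (corner k b) (corner k c) =
      4 * Real.sin (Real.pi * ((b - a : ℝ) / k)) * Real.sin (Real.pi * ((c - b : ℝ) / k)) *
        Real.sin (Real.pi * ((c - a : ℝ) / k)) := by
  have hre : ∀ i : ℕ, (corner k i).re = Real.cos (2 * (Real.pi * (i / k))) := by
    intro i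
    rw [corner, show (2 * Real.pi * Complex.I * ((i / k : ℝ) : ℂ) : ℂ) =
      ((2 * (Real.pi * (i / k)) : ℝ) : ℂ) * Complex.I by push_cast; ring]
    rw [Complex.exp_ofReal_mul_I_re]
  have him : ∀ i : ℕ, (corner k i).im = Real.sin (2 * (Real.pi * (i / k))) := by
    intro i
    rw [corner, show (2 * Real.pi * Complex.I * ((i / k : ℝ) : ℂ) : ℂ) =
      ((2 * (Real.pi * (i / k)) : ℝ) : ℂ) * Complex.I by push_cast; ring]
    rw [Complex.exp_ofReal_mul_I_im]
  have h1 : ∀ x y : ℕ, Real.pi * ((x - y : ℝ) / k) = Real.pi * (x / k) - Real.pi * (y / k) := by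
    intro x y; ring
  simp only [orient, hre, him, h1]
  generalize Real.pi * ((a : ℝ) / k) = x
  generalize Real.pi * ((b : ℝ) / k) = y
  generalize Real.pi * ((c : ℝ) / k) = z
  simp only [Real.sin_sub, Real.cos_two_mul, Real.sin_two_mul]
  have hx := Real.sin_sq_add_cos_sq x
  have hy := Real.sin_sq_add_cos_sq y
  have hz := Real.sin_sq_add_cos_sq z
  generalize Real.sin x = sx at *
  generalize Real.sin y = sy at *
  generalize Real.sin z = sz at *
  generalize Real.cos x = cx at *
  generalize Real.cos y = cy at *
  generalize Real.cos z = cz at *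
  have hx : sx ^ 2 = 1 - cx ^ 2 := by linarith
  have hy : sy ^ 2 = 1 - cy ^ 2 := by linarith
  have hz : sz ^ 2 = 1 - cz ^ 2 := by linarith
  ring_nf
  simp only [hx, hy, hz]
  ring

theorem sin_pi_mul_nonneg {k : ℕ} {a b : ℕ} (hab : a ≤ b) (hb : b ≤ a + k) :
    0 ≤ Real.sin (Real.pi * ((b - a : ℝ) / k)) := by
  have h1 : (a : ℝ) ≤ b := by exact_mod_cast hab
  have h2 : (b : ℝ) ≤ a + k := by exact_mod_cast hb
  apply Real.sin_nonneg_of_nonneg_of_le_pi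
  · exact mul_nonneg Real.pi_pos.le (div_nonneg (by linarith) (by positivity))
  · exact mul_le_of_le_one_right Real.pi_pos.le (div_le_one_of_le₀ (by linarith) (by positivity))

theorem sin_pi_mul_pos {k : ℕ} {a b : ℕ} (hab : a < b) (hb : b < a + k) :
    0 < Real.sin (Real.pi * ((b - a : ℝ) / k)) := by
  have h1 : (a : ℝ) < b := by exact_mod_cast hab
  have h2 : (b : ℝ) < a + k := by exact_mod_cast hb
  have h3 : (0 : ℝ) < k := by linarith
  apply Real.sin_pos_of_pos_of_lt_pi
  · exact mul_pos Real.pi_pos (div_pos (by linarith) h3)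
  · exact mul_lt_of_lt_one_right Real.pi_pos ((div_lt_one h3).2 (by linarith))

theorem orient_corner_nonneg {k a b c : ℕ} (hab : a ≤ b) (hbc : b ≤ c) (hc : c ≤ a + k) :
    0 ≤ orient (corner k a) (corner k b) (corner k c) := by
  rw [orient_corner]
  have := sin_pi_mul_nonneg (k := k) hab (by omega)
  have := sin_pi_mul_nonneg (k := k) hbc (by omega)
  have := sin_pi_mul_nonneg (k := k) (hab.trans hbc) hc
  positivity

theorem orient_corner_pos {k a b c : ℕ} (hab : a < b) (hbc : b < c) (hc : c < a + k) :
    0 < orient (corner k a) (corner k b) (corner k c) := by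
  rw [orient_corner]
  have := sin_pi_mul_pos (k := k) hab (by omega)
  have := sin_pi_mul_pos (k := k) hbc (by omega)
  have := sin_pi_mul_pos (k := k) (hab.trans hbc) hc
  positivity

theorem corner_self {k : ℕ} (hk : k ≠ 0) : corner k k = corner k 0 := by
  simp only [corner]
  have : (k : ℝ) / k = 1 := div_self (by exact_mod_cast hk)
  rw [this]
  simp [Complex.exp_two_pi_mul_I]

theorem corner_ne_succ {k s : ℕ} (hk : 3 ≤ k) : corner k s ≠ corner k (s + 1) := by
  intro h
  have := orient_corner_pos (k := k) (a := s) (b := s + 1) (c := s + 2) (by omega) (by omega)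
    (by omega)
  rw [h] at this
  simp at this

/-- The points of the subdivided polygon in cyclic order. -/
noncomputable def polygonPoint (k r n : ℕ) : ℂ := sidePoint k r (n / r) (n % r)

section polygon

variable {k r : ℕ}

theorem polygonPoint_eq (hr : 0 < r) {n s : ℕ} (h1 : r * s ≤ n) (h2 : n ≤ r * (s + 1)) :
    polygonPoint k r n = AffineMap.lineMap (corner k s) (corner k (s + 1)) ((n - r * s : ℝ) / r) := by
  have hr' : (r : ℝ) ≠ 0 := by exact_mod_cast hr.ne'
  rcases h2.eq_or_lt with rfl | h2
  · rw [polygonPoint, sidePoint, Nat.mul_div_cancel_left _ hr, Nat.mul_mod_right]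
    have : ((r * (s + 1) : ℕ) - r * s : ℝ) / r = 1 := by push_cast; field_simp; ring
    rw [this]
    simp
  · have h3 : n / r = s := by
      rw [Nat.div_eq_iff hr]
      constructor
      · rw [mul_comm]; exact h1
      · have : r * (s + 1) = s * r + r := by ring
        omega
    have h4 : n % r = n - r * s := by
      have := Nat.div_add_mod n r
      rw [h3] at this; omega
    rw [polygonPoint, sidePoint, h3, h4, Nat.cast_sub h1]
    push_cast
    rfl

/-- A position on the boundary of the polygon: side `s` and the fraction `x` along it. -/
theorem exists_position_lower (hr : 0 < r) {n : ℕ} (hn : n < k * r) :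
    ∃ s < k, ∃ x : ℝ, 0 ≤ x ∧ x < 1 ∧ (n : ℝ) = r * (s + x) ∧ s = n / r ∧
      polygonPoint k r n = AffineMap.lineMap (corner k s) (corner k (s + 1)) x := by
  have hr' : (0 : ℝ) < r := by exact_mod_cast hr
  have h1 : r * (n / r) ≤ n := Nat.mul_div_le n r
  have h2 : n < r * (n / r + 1) := Nat.lt_mul_div_succ n hr
  have h1' : (r : ℝ) * (n / r : ℕ) ≤ n := by exact_mod_cast h1
  have h2' : (n : ℝ) < r * ((n / r : ℕ) + 1) := by exact_mod_cast h2
  refine ⟨n / r, Nat.div_lt_of_lt_mul (by rwa [mul_comm]), _, ?_, ?_, ?_, rfl,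
    polygonPoint_eq hr h1 h2.le⟩
  · exact div_nonneg (by linarith) hr'.le
  · rw [div_lt_one hr']; linarith
  · field_simp; ring

/-- Here a corner counts as the end of the side before it, so that also `k * r` gets a side number
below `k`. -/
theorem exists_position_upper (hr : 0 < r) {n : ℕ} (hn0 : 0 < n) (hn : n ≤ k * r) :
    ∃ s < k, ∃ x : ℝ, 0 < x ∧ x ≤ 1 ∧ (n : ℝ) = r * (s + x) ∧ s = (n - 1) / r ∧
      polygonPoint k r n = AffineMap.lineMap (corner k s) (corner k (s + 1)) x := by
  have hr' : (0 : ℝ) < r := by exact_mod_cast hr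
  have h1 : r * ((n - 1) / r) < n := (Nat.mul_div_le (n - 1) r).trans_lt (by omega)
  have h2 : n ≤ r * ((n - 1) / r + 1) := by
    have := Nat.lt_mul_div_succ (n - 1) hr; omega
  have h1' : (r : ℝ) * ((n - 1) / r : ℕ) < n := by exact_mod_cast h1
  have h2' : (n : ℝ) ≤ r * (((n - 1) / r : ℕ) + 1) := by exact_mod_cast h2
  refine ⟨(n - 1) / r, Nat.div_lt_of_lt_mul (by rw [mul_comm]; omega), _, ?_, ?_, ?_, rfl,
    polygonPoint_eq hr h1.le h2⟩
  · exact div_pos (by linarith) hr'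
  · rw [div_le_one hr']; linarith
  · field_simp; ring

theorem orient_lineMap_pair (a b z : ℂ) (x y : ℝ) :
    orient (AffineMap.lineMap a b x) (AffineMap.lineMap a b y) z = (y - x) * orient a b z := by
  simp [orient, AffineMap.lineMap_apply]; ring

theorem orient_lineMap_pair' (a b z : ℂ) (x y : ℝ) :
    orient z (AffineMap.lineMap a b x) (AffineMap.lineMap a b y) = (y - x) * orient z a b := by
  simp [orient, AffineMap.lineMap_apply]; ring

/-- Two positions on one side and a later one. -/
theorem orient_side_pos (hk : 3 ≤ k) {s t : ℕ} {z : ℝ} (hst : s < t) (ht : t < k) (hz : 0 < z)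
    (hz1 : z ≤ 1) (h : ¬(s = 0 ∧ t + 1 = k ∧ z = 1)) :
    0 < orient (corner k s) (corner k (s + 1))
      (AffineMap.lineMap (corner k t) (corner k (t + 1)) z) := by
  rw [orient_lineMap]
  have h1 := orient_corner_nonneg (k := k) (a := s) (b := s + 1) (c := t) (by omega) (by omega)
    (by omega)
  have h2 := orient_corner_nonneg (k := k) (a := s) (b := s + 1) (c := t + 1) (by omega)
    (by omega) (by omega)
  have h1' := mul_nonneg (sub_nonneg.2 hz1) h1
  have h2' := mul_nonneg hz.le h2
  by_cases hw : t + 1 < s + k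
  · have := mul_pos hz (orient_corner_pos (k := k) (a := s) (b := s + 1) (c := t + 1) (by omega)
      (by omega) hw)
    linarith
  · have hz2 : z < 1 := lt_of_le_of_ne hz1 fun h0 => h ⟨by omega, by omega, h0⟩
    have := mul_pos (sub_pos.2 hz2) (orient_corner_pos (k := k) (a := s) (b := s + 1) (c := t)
      (by omega) (by omega) (by omega))
    linarith

/-- Orientation is affine in each point, so it expands into orientations of corners with nonnegative
weights. Strictness needs the last point to be past the side of the first one; the remaining
exception is corner 0 as last point, collinear with points of the first side. -/
theorem orient_polygonPoint (hk : 3 ≤ k) (hr : 0 < r) {a b c : ℕ} (ha : 1 ≤ a) (hab : a < b)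
    (hbc : b < c) (hc : c ≤ k * r) :
    0 ≤ orient (polygonPoint k r a) (polygonPoint k r b) (polygonPoint k r c) ∧
    (r * (a / r + 1) < c → ¬(c = k * r ∧ b ≤ r) →
      0 < orient (polygonPoint k r a) (polygonPoint k r b) (polygonPoint k r c)) := by
  have hr' : (0 : ℝ) < r := by exact_mod_cast hr
  obtain ⟨s, hs, x, hx0, hx1, hax, hsa, ea⟩ := exists_position_lower (k := k) hr
    (show a < k * r by omega)
  obtain ⟨t, ht, y, hy0, hy1, hby, htb, eb⟩ := exists_position_lower (k := k) hr
    (show b < k * r by omega)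
  obtain ⟨l, hl, z, hz0, hz1, hcz, hlc, ec⟩ := exists_position_upper (k := k) hr
    (show 0 < c by omega) hc
  have hst : s ≤ t := by rw [hsa, htb]; exact Nat.div_le_div_right hab.le
  have htl : t ≤ l := by rw [hlc, htb]; exact Nat.div_le_div_right (by omega)
  have hab' : (a : ℝ) < b := by exact_mod_cast hab
  have hbc' : (b : ℝ) < c := by exact_mod_cast hbc
  have ha' : (1 : ℝ) ≤ a := by exact_mod_cast ha
  rw [ea, eb, ec, ← hsa]
  have hwrap : ∀ {t' : ℕ} {y' : ℝ}, (b : ℝ) = r * (t' + y') → t' + y' ≤ 1 → b ≤ r := by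
    intro t' y' h1 h2
    have : (b : ℝ) ≤ r := by rw [h1]; exact mul_le_of_le_one_right hr'.le h2
    exact_mod_cast this
  have hckr : l + 1 = k → z = 1 → c = k * r := by
    intro h1 h2
    have : (c : ℝ) = k * r := by rw [hcz, h2, ← h1]; push_cast; ring
    exact_mod_cast this
  have hx_pos : s = 0 → 0 < x := by
    rintro rfl
    by_contra hc
    have : x = 0 := le_antisymm (not_lt.1 hc) hx0
    rw [this] at hax; simp at hax; linarith
  rcases hst.eq_or_lt with rfl | hst
  · have hxy : x < y := by
      rw [hax, hby] at hab'
      have := lt_of_mul_lt_mul_left hab' hr'.le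
      linarith
    rw [orient_lineMap_pair]
    rcases htl.eq_or_lt with rfl | htl
    · rw [orient_lineMap]
      simp only [orient_self_outer, orient_self_right, mul_zero, add_zero, le_refl, true_and]
      intro h
      have h' : (r : ℝ) * (s + 1) < c := by exact_mod_cast h
      rw [hcz] at h'
      have := lt_of_mul_lt_mul_left h' hr'.le
      linarith
    by_cases hw : s = 0 ∧ l + 1 = k ∧ z = 1
    · obtain ⟨rfl, h1, rfl⟩ := hw
      have hb : b ≤ r := hwrap hby (by simpa using hy1.le)
      refine ⟨?_, fun _ h => absurd ⟨hckr h1 rfl, hb⟩ h⟩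
      rw [AffineMap.lineMap_apply_one]
      exact mul_nonneg (by linarith)
        (orient_corner_nonneg (by omega) (by omega) (by omega))
    · have := mul_pos (sub_pos.2 hxy) (orient_side_pos hk htl hl hz0 hz1 hw)
      exact ⟨this.le, fun _ _ => this⟩
  rcases htl.eq_or_lt with rfl | htl
  · have hyz : y < z := by
      rw [hby, hcz] at hbc'
      have := lt_of_mul_lt_mul_left hbc' hr'.le
      linarith
    rw [orient_lineMap_pair']
    suffices 0 < (z - y) * orient (AffineMap.lineMap (corner k s) (corner k (s + 1)) x)
      (corner k t) (corner k (t + 1)) from ⟨this.le, fun _ _ => this⟩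
    refine mul_pos (sub_pos.2 hyz) ?_
    rw [orient_lineMap_left]
    have h1 := mul_nonneg (sub_nonneg.2 hx1.le) (orient_corner_nonneg (k := k) (a := s) (b := t)
      (c := t + 1) (by omega) (by omega) (by omega))
    have h2 := mul_nonneg hx0 (orient_corner_nonneg (k := k) (a := s + 1) (b := t)
      (c := t + 1) (by omega) (by omega) (by omega))
    by_cases hw : t + 1 < s + k
    · have := mul_pos (sub_pos.2 hx1) (orient_corner_pos (k := k) (a := s) (b := t)
        (c := t + 1) (by omega) (by omega) hw)
      linarith
    · have := mul_pos (hx_pos (by omega)) (orient_corner_pos (k := k) (a := s + 1) (b := t)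
        (c := t + 1) (by omega) (by omega) (by omega))
      linarith
  · have hO : ∀ e ≤ 1, ∀ f ≤ 1, ∀ g ≤ 1,
        0 ≤ orient (corner k (s + e)) (corner k (t + f)) (corner k (l + g)) := by
      intro e he f hf g hg
      exact orient_corner_nonneg (by omega) (by omega) (by omega)
    have hX := sub_pos.2 hx1
    have hY := sub_pos.2 hy1
    have hZ := sub_nonneg.2 hz1
    rw [orient_lineMap_left, orient_lineMap_mid, orient_lineMap_mid, orient_lineMap,
      orient_lineMap, orient_lineMap, orient_lineMap]
    have n000 := mul_nonneg (mul_nonneg (mul_nonneg hX.le hY.le) hZ)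
      (hO 0 (by simp) 0 (by simp) 0 (by simp))
    have n001 := mul_nonneg (mul_nonneg (mul_nonneg hX.le hY.le) hz0.le)
      (hO 0 (by simp) 0 (by simp) 1 (by simp))
    have n010 := mul_nonneg (mul_nonneg (mul_nonneg hX.le hy0) hZ)
      (hO 0 (by simp) 1 (by simp) 0 (by simp))
    have n011 := mul_nonneg (mul_nonneg (mul_nonneg hX.le hy0) hz0.le)
      (hO 0 (by simp) 1 (by simp) 1 (by simp))
    have n100 := mul_nonneg (mul_nonneg (mul_nonneg hx0 hY.le) hZ)
      (hO 1 (by simp) 0 (by simp) 0 (by simp))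
    have n101 := mul_nonneg (mul_nonneg (mul_nonneg hx0 hY.le) hz0.le)
      (hO 1 (by simp) 0 (by simp) 1 (by simp))
    have n110 := mul_nonneg (mul_nonneg (mul_nonneg hx0 hy0) hZ)
      (hO 1 (by simp) 1 (by simp) 0 (by simp))
    have n111 := mul_nonneg (mul_nonneg (mul_nonneg hx0 hy0) hz0.le)
      (hO 1 (by simp) 1 (by simp) 1 (by simp))
    simp only [add_zero] at n000 n001 n010 n011 n100 n101 n110 n111
    refine ⟨by linarith, fun _ hw => ?_⟩
    by_cases h1 : l + 1 < s + k
    · have := mul_pos (mul_pos (mul_pos hX hY) hz0) (orient_corner_pos (k := k) (a := s) (b := t)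
        (c := l + 1) (by omega) (by omega) h1)
      linarith
    obtain rfl : s = 0 := by omega
    have hx := hx_pos rfl
    by_cases h2 : 1 < t
    · have := mul_pos (mul_pos (mul_pos hx hY) hz0) (orient_corner_pos (k := k) (a := 0 + 1)
        (b := t) (c := l + 1) (by omega) (by omega) (by omega))
      linarith
    obtain rfl : t = 1 := by omega
    rcases hy0.eq_or_lt with rfl | hy
    · have hz2 : z < 1 := lt_of_le_of_ne hz1 fun h0 =>
        hw ⟨hckr (by omega) h0, hwrap hby (by simp)⟩
      have := mul_pos (mul_pos (mul_pos hX hY) (sub_pos.2 hz2)) (orient_corner_pos (k := k)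
        (a := 0) (b := 1) (c := l) (by omega) (by omega) (by omega))
      linarith
    · have := mul_pos (mul_pos (mul_pos hx hy) hz0) (orient_corner_pos (k := k) (a := 0 + 1)
        (b := 1 + 1) (c := l + 1) (by omega) (by omega) (by omega))
      linarith

theorem polygonPoint_mem_segment (hr : 0 < r) {a b c : ℕ} (hab : a ≤ b) (hbc : b ≤ c)
    (hc : c ≤ r * (a / r + 1)) :
    polygonPoint k r b ∈ segment ℝ (polygonPoint k r a) (polygonPoint k r c) := by
  have h0 : r * (a / r) ≤ a := Nat.mul_div_le a r
  have hr' : (0 : ℝ) < r := by exact_mod_cast hr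
  rw [polygonPoint_eq hr h0 (by omega), polygonPoint_eq (n := b) hr (h0.trans hab) (by omega),
    polygonPoint_eq (n := c) hr (h0.trans (hab.trans hbc)) hc]
  have hab' : (a : ℝ) ≤ b := by exact_mod_cast hab
  have hbc' : (b : ℝ) ≤ c := by exact_mod_cast hbc
  rw [← image_segment, segment_eq_Icc (by gcongr; linarith)]
  exact ⟨_, ⟨by gcongr, by gcongr⟩, rfl⟩

/-- The range starts at 1 because 0 and `k * r` index the same corner. -/
theorem weaklyConvex_polygonPoint (hk : 3 ≤ k) (hr : 0 < r) :
    WeaklyConvex (polygonPoint k r) 1 (k * r) := by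
  have hr' : (0 : ℝ) < r := by exact_mod_cast hr
  refine ⟨?_, fun a b c ha hab hbc hc => (orient_polygonPoint hk hr ha hab hbc hc).1⟩
  have key : ∀ a b, 1 ≤ a → a < b → b ≤ k * r → polygonPoint k r a ≠ polygonPoint k r b := by
    intro a b ha hab hb h
    have hab' : (a : ℝ) < b := by exact_mod_cast hab
    obtain ⟨s, hs, x, hx0, hx1, hax, hsa, ea⟩ := exists_position_lower (k := k) hr
      (show a < k * r by omega)
    obtain ⟨l, hl, z, hz0, hz1, hcz, hlc, ec⟩ := exists_position_upper (k := k) hr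
      (show 0 < b by omega) hb
    have hst : s ≤ l := by rw [hsa, hlc]; exact Nat.div_le_div_right (by omega)
    rw [ea, ec] at h
    rcases hst.eq_or_lt with rfl | hst
    · have := AffineMap.lineMap_injective ℝ (corner_ne_succ hk) h
      rw [hax, hcz, this] at hab'
      exact lt_irrefl _ hab'
    · by_cases hw : s = 0 ∧ l + 1 = k ∧ z = 1
      · obtain ⟨rfl, h1, rfl⟩ := hw
        rw [AffineMap.lineMap_apply_one, h1, corner_self (by omega),
          AffineMap.lineMap_eq_left_iff] at h
        rcases h with h | rfl
        · exact corner_ne_succ hk h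
        · simp at hax; omega
      · have := orient_side_pos hk hst hl hz0 hz1 hw
        rw [← h, orient_lineMap] at this
        simp at this
  intro a ha b hb h
  rcases lt_trichotomy a b with hab | rfl | hab
  · exact absurd h (key a b ha.1 hab hb.2)
  · rfl
  · exact absurd h.symm (key b a hb.1 hab ha.2)

theorem polygonPoint_base_clean (hk : 3 ≤ k) (hr : 0 < r) {w : ℕ} (hw : w ∈ Set.Icc 1 (k * r))
    (hs : polygonPoint k r w ∈ segment ℝ (polygonPoint k r 1) (polygonPoint k r (k * r))) :
    w = 1 ∨ w = k * r := by
  have hr' : (0 : ℝ) < r := by exact_mod_cast hr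
  have hkr : 3 * r ≤ k * r := Nat.mul_le_mul_right r hk
  by_contra hc
  push Not at hc
  have h1 : 1 < w := lt_of_le_of_ne hw.1 hc.1.symm
  have h2 : w < k * r := lt_of_le_of_ne hw.2 hc.2
  by_cases hwr : w ≤ r
  · rw [polygonPoint_eq (n := w) (s := 0) hr (by simp) (by omega),
      polygonPoint_eq (n := 1) (s := 0) hr (by simp) (by omega)] at hs
    have : polygonPoint k r (k * r) =
        AffineMap.lineMap (corner k 0) (corner k (0 + 1)) (0 : ℝ) := by
      rw [polygonPoint, sidePoint, Nat.mul_div_cancel _ hr, Nat.mul_mod_left]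
      simp [corner_self (show k ≠ 0 by omega)]
    rw [this, ← image_segment, segment_symm, segment_eq_Icc (by simp)] at hs
    obtain ⟨x, hx, hxw⟩ := hs
    have := AffineMap.lineMap_injective ℝ (corner_ne_succ hk) hxw
    rw [this] at hx
    have h3 := hx.2
    rw [div_le_div_iff_of_pos_right hr'] at h3
    simp at h3
    omega
  · have h3 : r * (1 / r + 1) < k * r := by
      rcases Nat.lt_or_ge 1 r with h | h
      · rw [Nat.div_eq_of_lt h]; omega
      · obtain rfl : r = 1 := by omega
        omega
    have := (orient_polygonPoint hk hr le_rfl h1 h2 le_rfl).2 h3 (by omega)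
    rw [orient_swap, orient_eq_zero_of_mem_segment hs] at this
    simp at this

theorem image_polygonPoint (hk : 3 ≤ k) (hr : 0 < r) :
    polygonPoint k r '' Set.Icc 1 (k * r) = subdividedPolygon k r := by
  ext z
  constructor
  · rintro ⟨n, hn, rfl⟩
    rcases hn.2.eq_or_lt with rfl | h
    · refine ⟨0, by omega, 0, hr, ?_⟩
      rw [polygonPoint, Nat.mul_div_cancel _ hr, Nat.mul_mod_left]
      simp [sidePoint, corner_self (show k ≠ 0 by omega)]
    · exact ⟨n / r, Nat.div_lt_of_lt_mul (by rwa [mul_comm]), n % r, Nat.mod_lt _ hr, rfl⟩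
  · rintro ⟨i, hi, j, hj, rfl⟩
    by_cases h : i = 0 ∧ j = 0
    · obtain ⟨rfl, rfl⟩ := h
      refine ⟨k * r, ⟨Nat.mul_pos (by omega) hr, le_rfl⟩, ?_⟩
      rw [polygonPoint, Nat.mul_div_cancel _ hr, Nat.mul_mod_left]
      simp [sidePoint, corner_self (show k ≠ 0 by omega)]
    · refine ⟨r * i + j, ⟨?_, ?_⟩, ?_⟩
      · by_contra h0
        have h1 : r * i + j = 0 := by omega
        apply h
        constructor
        · have : r * i = 0 := by omega
          exact (Nat.mul_eq_zero.1 this).resolve_left hr.ne'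
        · omega
      · calc r * i + j ≤ r * i + r := by omega
          _ = (i + 1) * r := by ring
          _ ≤ k * r := Nat.mul_le_mul_right r hi
      · rw [polygonPoint, Nat.mul_add_div hr, Nat.div_eq_of_lt hj, Nat.mul_add_mod,
          Nat.mod_eq_of_lt hj, add_zero]

theorem orient_base_pos (hk : 3 ≤ k) (hr : 1 < r) {m : ℕ} (hm : r < m) (hmk : m < k * r) :
    0 < orient (polygonPoint k r 1) (polygonPoint k r m) (polygonPoint k r (k * r)) := by
  have hkr : 3 * r ≤ k * r := Nat.mul_le_mul_right r hk
  refine (orient_polygonPoint hk (by omega) le_rfl (by omega) hmk le_rfl).2 ?_ (by omega)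
  rw [Nat.div_eq_of_lt hr]; omega

/-- The base is the polygon edge from point 1 to corner 0. Since the chain has a point off its line,
a chain triangulation covers the base as well. -/
theorem tr_eq_chainCount (hk : 3 ≤ k) (hr : 1 < r) :
    tr k r = chainCount (polygonPoint k r) 1 (k * r) := by
  have hr0 : 0 < r := by omega
  have hkr : 3 * r ≤ k * r := Nat.mul_le_mul_right r hk
  have hS := image_polygonPoint hk hr0
  have h : ∀ T, IsTriangulation (subdividedPolygon k r) T ↔
      IsChainTriangulation (polygonPoint k r) 1 (k * r) T := by
    intro T
    constructor
    · intro hT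
      refine ⟨by rw [hS]; exact hT.vertices_mem, hT.card_eq_three, hT.nondegenerate,
        fun t ht => by rw [hS]; exact (hT.no_other_point t ht).subset, ?_, hT.noncrossing⟩
      intro z hz _
      rw [hS, ← hT.covers] at hz
      simpa using hz
    · intro hT
      refine ⟨by rw [← hS]; exact hT.vertices_mem, hT.card_eq_three, hT.nondegenerate,
        fun t ht => ?_, ?_, hT.noncrossing⟩
      · rw [← hS]
        exact (hT.no_other_point t ht).antisymm
          (Set.subset_inter (subset_convexHull _ _) (hT.vertices_mem t ht))
      · rw [← hS]
        exact hT.iUnion_eq (weaklyConvex_polygonPoint hk hr0) (u := r + 1) ⟨by omega, by omega⟩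
          (orient_base_pos hk hr (by omega) (by omega))
  simp only [tr, h]
  rw [chainCount, ← Nat.card_coe_set_eq]
  rfl

end polygon

/-! ### Counting with an abstract solution of the recursion -/

section count

variable {k r : ℕ}

/-- The points from `a` to `b` do not lie on one side, unless they are the ends of an edge. -/
def IsChord (r a b : ℕ) : Prop := b = a + 1 ∨ r * (a / r + 1) < b

/-- A leg within one side that is longer than an edge contains another point. For a leg that passes
a corner, convexity is strict, so the points it cuts off are strictly outside the triangle. -/
theorem isApex_iff (hk : 3 ≤ k) (hr : 0 < r) {i m j : ℕ} (hi : 1 ≤ i) (him : i < m) (hmj : m < j)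
    (hj : j ≤ k * r) (hjm : j = k * r → r ≤ m)
    (hpos : 0 < orient (polygonPoint k r i) (polygonPoint k r m) (polygonPoint k r j)) :
    IsApex (polygonPoint k r) i m j ↔ IsChord r i m ∧ IsChord r m j := by
  constructor
  · intro h
    constructor
    · by_contra hc
      simp only [IsChord, not_or, not_lt] at hc
      have := h.of_mem_segment_left (w := i + 1) ⟨by omega, by omega⟩
        (polygonPoint_mem_segment hr (by omega) (by omega) hc.2)
      omega
    · by_contra hc
      simp only [IsChord, not_or, not_lt] at hc
      have := h.of_mem_segment_right (w := m + 1) ⟨by omega, by omega⟩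
        (polygonPoint_mem_segment hr (by omega) (by omega) hc.2)
      omega
  · rintro ⟨h1, h2⟩
    refine ⟨him, hmj, hpos, fun w hw hwt => ?_⟩
    by_contra hc
    push Not at hc
    have hiw : i < w := lt_of_le_of_ne hw.1 hc.1.symm
    have hwj : w < j := lt_of_le_of_ne hw.2 hc.2.2
    obtain ⟨e1, e2, -⟩ := (mem_convexHull_triple hpos).1 hwt
    rcases lt_or_gt_of_ne hc.2.1 with hwm | hwm
    · have := (orient_polygonPoint hk hr hi hiw hwm (by omega)).2
        (h1.resolve_left (by omega)) (by omega)
      rw [orient_swap] at this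
      linarith
    · have := (orient_polygonPoint hk hr (by omega) hwm hwj (by omega)).2
        (h2.resolve_left (by omega)) (by omega)
      rw [orient_swap] at this
      linarith

variable {G : ℕ → ℕ → ℝ}

/-- The sum in `hG` runs over all `m`, the geometric one over apexes only; each extra term has a
factor that is not a chord, where `G` vanishes. The hypothesis `hjr` excludes chains from the first
side to corner 0, whose base runs inside that side. -/
theorem chainCount_eq (hk : 3 ≤ k) (hr : 0 < r) (h1 : ∀ i, i + 1 ≤ k * r → G i (i + 1) = 1)
    (h0 : ∀ i j, i < j → j ≤ k * r → ¬IsChord r i j → G i j = 0)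
    (hG : ∀ i j, r * (i / r + 1) < j → j ≤ k * r → G i j = ∑ m ∈ Finset.Ioo i j, G i m * G m j)
    {i j : ℕ} (hi : 1 ≤ i) (hij : i < j) (hj : j ≤ k * r) (hjr : j = k * r → r ≤ i)
    (hc : IsChord r i j) : (chainCount (polygonPoint k r) i j : ℝ) = G i j := by
  induction hn : j - i using Nat.strong_induction_on generalizing i j with
  | _ n ih =>
  rcases hc with rfl | hc
  · rw [chainCount_succ, h1 i hj, Nat.cast_one]
  have hi' : i < r * (i / r + 1) := Nat.lt_mul_div_succ i hr
  have hpos : ∀ w, i < w → w < j →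
      0 < orient (polygonPoint k r i) (polygonPoint k r w) (polygonPoint k r j) :=
    fun w h1 h2 => (orient_polygonPoint hk hr hi h1 h2 hj).2 hc (by omega)
  rw [chainCount_eq_sum ((weaklyConvex_polygonPoint hk hr).mono hi hj) hij ?_ (u := i + 1)
    ⟨by omega, by omega⟩ (hpos _ (by omega) (by omega)), hG i j hc hj, Finset.sum_filter,
    Nat.cast_sum]
  · refine Finset.sum_congr rfl fun m hm => ?_
    obtain ⟨him, hmj⟩ := Finset.mem_Ioo.1 hm
    have hiff := isApex_iff hk hr hi him hmj hj (by omega) (hpos m him hmj)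
    by_cases h : IsApex (polygonPoint k r) i m j
    · rw [if_pos h, Nat.cast_mul,
        ih (m - i) (by omega) hi him (by omega) (by omega) (hiff.1 h).1 rfl,
        ih (j - m) (by omega) (by omega) hmj hj (by omega) (hiff.1 h).2 rfl]
    · rw [if_neg h, Nat.cast_zero]
      rw [hiff, not_and_or] at h
      rcases h with h | h
      · rw [h0 i m him (by omega) h, zero_mul]
      · rw [h0 m j hmj hj h, mul_zero]
  · intro w hw hs
    by_contra hcon
    push Not at hcon
    have := hpos w (lt_of_le_of_ne hw.1 hcon.1.symm) (lt_of_le_of_ne hw.2 hcon.2)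
    rw [orient_swap, orient_eq_zero_of_mem_segment hs] at this
    simp at this

/-- The base edge lies on the first side, so no point of that side is an apex. The term `m = 2` of
the full sum need not vanish, so the restriction to `m > r` matters. -/
theorem tr_eq_sum (hk : 3 ≤ k) (hr : 2 < r) (h1 : ∀ i, i + 1 ≤ k * r → G i (i + 1) = 1)
    (h0 : ∀ i j, i < j → j ≤ k * r → ¬IsChord r i j → G i j = 0)
    (hG : ∀ i j, r * (i / r + 1) < j → j ≤ k * r → G i j = ∑ m ∈ Finset.Ioo i j, G i m * G m j) :
    (tr k r : ℝ) = ∑ m ∈ Finset.Ioo r (k * r), G 1 m * G m (k * r) := by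
  have hr0 : 0 < r := by omega
  have hkr : 3 * r ≤ k * r := Nat.mul_le_mul_right r hk
  have hpos : ∀ w, r < w → w < k * r → 0 < orient (polygonPoint k r 1) (polygonPoint k r w)
      (polygonPoint k r (k * r)) := fun w h1 h2 => orient_base_pos hk (by omega) h1 h2
  rw [tr_eq_chainCount hk (by omega), chainCount_eq_sum (weaklyConvex_polygonPoint hk hr0)
    (by omega) (fun w hw hs => polygonPoint_base_clean hk hr0 hw hs) (u := r + 1)
    ⟨by omega, by omega⟩ (hpos _ (by omega) (by omega)), Finset.sum_filter,
    Nat.cast_sum]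
  have hsub : Finset.Ioo r (k * r) ⊆ Finset.Ioo 1 (k * r) :=
    Finset.Ioo_subset_Ioo (by omega) le_rfl
  rw [← Finset.sum_subset hsub]
  · refine Finset.sum_congr rfl fun m hm => ?_
    obtain ⟨him, hmj⟩ := Finset.mem_Ioo.1 hm
    have hiff := isApex_iff hk hr0 le_rfl (by omega) hmj le_rfl (by omega) (hpos m him hmj)
    by_cases h : IsApex (polygonPoint k r) 1 m (k * r)
    · rw [if_pos h, Nat.cast_mul,
        chainCount_eq hk hr0 h1 h0 hG le_rfl (by omega) (by omega) (by omega) (hiff.1 h).1,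
        chainCount_eq hk hr0 h1 h0 hG (by omega) hmj le_rfl (by omega) (hiff.1 h).2]
    · rw [if_neg h, Nat.cast_zero]
      rw [hiff, not_and_or] at h
      rcases h with h | h
      · rw [h0 1 m (by omega) (by omega) h, zero_mul]
      · rw [h0 m _ hmj le_rfl h, mul_zero]
  · intro m hm hm'
    obtain ⟨him, hmj⟩ := Finset.mem_Ioo.1 hm
    have hmr : m ≤ r := by
      by_contra h; exact hm' (Finset.mem_Ioo.2 ⟨not_le.1 h, hmj⟩)
    rw [if_neg, Nat.cast_zero]
    intro h
    have hp := h.orient_pos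
    rw [polygonPoint_eq (n := m) (s := 0) hr0 (by simp) (by omega),
      polygonPoint_eq (n := 1) (s := 0) hr0 (by simp) (by omega), orient_lineMap_pair,
      polygonPoint, sidePoint, Nat.mul_div_cancel _ hr0, Nat.mul_mod_left] at hp
    simp [corner_self (show k ≠ 0 by omega)] at hp

end count

/-! ### Side polynomials and the Catalan functional -/

open Polynomial in
/-- The generating polynomial of the ways to flatten a side that is divided into `n` parts. -/
noncomputable def sidePoly : ℕ → ℝ[X]
  | 0 => 1
  | 1 => X
  | n + 2 => X * (sidePoly (n + 1) - sidePoly n)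

section functional

open Polynomial TensorProduct

/-- The inclusion of the first factor. -/
noncomputable abbrev inFst : ℝ[X] →ₐ[ℝ] ℝ[X] ⊗[ℝ] ℝ[X] := Algebra.TensorProduct.includeLeft

/-- The inclusion of the second factor. -/
noncomputable abbrev inSnd : ℝ[X] →ₐ[ℝ] ℝ[X] ⊗[ℝ] ℝ[X] := Algebra.TensorProduct.includeRight

/-- The linear map that sends `X ^ n` to the sum of all `X ^ i ⊗ X ^ j` with `i + j = n`. -/
noncomputable def splitPoly : ℝ[X] →ₗ[ℝ] ℝ[X] ⊗[ℝ] ℝ[X] :=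
  Polynomial.lsum fun n => LinearMap.toSpanSingleton ℝ _
    (∑ p ∈ Finset.HasAntidiagonal.antidiagonal n, inFst (X ^ p.1) * inSnd (X ^ p.2))

/-- The shifted Catalan functional: `X ^ (n + 1)` is sent to the `n`-th Catalan number and `1`
to zero. -/
noncomputable def catalanFunctional : ℝ[X] →ₗ[ℝ] ℝ :=
  Polynomial.lsum fun n => LinearMap.toSpanSingleton ℝ _
    (if n = 0 then 0 else (catalan (n - 1) : ℝ))

theorem splitPoly_X_pow (n : ℕ) : splitPoly (X ^ n) =
    ∑ p ∈ Finset.HasAntidiagonal.antidiagonal n, inFst (X ^ p.1) * inSnd (X ^ p.2) := by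
  rw [splitPoly, Polynomial.lsum_apply, ← Polynomial.monomial_one_right_eq_X_pow,
    Polynomial.sum_monomial_index] <;> simp

theorem catalanFunctional_X_pow (n : ℕ) :
    catalanFunctional (X ^ n) = if n = 0 then 0 else (catalan (n - 1) : ℝ) := by
  rw [catalanFunctional, Polynomial.lsum_apply, ← Polynomial.monomial_one_right_eq_X_pow,
    Polynomial.sum_monomial_index] <;> simp

theorem catalanFunctional_one : catalanFunctional 1 = 0 := by
  simpa using catalanFunctional_X_pow 0

theorem catalanFunctional_X : catalanFunctional X = 1 := by
  simpa using catalanFunctional_X_pow 1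

theorem splitPoly_one : splitPoly 1 = 1 := by
  simpa [Algebra.TensorProduct.one_def] using splitPoly_X_pow 0

theorem polynomial_linear_ext {V : Type*} [AddCommMonoid V] [Module ℝ V] {f g : ℝ[X] →ₗ[ℝ] V}
    (h : ∀ n : ℕ, f (X ^ n) = g (X ^ n)) : f = g := by
  refine Polynomial.lhom_ext' fun n => LinearMap.ext_ring ?_
  simpa [Polynomial.monomial_one_right_eq_X_pow] using h n

theorem splitPoly_X_mul (q : ℝ[X]) :
    splitPoly (X * q) = inFst X * splitPoly q + inSnd (X * q) := by
  have : splitPoly ∘ₗ LinearMap.mulLeft ℝ X = LinearMap.mulLeft ℝ (inFst X) ∘ₗ splitPoly +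
      inSnd.toLinearMap ∘ₗ LinearMap.mulLeft ℝ X := by
    refine polynomial_linear_ext fun n => ?_
    simp only [LinearMap.comp_apply, LinearMap.mulLeft_apply, LinearMap.add_apply,
      AlgHom.toLinearMap_apply, ← pow_succ', splitPoly_X_pow]
    rw [Finset.Nat.antidiagonal_succ, Finset.sum_cons, Finset.sum_map, Finset.mul_sum, add_comm]
    congr 1
    · refine Finset.sum_congr rfl fun p _ => ?_
      simp only [Function.Embedding.prodMap, Function.Embedding.coeFn_mk, Prod.map,
        Nat.succ_eq_add_one, Function.Embedding.refl_apply, pow_succ', map_mul]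
      ring
    · simp
  exact LinearMap.congr_fun this q

/-- With x and y for the two copies of the variable, `splitPoly p` is (x p(x) - y p(y)) / (x - y),
which makes this product rule visible. -/
theorem splitPoly_mul (p q : ℝ[X]) : splitPoly (p * q) =
    splitPoly p * inSnd q + inFst p * splitPoly q - inFst p * inSnd q := by
  have : splitPoly ∘ₗ LinearMap.mulRight ℝ q = LinearMap.mulRight ℝ (inSnd q) ∘ₗ splitPoly +
      LinearMap.mulRight ℝ (splitPoly q) ∘ₗ inFst.toLinearMap -
      LinearMap.mulRight ℝ (inSnd q) ∘ₗ inFst.toLinearMap := by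
    refine polynomial_linear_ext fun n => ?_
    simp only [LinearMap.comp_apply, LinearMap.mulRight_apply, LinearMap.add_apply,
      LinearMap.sub_apply, AlgHom.toLinearMap_apply]
    induction n with
    | zero => simp only [pow_zero, splitPoly_one, map_one, one_mul]; ring
    | succ n ih =>
      rw [pow_succ', mul_assoc, splitPoly_X_mul, ih, splitPoly_X_mul]
      simp only [map_mul]
      ring
  exact LinearMap.congr_fun this p

/-- Algebraic form of cutting a side at each of its division points. `splitPoly_X_mul` reduces it to
the recurrence that defines `sidePoly`. -/
theorem splitPoly_sidePoly (n : ℕ) : splitPoly (sidePoly n) =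
    ∑ p ∈ Finset.HasAntidiagonal.antidiagonal n, inFst (sidePoly p.1) * inSnd (sidePoly p.2) := by
  induction n using Nat.twoStepInduction with
  | zero => simp [sidePoly, splitPoly_one, Algebra.TensorProduct.one_def]
  | one =>
    have := splitPoly_X_pow 1
    rw [pow_one] at this
    rw [sidePoly, this]
    simp [Finset.Nat.antidiagonal_succ, sidePoly]
  | more n h1 h2 =>
    rw [sidePoly, splitPoly_X_mul, map_sub, h1, h2]
    simp only [Finset.Nat.sum_antidiagonal_succ]
    simp only [sidePoly, map_mul, map_sub, mul_sub, sub_mul, Finset.sum_sub_distrib,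
      Finset.mul_sum, map_one, mul_add, ← mul_assoc, one_mul]
    ring

/-- The product of the Catalan functional with itself. -/
noncomputable def catalanPair : ℝ[X] ⊗[ℝ] ℝ[X] →ₗ[ℝ] ℝ :=
  LinearMap.mul' ℝ ℝ ∘ₗ TensorProduct.map catalanFunctional catalanFunctional

theorem catalanPair_apply (p q : ℝ[X]) :
    catalanPair (inFst p * inSnd q) = catalanFunctional p * catalanFunctional q := by
  simp [catalanPair]

/-- The Catalan convolution. The coefficient supplies the initial value at `X`, for which the
convolution gives 0 instead of 1. -/
theorem catalanFunctional_eq (q : ℝ[X]) :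
    catalanFunctional q = catalanPair (splitPoly q) + q.coeff 1 := by
  have : catalanFunctional = catalanPair ∘ₗ splitPoly + Polynomial.lcoeff ℝ 1 := by
    refine polynomial_linear_ext fun n => ?_
    simp only [LinearMap.add_apply, LinearMap.comp_apply, splitPoly_X_pow, map_sum,
      catalanPair_apply, catalanFunctional_X_pow, Polynomial.lcoeff_apply, Polynomial.coeff_X_pow]
    match n with
    | 0 => simp
    | 1 => simp [Finset.Nat.antidiagonal_succ]
    | n + 2 =>
      rw [Finset.Nat.antidiagonal_succ_succ', Finset.sum_cons, Finset.sum_cons, Finset.sum_map]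
      simp [catalan_succ']
  exact LinearMap.congr_fun this q

theorem coeff_zero_sidePoly (n : ℕ) : (sidePoly (n + 1)).coeff 0 = 0 := by
  cases n <;> simp [sidePoly]

/-- A flat chain of at least two edges has no triangulation. In the split sum the end terms vanish,
and by induction so do the inner ones unless `n = 0`; there the single term 1 cancels the
coefficient -1 of `X` in X^2 - X. -/
theorem catalanFunctional_sidePoly (n : ℕ) : catalanFunctional (sidePoly (n + 2)) = 0 := by
  induction n using Nat.strong_induction_on with
  | _ n ih =>
  have h1 : ∀ p ∈ Finset.HasAntidiagonal.antidiagonal n,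
      catalanFunctional (sidePoly (p.1 + 1)) * catalanFunctional (sidePoly (p.2 + 1)) =
        if n = 0 then 1 else 0 := by
    rintro ⟨a, b⟩ hp
    rw [Finset.HasAntidiagonal.mem_antidiagonal] at hp
    simp only at hp ⊢
    rcases a with _ | a
    · rcases b with _ | b
      · obtain rfl : n = 0 := by omega
        simp [sidePoly, catalanFunctional_X]
      · rw [if_neg (by omega), ih b (by omega), mul_zero]
    · rw [if_neg (by omega), ih a (by omega), zero_mul]
  rw [catalanFunctional_eq, splitPoly_sidePoly, map_sum]
  simp only [catalanPair_apply]
  rw [Finset.Nat.antidiagonal_succ_succ', Finset.sum_cons, Finset.sum_cons, Finset.sum_map]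
  simp only [Function.Embedding.prodMap, Function.Embedding.coeFn_mk, Prod.map,
    Nat.succ_eq_add_one]
  rw [Finset.sum_congr rfl h1]
  have h0 : catalanFunctional (sidePoly 0) = 0 := catalanFunctional_one
  rw [h0, sidePoly, Polynomial.coeff_X_mul, Polynomial.coeff_sub, coeff_zero_sidePoly]
  rcases n with _ | n
  · simp [sidePoly]
  · simp [coeff_zero_sidePoly]

end functional

/-! ### Chain polynomials solve the recursion -/

section chain

open Polynomial

variable {k r : ℕ}

/-- The generating polynomial of the chain of points from `i` to `j`: the product over the sides
of the polynomials of the parts of the chain on that side. -/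
noncomputable def chainPoly (k r i j : ℕ) : ℝ[X] :=
  ∏ s ∈ Finset.range k, sidePoly (min j (r * (s + 1)) - max i (r * s))

/-- Truncated subtraction gives length 0 on every side away from a chain, hence a factor `sidePoly 0
= 1`. A cut at a corner thus only distributes the factors. -/
theorem chainPoly_mul {i j t : ℕ} (hi : i ≤ r * t) (hj : r * t ≤ j) :
    chainPoly k r i j = chainPoly k r i (r * t) * chainPoly k r (r * t) j := by
  rw [chainPoly, chainPoly, chainPoly, ← Finset.prod_mul_distrib]
  refine Finset.prod_congr rfl fun s _ => ?_
  rcases lt_or_ge s t with h | h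
  · have : r * (s + 1) ≤ r * t := Nat.mul_le_mul_left r h
    have h1 : r * s ≤ r * (s + 1) := Nat.mul_le_mul_left r (by omega)
    have e1 : min (r * t) (r * (s + 1)) = min j (r * (s + 1)) := by omega
    have e2 : min j (r * (s + 1)) - max (r * t) (r * s) = 0 := by omega
    rw [e1, e2, sidePoly, mul_one]
  · have : r * t ≤ r * s := Nat.mul_le_mul_left r h
    have e1 : max (r * t) (r * s) = max i (r * s) := by omega
    have e2 : min (r * t) (r * (s + 1)) - max i (r * s) = 0 := by omega
    rw [e1, e2, sidePoly, one_mul]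

theorem chainPoly_self (i : ℕ) : chainPoly k r i i = 1 := by
  refine Finset.prod_eq_one fun s _ => ?_
  rw [show min i (r * (s + 1)) - max i (r * s) = 0 by omega, sidePoly]

theorem chainPoly_side {i j s : ℕ} (hs : s < k) (hi : r * s ≤ i)
    (hj : j ≤ r * (s + 1)) : chainPoly k r i j = sidePoly (j - i) := by
  rw [chainPoly, Finset.prod_eq_single s]
  · congr 1; omega
  · intro t _ hts
    rcases lt_or_gt_of_ne hts with h | h
    · have : r * (t + 1) ≤ r * s := Nat.mul_le_mul_left r h
      rw [show min j (r * (t + 1)) - max i (r * t) = 0 by omega, sidePoly]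
    · have : r * (s + 1) ≤ r * t := Nat.mul_le_mul_left r h
      rw [show min j (r * (t + 1)) - max i (r * t) = 0 by omega, sidePoly]
  · intro h; exact absurd (Finset.mem_range.2 hs) h

/-- Peel off the first side. Cutting at the corner `c` occurs in both parts, and the subtracted term
of `splitPoly_mul` removes the duplicate. -/
theorem splitPoly_chainPoly (hr : 0 < r) {i j : ℕ} (hij : i ≤ j) (hj : j ≤ k * r) :
    splitPoly (chainPoly k r i j) =
      ∑ m ∈ Finset.Ico i (j + 1), inFst (chainPoly k r i m) * inSnd (chainPoly k r m j) := by
  induction hn : j - i using Nat.strong_induction_on generalizing i j with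
  | _ n ih =>
  rcases hij.eq_or_lt with rfl | hij
  · simp [chainPoly_self, splitPoly_one, Algebra.TensorProduct.one_def]
  have h0 : r * (i / r) ≤ i := Nat.mul_div_le i r
  have h1 : i < r * (i / r + 1) := Nat.lt_mul_div_succ i hr
  by_cases hc : j ≤ r * (i / r + 1)
  · have hs : i / r < k := Nat.div_lt_of_lt_mul (by rw [mul_comm]; omega)
    rw [chainPoly_side hs h0 hc, splitPoly_sidePoly, Finset.Nat.sum_antidiagonal_eq_sum_range_succ
      (fun a b => inFst (sidePoly a) * inSnd (sidePoly b)), Finset.sum_Ico_eq_sum_range,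
      show j + 1 - i = j - i + 1 by omega]
    refine Finset.sum_congr rfl fun m hm => ?_
    have := Finset.mem_range.1 hm
    rw [chainPoly_side hs h0 (by omega), chainPoly_side hs (by omega) hc,
      show i + m - i = m by omega, show j - (i + m) = j - i - m by omega]
  · push Not at hc
    have hci := h1.le
    set c := r * (i / r + 1) with hcd
    have hm : ∀ {a b}, a ≤ c → c ≤ b → chainPoly k r a b = chainPoly k r a c * chainPoly k r c b :=
      fun ha hb => chainPoly_mul ha hb
    rw [hm hci hc.le, splitPoly_mul, ih (c - i) (by omega) hci (by omega) rfl,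
      ih (j - c) (by omega) hc.le hj rfl, Finset.sum_mul, Finset.mul_sum,
      Finset.sum_Ico_succ_top hci, chainPoly_self, ← Finset.sum_Ico_consecutive _ hci
      (show c ≤ j + 1 by omega)]
    have e1 : ∀ m ∈ Finset.Ico i c, inFst (chainPoly k r i m) * inSnd (chainPoly k r m c) *
        inSnd (chainPoly k r c j) = inFst (chainPoly k r i m) * inSnd (chainPoly k r m j) := by
      intro m hm'
      have := (Finset.mem_Ico.1 hm').2
      rw [hm this.le hc.le, map_mul]; ring
    have e2 : ∀ m ∈ Finset.Ico c (j + 1), inFst (chainPoly k r i c) *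
        (inFst (chainPoly k r c m) * inSnd (chainPoly k r m j)) =
        inFst (chainPoly k r i m) * inSnd (chainPoly k r m j) := by
      intro m hm'
      have := (Finset.mem_Ico.1 hm').1
      rw [hm hci this, map_mul]; ring
    rw [Finset.sum_congr rfl e1, Finset.sum_congr rfl e2, map_one]
    ring

theorem coeff_zero_chainPoly (hr : 0 < r) {i j : ℕ} (hij : i < j) (hj : j ≤ k * r) :
    (chainPoly k r i j).coeff 0 = 0 := by
  have h0 : r * (i / r) ≤ i := Nat.mul_div_le i r
  have h1 : i < r * (i / r + 1) := Nat.lt_mul_div_succ i hr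
  have hs : i / r < k := Nat.div_lt_of_lt_mul (by rw [mul_comm]; omega)
  rw [chainPoly, Polynomial.coeff_zero_prod]
  refine Finset.prod_eq_zero (Finset.mem_range.2 hs) ?_
  obtain ⟨n, hn⟩ : ∃ n, min j (r * (i / r + 1)) - max i (r * (i / r)) = n + 1 :=
    ⟨min j (r * (i / r + 1)) - max i (r * (i / r)) - 1, by omega⟩
  rw [hn, coeff_zero_sidePoly]

/-- The polynomial is a product of two factors without constant term, so its linear coefficient
vanishes and only the convolution remains. -/
theorem catalanFunctional_chainPoly_of_lt (hr : 0 < r) {i j : ℕ} (hij : r * (i / r + 1) < j)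
    (hj : j ≤ k * r) : catalanFunctional (chainPoly k r i j) = ∑ m ∈ Finset.Ioo i j,
      catalanFunctional (chainPoly k r i m) * catalanFunctional (chainPoly k r m j) := by
  have h1 : i < r * (i / r + 1) := Nat.lt_mul_div_succ i hr
  rw [catalanFunctional_eq, splitPoly_chainPoly hr (by omega) hj, map_sum]
  simp only [catalanPair_apply]
  rw [Finset.sum_Ico_succ_top (by omega), chainPoly_self, catalanFunctional_one, mul_zero, add_zero,
    Finset.sum_eq_sum_Ico_succ_bot (by omega), chainPoly_self, catalanFunctional_one, zero_mul,
    zero_add, chainPoly_mul h1.le hij.le, Polynomial.mul_coeff_one,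
    coeff_zero_chainPoly hr h1 (by omega), coeff_zero_chainPoly hr hij hj]
  simp only [zero_mul, mul_zero, add_zero]
  rfl

theorem catalanFunctional_chainPoly_succ (hr : 0 < r) {i : ℕ} (hi : i + 1 ≤ k * r) :
    catalanFunctional (chainPoly k r i (i + 1)) = 1 := by
  have h0 : r * (i / r) ≤ i := Nat.mul_div_le i r
  have h1 : i < r * (i / r + 1) := Nat.lt_mul_div_succ i hr
  have hs : i / r < k := Nat.div_lt_of_lt_mul (by rw [mul_comm]; omega)
  rw [chainPoly_side hs h0 (by omega), show i + 1 - i = 1 by omega, sidePoly, catalanFunctional_X]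

theorem catalanFunctional_chainPoly_eq_zero {i j : ℕ} (hij : i < j)
    (hj : j ≤ k * r) (hc : ¬IsChord r i j) : catalanFunctional (chainPoly k r i j) = 0 := by
  have h0 : r * (i / r) ≤ i := Nat.mul_div_le i r
  have hs : i / r < k := Nat.div_lt_of_lt_mul (by rw [mul_comm]; omega)
  simp only [IsChord, not_or, not_lt] at hc
  obtain ⟨n, hn⟩ : ∃ n, j - i = n + 2 := ⟨j - i - 2, by omega⟩
  rw [chainPoly_side hs h0 hc.2, hn, catalanFunctional_sidePoly]

theorem chainPoly_tail : chainPoly (k + 1) r r ((k + 1) * r) = sidePoly r ^ k := by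
  rw [chainPoly, Finset.prod_range_succ', show min ((k + 1) * r) (r * (0 + 1)) - max r (r * 0) = 0
    by simp, sidePoly, mul_one, Finset.prod_eq_pow_card (b := sidePoly r), Finset.card_range]
  intro s hs
  have h1 : r * (s + 1 + 1) ≤ (k + 1) * r := by
    rw [mul_comm]; exact Nat.mul_le_mul_right r (by have := Finset.mem_range.1 hs; omega)
  have h2 : r * (s + 1 + 1) = r * (s + 1) + r := by ring
  have h3 : r * (s + 1) = r * s + r := by ring
  congr 1; omega

/-- The full sum for the chain from 1 to `k * r` exceeds the count by the terms `2 ≤ m ≤ r`, of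
which only `m = 2` survives. So the count is a difference of two values of the functional, in which
`sidePoly r` is factored once by its recurrence. -/
theorem tr_eq_catalanFunctional (hk : 3 ≤ k) (hr : 2 < r) :
    (tr k r : ℝ) = catalanFunctional
      (X * ((sidePoly (r - 1) - sidePoly (r - 2)) ^ 2 * sidePoly r ^ (k - 2))) := by
  have hr0 : 0 < r := by omega
  have hkr : 3 * r ≤ k * r := Nat.mul_le_mul_right r hk
  have h1r : 1 / r = 0 := Nat.div_eq_of_lt (by omega)
  rw [tr_eq_sum hk hr (G := fun i j => catalanFunctional (chainPoly k r i j))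
    (fun i hi => catalanFunctional_chainPoly_succ hr0 hi)
    (fun i j hij hj hc => catalanFunctional_chainPoly_eq_zero hij hj hc)
    (fun i j hij hj => catalanFunctional_chainPoly_of_lt hr0 hij hj)]
  have h1 := catalanFunctional_chainPoly_of_lt (k := k) (i := 1) (j := k * r) hr0
    (by rw [h1r]; omega) le_rfl
  have hd : Finset.Ioo 1 (k * r) = insert 2 (Finset.Ioc 2 r ∪ Finset.Ioo r (k * r)) := by
    ext x; simp only [Finset.mem_Ioo, Finset.mem_insert, Finset.mem_union, Finset.mem_Ioc]; omega
  rw [hd, Finset.sum_insert (by simp; omega), Finset.sum_union (by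
    rw [Finset.disjoint_left]; intro x; simp only [Finset.mem_Ioo, Finset.mem_Ioc]; omega),
    Finset.sum_eq_zero (s := Finset.Ioc 2 r), catalanFunctional_chainPoly_succ hr0 (by omega),
    one_mul, zero_add] at h1
  · rw [eq_sub_iff_add_eq'.2 h1.symm, ← map_sub]
    congr 1
    have hm : ∀ {a}, a ≤ r → chainPoly k r a (k * r) =
        chainPoly k r a r * chainPoly k r r (k * r) := by
      intro a ha
      have := chainPoly_mul (k := k) (r := r) (i := a) (j := k * r) (t := 1) (by simpa using ha)
        (by omega)
      simpa using this
    have hP : sidePoly r = X * (sidePoly (r - 1) - sidePoly (r - 2)) := by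
      obtain ⟨n, rfl⟩ : ∃ n, r = n + 2 := ⟨r - 2, by omega⟩
      rfl
    have hs : ∀ {a}, chainPoly k r a r = sidePoly (r - a) := fun {a} =>
      chainPoly_side (s := 0) (by omega) (by omega) (by omega)
    rw [hm (a := 1) (by omega), hm (a := 2) (by omega), hs, hs]
    obtain ⟨l, rfl⟩ : ∃ l, k = l + 2 := ⟨k - 2, by omega⟩
    rw [chainPoly_tail, show l + 2 - 2 = l by omega, pow_succ]
    conv_lhs => rw [hP]
    conv_rhs => rw [hP]
    ring
  · intro m hm
    obtain ⟨h2, h3⟩ := Finset.mem_Ioc.1 hm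
    rw [catalanFunctional_chainPoly_eq_zero (by omega) (by omega), zero_mul]
    simp only [IsChord, h1r]
    omega

end chain

/-! ### Integral representation of the count -/

theorem integral_cos_pow_even_half_pi (n : ℕ) :
    4 ^ n * ∫ x in (0 : ℝ)..Real.pi / 2, Real.cos x ^ (2 * n) =
      Real.pi / 2 * n.centralBinom := by
  induction n with
  | zero => simp
  | succ n ih =>
    rw [show 2 * (n + 1) = 2 * n + 2 by ring, integral_cos_pow]
    have h : ((n : ℝ) + 1) * (n + 1).centralBinom = 2 * (2 * n + 1) * n.centralBinom := by
      exact_mod_cast Nat.succ_mul_centralBinom_succ n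
    have hn : (n : ℝ) + 1 ≠ 0 := by positivity
    simp only [Real.cos_pi_div_two, Real.sin_zero, mul_zero]
    apply mul_left_cancel₀ hn
    push_cast
    rw [pow_succ]
    have h3 : (2 : ℝ) * n + 2 ≠ 0 := by positivity
    field_simp
    rw [zero_pow (by omega)]
    linear_combination (4 * (2 * (n : ℝ) + 1)) * ih - Real.pi * h

/-- By sin^2 = 1 - cos^2 and Wallis, the right side is twice the n-th central binomial coefficient
minus half the next one. -/
theorem catalan_eq_integral (n : ℕ) : (catalan n : ℝ) =
    4 / Real.pi * ∫ x in (0 : ℝ)..Real.pi / 2, (4 * Real.cos x ^ 2) ^ n * Real.sin x ^ 2 := by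
  have h1 : ∀ x : ℝ, (4 * Real.cos x ^ 2) ^ n * Real.sin x ^ 2 =
      4 ^ n * Real.cos x ^ (2 * n) - 4 ^ n * Real.cos x ^ (2 * (n + 1)) := by
    intro x; rw [Real.sin_sq, mul_pow, ← pow_mul]; ring
  simp only [h1]
  rw [intervalIntegral.integral_sub (Continuous.intervalIntegrable (by fun_prop) _ _)
    (Continuous.intervalIntegrable (by fun_prop) _ _), intervalIntegral.integral_const_mul,
    intervalIntegral.integral_const_mul]
  have e1 := integral_cos_pow_even_half_pi n
  have e2 := integral_cos_pow_even_half_pi (n + 1)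
  have h : ((n : ℝ) + 1) * (n + 1).centralBinom = 2 * (2 * n + 1) * n.centralBinom := by
    exact_mod_cast Nat.succ_mul_centralBinom_succ n
  have hc : ((n : ℝ) + 1) * catalan n = n.centralBinom := by
    exact_mod_cast succ_mul_catalan_eq_centralBinom n
  rw [e1, show (4 : ℝ) ^ n * ∫ x in (0 : ℝ)..Real.pi / 2, Real.cos x ^ (2 * (n + 1)) =
    (Real.pi / 2 * (n + 1).centralBinom) / 4 by rw [← e2]; ring]
  have hn : (n : ℝ) + 1 ≠ 0 := by positivity
  apply mul_left_cancel₀ hn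
  rw [hc]
  have := Real.pi_ne_zero
  field_simp
  linear_combination h

theorem catalanFunctional_X_mul (q : Polynomial ℝ) :
    catalanFunctional (Polynomial.X * q) =
      4 / Real.pi * ∫ x in (0 : ℝ)..Real.pi / 2,
        q.eval (4 * Real.cos x ^ 2) * Real.sin x ^ 2 := by
  have hc : ∀ q : Polynomial ℝ, Continuous fun x : ℝ =>
      q.eval (4 * Real.cos x ^ 2) * Real.sin x ^ 2 := fun q =>
    (q.continuous.comp (by fun_prop)).mul (by fun_prop)
  induction q using Polynomial.induction_on' with
  | add p q hp hq =>
    simp only [mul_add, map_add, hp, hq, Polynomial.eval_add, add_mul]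
    rw [intervalIntegral.integral_add ((hc p).intervalIntegrable _ _)
      ((hc q).intervalIntegrable _ _), mul_add]
  | monomial n a =>
    have h1 : Polynomial.X * Polynomial.monomial n a = a • (Polynomial.X ^ (n + 1)) := by
      rw [← Polynomial.C_mul_X_pow_eq_monomial, Polynomial.smul_eq_C_mul]; ring
    rw [h1, map_smul, catalanFunctional_X_pow, if_neg (by omega), Nat.add_sub_cancel,
      catalan_eq_integral, smul_eq_mul]
    simp only [Polynomial.eval_monomial, mul_assoc]
    rw [intervalIntegral.integral_const_mul]
    ring

/-- In the variable 4 cos^2 x the side polynomial is (2 cos x)^n U_n(cos x), with U_n the Chebyshev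
polynomial of the second kind. -/
theorem eval_sidePoly (n : ℕ) (x : ℝ) :
    (sidePoly n).eval (4 * Real.cos x ^ 2) * Real.sin x =
      (2 * Real.cos x) ^ n * Real.sin ((n + 1) * x) := by
  induction n using Nat.twoStepInduction with
  | zero => simp [sidePoly]
  | one =>
    simp only [sidePoly, Polynomial.eval_X]
    rw [show ((1 : ℕ) + 1 : ℝ) * x = 2 * x by push_cast; ring, Real.sin_two_mul]; ring
  | more n h1 h2 =>
    rw [sidePoly, Polynomial.eval_mul, Polynomial.eval_X, Polynomial.eval_sub, mul_assoc, sub_mul,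
      h1, h2]
    have e1 : ((n + 1 : ℕ) + 1 : ℝ) * x = (n + 1) * x + x := by push_cast; ring
    have e2 : ((n + 2 : ℕ) + 1 : ℝ) * x = (n + 1) * x + 2 * x := by push_cast; ring
    rw [e1, e2, Real.sin_add, Real.sin_add, Real.cos_two_mul, Real.sin_two_mul]
    ring

theorem eval_sidePoly_sub (n : ℕ) (x : ℝ) :
    (sidePoly (n + 1) - sidePoly n).eval (4 * Real.cos x ^ 2) * Real.sin x =
      (2 * Real.cos x) ^ n * Real.sin ((n + 3) * x) := by
  rw [Polynomial.eval_sub, sub_mul, eval_sidePoly, eval_sidePoly]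
  have e1 : ((n + 1 : ℕ) + 1 : ℝ) * x = (n + 1) * x + x := by push_cast; ring
  have e2 : ((n : ℝ) + 3) * x = (n + 1) * x + 2 * x := by ring
  rw [e1, e2, Real.sin_add, Real.sin_add, Real.cos_two_mul, Real.sin_two_mul]
  ring

theorem tr_eq_integral {k r : ℕ} (hk : 3 ≤ k) (hr : 2 < r) : (tr k r : ℝ) =
    4 / Real.pi * 2 ^ (k * r - 4) * ∫ x in (0 : ℝ)..Real.pi / 2,
      Real.cos x ^ (k * r - 4) * Real.sin ((r + 1) * x) ^ k / Real.sin x ^ (k - 2) := by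
  rw [tr_eq_catalanFunctional hk hr, catalanFunctional_X_mul, mul_assoc,
    ← intervalIntegral.integral_const_mul ((2 : ℝ) ^ (k * r - 4))]
  congr 1
  refine intervalIntegral.integral_congr fun x _ => ?_
  obtain ⟨l, rfl⟩ : ∃ l, k = l + 2 := ⟨k - 2, by omega⟩
  obtain ⟨n, rfl⟩ : ∃ n, r = n + 2 := ⟨r - 2, by omega⟩
  simp only [Nat.add_sub_cancel, show n + 2 - 1 = n + 1 by omega]
  -- Where the sine vanishes both sides are 0, on the right by the convention for division by zero.
  by_cases hs : Real.sin x = 0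
  · simp only [hs, zero_pow (show l ≠ 0 by omega), div_zero, mul_zero]
    simp
  have h1 := eval_sidePoly_sub n x
  have h2 := eval_sidePoly (n + 2) x
  rw [Polynomial.eval_mul, Polynomial.eval_pow, Polynomial.eval_pow]
  rw [show ((n + 2 : ℕ) + 1 : ℝ) * x = (n + 3) * x by push_cast; ring] at h2 ⊢
  rw [mul_div_assoc', eq_div_iff (pow_ne_zero _ hs)]
  have h3 : (l + 2) * (n + 2) - 4 = 2 * n + l * (n + 2) := by
    have : (l + 2) * (n + 2) = 2 * n + l * (n + 2) + 4 := by ring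
    omega
  rw [h3]
  set A := (sidePoly (n + 1) - sidePoly n).eval (4 * Real.cos x ^ 2)
  set B := (sidePoly (n + 2)).eval (4 * Real.cos x ^ 2)
  calc A ^ 2 * B ^ l * Real.sin x ^ 2 * Real.sin x ^ l
      = (A * Real.sin x) ^ 2 * (B * Real.sin x) ^ l := by ring
    _ = _ := by
      rw [h1, h2]
      simp only [mul_pow, ← pow_mul, pow_add]
      ring

/-! ### Tail bounds for oscillating integrals -/

/-- Integration by parts: the boundary terms are at most M (φ a + φ b), the remaining integral at
most M (φ a - φ b). -/
theorem abs_integral_mul_le_of_antitone {a b M : ℝ} {φ φ' S S' : ℝ → ℝ} (hab : a ≤ b)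
    (hφ : ∀ x ∈ Set.Icc a b, HasDerivAt φ (φ' x) x) (hφ' : ContinuousOn φ' (Set.Icc a b))
    (hneg : ∀ x ∈ Set.Icc a b, φ' x ≤ 0) (hb : 0 ≤ φ b)
    (hS : ∀ x, HasDerivAt S (S' x) x) (hS' : Continuous S') (hM : ∀ x, |S x| ≤ M) :
    |∫ x in a..b, S' x * φ x| ≤ 2 * M * φ a := by
  have hu : Set.uIcc a b = Set.Icc a b := Set.uIcc_of_le hab
  have hi : IntervalIntegrable φ' MeasureTheory.volume a b :=
    ContinuousOn.intervalIntegrable (by rwa [hu])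
  have h1 := intervalIntegral.integral_deriv_mul_eq_sub (u := S) (v := φ)
    (u' := S') (v' := φ') (a := a) (b := b)
    (fun x _ => hS x) (fun x hx => hφ x (hu ▸ hx)) (hS'.intervalIntegrable _ _) hi
  have hSc : Continuous S := continuous_iff_continuousAt.2 fun x => (hS x).continuousAt
  have hφc : ContinuousOn φ (Set.Icc a b) := fun x hx => (hφ x hx).continuousAt.continuousWithinAt
  have i1 : IntervalIntegrable (fun x => S' x * φ x) MeasureTheory.volume a b :=
    ContinuousOn.intervalIntegrable (by rw [hu]; exact hS'.continuousOn.mul hφc)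
  have i2 : IntervalIntegrable (fun x => S x * φ' x) MeasureTheory.volume a b :=
    ContinuousOn.intervalIntegrable (by rw [hu]; exact hSc.continuousOn.mul hφ')
  rw [intervalIntegral.integral_add i1 i2] at h1
  have h2 : ∫ x in a..b, φ' x = φ b - φ a :=
    intervalIntegral.integral_eq_sub_of_hasDerivAt (fun x hx => hφ x (hu ▸ hx)) hi
  have h3 : ‖∫ x in a..b, S x * φ' x‖ ≤ ∫ x in a..b, -M * φ' x := by
    refine intervalIntegral.norm_integral_le_of_norm_le hab ?_ (hi.const_mul _)
    refine MeasureTheory.ae_of_all _ fun x hx => ?_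
    have := hneg x ⟨hx.1.le, hx.2⟩
    rw [Real.norm_eq_abs, abs_mul, abs_of_nonpos this]
    nlinarith [mul_le_mul_of_nonneg_right (hM x) (neg_nonneg.2 this)]
  rw [intervalIntegral.integral_const_mul, h2, Real.norm_eq_abs] at h3
  have hanti : φ b ≤ φ a := by
    have : 0 ≤ ∫ x in a..b, -φ' x :=
      intervalIntegral.integral_nonneg hab fun x hx => neg_nonneg.2 (hneg x hx)
    rw [intervalIntegral.integral_neg] at this
    linarith
  have ha := hM a
  have hb' := hM b
  rw [abs_le] at *
  have m1 := mul_le_mul_of_nonneg_right ha.1 (hb.trans hanti)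
  have m2 := mul_le_mul_of_nonneg_right ha.2 (hb.trans hanti)
  have m3 := mul_le_mul_of_nonneg_right hb'.1 hb
  have m4 := mul_le_mul_of_nonneg_right hb'.2 hb
  constructor <;> nlinarith

/-- For `k ≥ 4` the weight is dominated by a multiple of x^(-2). For `k = 3` it only decays like
1/x, and monotonicity together with a bounded antiderivative of sin^3(2x) replaces absolute
convergence. The bound serves the limit integrand and, uniformly in r, the rescaled ones. -/
theorem abs_integral_sin_pow_mul_le {k : ℕ} (hk : 3 ≤ k) {A B c : ℝ} (hA : 1 ≤ A) (hAB : A ≤ B)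
    (hc : 1 ≤ c) {φ : ℝ → ℝ}
    (h0 : ∀ x ∈ Set.Icc A B, 0 ≤ φ x) (hle : ∀ x ∈ Set.Icc A B, φ x ≤ (c / x) ^ (k - 2))
    (hd : k = 3 → ∃ φ' : ℝ → ℝ, (∀ x ∈ Set.Icc A B, HasDerivAt φ (φ' x) x) ∧
      ContinuousOn φ' (Set.Icc A B) ∧ ∀ x ∈ Set.Icc A B, φ' x ≤ 0) :
    |∫ x in A..B, Real.sin (2 * x) ^ k * φ x| ≤ 2 * c ^ (k - 2) / A := by
  have hA0 : 0 < A := by linarith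
  have hAm : A ∈ Set.Icc A B := ⟨le_rfl, hAB⟩
  rcases hk.eq_or_lt with rfl | hk
  · obtain ⟨φ', h1, h2, h3⟩ := hd rfl
    have hS : ∀ x : ℝ, HasDerivAt (fun x => Real.cos (2 * x) ^ 3 / 6 - Real.cos (2 * x) / 2)
        (Real.sin (2 * x) ^ 3) x := by
      intro x
      have e1 : HasDerivAt (fun x : ℝ => Real.cos (2 * x)) (-Real.sin (2 * x) * 2) x := by
        have := ((hasDerivAt_id' x).const_mul 2).cos
        simpa using this
      refine (((e1.pow 3).div_const 6).sub (e1.div_const 2)).congr_deriv ?_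
      have := Real.sin_sq_add_cos_sq (2 * x)
      simp only [Nat.cast_ofNat]
      linear_combination (-Real.sin (2 * x)) * this
    have hM : ∀ x : ℝ, |Real.cos (2 * x) ^ 3 / 6 - Real.cos (2 * x) / 2| ≤ 1 := by
      intro x
      have l1 := Real.neg_one_le_cos (2 * x)
      have l2 := Real.cos_le_one (2 * x)
      rw [abs_le]
      constructor <;> nlinarith [sq_nonneg (Real.cos (2 * x))]
    have := abs_integral_mul_le_of_antitone hAB h1 h2 h3 (h0 B ⟨hAB, le_rfl⟩) hS (by fun_prop) hM
    refine this.trans ?_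
    have := hle A hAm
    simp only [Nat.reduceSub, pow_one] at this ⊢
    calc 2 * 1 * φ A ≤ 2 * 1 * (c / A) := by gcongr
      _ = 2 * c / A := by ring
  · have hint : ∫ x in A..B, c ^ (k - 2) * x ^ (-2 : ℤ) = c ^ (k - 2) * (1 / A - 1 / B) := by
      rw [intervalIntegral.integral_const_mul, integral_zpow]
      · norm_num
        left; ring
      · right
        refine ⟨by norm_num, ?_⟩
        rw [Set.uIcc_of_le hAB]
        intro h; linarith [h.1]
    have : ‖∫ x in A..B, Real.sin (2 * x) ^ k * φ x‖ ≤ ∫ x in A..B, c ^ (k - 2) * x ^ (-2 : ℤ) := by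
      refine intervalIntegral.norm_integral_le_of_norm_le hAB ?_ ?_
      · refine MeasureTheory.ae_of_all _ fun x hx => ?_
        have hx' : x ∈ Set.Icc A B := ⟨hx.1.le, hx.2⟩
        have hx0 : 1 ≤ x := hA.trans hx'.1
        rw [norm_mul, norm_pow, Real.norm_eq_abs, Real.norm_eq_abs, abs_of_nonneg (h0 x hx')]
        calc |Real.sin (2 * x)| ^ k * φ x ≤ 1 * (c / x) ^ (k - 2) :=
              mul_le_mul (pow_le_one₀ (abs_nonneg _) (Real.abs_sin_le_one _)) (hle x hx')
                (h0 x hx') zero_le_one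
          _ = c ^ (k - 2) * (x ^ (k - 2))⁻¹ := by rw [one_mul, div_pow, div_eq_mul_inv]
          _ ≤ c ^ (k - 2) * x ^ (-2 : ℤ) := by
            rw [zpow_neg]
            gcongr
            have := pow_le_pow_right₀ hx0 (show 2 ≤ k - 2 by omega)
            exact_mod_cast this
      · apply ContinuousOn.intervalIntegrable
        rw [Set.uIcc_of_le hAB]
        refine continuousOn_const.mul (ContinuousOn.zpow₀ continuousOn_id _ fun x hx => Or.inl ?_)
        have : 1 ≤ x := hA.trans hx.1
        simp only [id]; linarith
    rw [hint, Real.norm_eq_abs] at this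
    refine this.trans ?_
    have hB : 0 ≤ 1 / B := by have : 0 < B := by linarith
                              positivity
    have hcp : 0 ≤ c ^ (k - 2) := by positivity
    rw [show 2 * c ^ (k - 2) / A = 2 * (c ^ (k - 2) * (1 / A)) by ring]
    have : 0 ≤ 1 / A := by positivity
    nlinarith [mul_nonneg hcp hB, mul_nonneg hcp this]

/-! ### The improper integral: convergence and positivity -/

/-- The integrand of the limit. -/
noncomputable def sinPowDiv (k : ℕ) (u : ℝ) : ℝ := Real.sin (2 * u) ^ k / u ^ (k - 2)

/-- The sinc form shows continuity at 0, where the quotient has the value 0 by convention. -/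
theorem sinPowDiv_eq {k : ℕ} (hk : 3 ≤ k) (u : ℝ) :
    sinPowDiv k u = Real.sin (2 * u) ^ 2 * (2 * Real.sinc (2 * u)) ^ (k - 2) := by
  obtain ⟨l, rfl⟩ : ∃ l, k = l + 2 := ⟨k - 2, by omega⟩
  rw [sinPowDiv, Nat.add_sub_cancel]
  by_cases hu : u = 0
  · simp [hu]
  · rw [Real.sinc_of_ne_zero (by simpa using hu), show 2 * (Real.sin (2 * u) / (2 * u)) =
      Real.sin (2 * u) / u by field_simp, div_pow, mul_div_assoc', pow_add, mul_comm]

theorem continuous_sinPowDiv {k : ℕ} (hk : 3 ≤ k) : Continuous (sinPowDiv k) := by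
  have : sinPowDiv k = fun u => Real.sin (2 * u) ^ 2 * (2 * Real.sinc (2 * u)) ^ (k - 2) :=
    funext (sinPowDiv_eq hk)
  rw [this]
  have := Real.continuous_sinc
  fun_prop

theorem sinPowDiv_neg {k : ℕ} (hk : 3 ≤ k) (u : ℝ) : sinPowDiv k (-u) = sinPowDiv k u := by
  simp [sinPowDiv_eq hk, Real.sinc_neg]

theorem abs_integral_sinPowDiv_le {k : ℕ} (hk : 3 ≤ k) {A B : ℝ} (hA : 1 ≤ A) (hAB : A ≤ B) :
    |∫ x in A..B, sinPowDiv k x| ≤ 2 / A := by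
  have hx0 : ∀ x ∈ Set.Icc A B, 0 < x := fun x hx => by linarith [hx.1]
  have := abs_integral_sin_pow_mul_le hk hA hAB le_rfl (φ := fun x => (1 / x) ^ (k - 2))
    (fun x hx => by have := hx0 x hx; positivity) (fun x hx => le_rfl) (by
      rintro rfl
      refine ⟨fun x => -(x ^ 2)⁻¹, fun x hx => ?_, ?_, fun x hx => ?_⟩
      · simpa using hasDerivAt_inv (hx0 x hx).ne'
      · exact (ContinuousOn.inv₀ (by fun_prop) fun x hx => pow_ne_zero 2 (hx0 x hx).ne').neg
      · simp only [Left.neg_nonpos_iff]; positivity)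
  simp only [one_pow, mul_one] at this
  convert this using 4 with x
  rw [sinPowDiv, div_pow, one_pow, mul_one_div]

theorem exists_tendsto_integral_sinPowDiv {k : ℕ} (hk : 3 ≤ k) :
    ∃ L : ℝ, Tendsto (fun B => ∫ x in (0 : ℝ)..B, sinPowDiv k x) atTop (𝓝 L) := by
  rw [← cauchy_map_iff_exists_tendsto]
  change CauchySeq _
  have hi : ∀ a b, IntervalIntegrable (sinPowDiv k) MeasureTheory.volume a b :=
    fun a b => (continuous_sinPowDiv hk).intervalIntegrable a b
  rw [Metric.cauchySeq_iff']
  intro ε hε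
  refine ⟨max 1 (4 / ε), fun n hn => ?_⟩
  have h1 : 1 ≤ max 1 (4 / ε) := le_max_left _ _
  have h2 : 4 / ε ≤ max 1 (4 / ε) := le_max_right _ _
  rw [Real.dist_eq, intervalIntegral.integral_interval_sub_left (hi _ _) (hi _ _)]
  refine (abs_integral_sinPowDiv_le hk h1 hn).trans_lt ?_
  rw [div_lt_iff₀ (by linarith)]
  rw [div_le_iff₀ hε] at h2
  linarith

/-- A shift by π/2 changes the sign of sin(2u) and enlarges the denominator, so a possibly negative
value is outweighed by the earlier positive one. -/
theorem sinPowDiv_add_pos {k : ℕ} (hk : 3 ≤ k) {u : ℝ} (hu : 0 < u) (hs : 0 < Real.sin (2 * u)) :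
    0 < sinPowDiv k u + sinPowDiv k (u + Real.pi / 2) := by
  have hpi := Real.pi_pos
  have h1 : Real.sin (2 * (u + Real.pi / 2)) = -Real.sin (2 * u) := by
    rw [show 2 * (u + Real.pi / 2) = 2 * u + Real.pi by ring, Real.sin_add_pi]
  have h2 : |sinPowDiv k (u + Real.pi / 2)| < sinPowDiv k u := by
    rw [sinPowDiv, sinPowDiv, h1, abs_div, abs_pow, abs_neg, abs_of_pos hs, abs_pow,
      abs_of_pos (by linarith)]
    apply div_lt_div_of_pos_left (pow_pos hs k) (pow_pos hu _)
    exact pow_lt_pow_left₀ (by linarith) hu.le (by omega)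
  linarith [(abs_lt.1 h2).1, neg_abs_le (sinPowDiv k (u + Real.pi / 2))]

theorem integral_sinPowDiv_period_pos {k : ℕ} (hk : 3 ≤ k) (j : ℕ) :
    0 < ∫ x in (j * Real.pi : ℝ)..((j + 1 : ℕ) * Real.pi), sinPowDiv k x := by
  have hi : ∀ a b, IntervalIntegrable (sinPowDiv k) MeasureTheory.volume a b :=
    fun a b => (continuous_sinPowDiv hk).intervalIntegrable a b
  have hi' : ∀ a b, IntervalIntegrable (fun x => sinPowDiv k (x + Real.pi / 2))
      MeasureTheory.volume a b := fun a b =>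
    ((continuous_sinPowDiv hk).comp (continuous_add_const (Real.pi / 2))).intervalIntegrable a b
  have hpi := Real.pi_pos
  have h1 : ∫ x in (j * Real.pi : ℝ)..((j + 1 : ℕ) * Real.pi), sinPowDiv k x =
      ∫ x in (j * Real.pi : ℝ)..(j * Real.pi + Real.pi / 2),
        (sinPowDiv k x + sinPowDiv k (x + Real.pi / 2)) := by
    rw [intervalIntegral.integral_add (hi _ _) (hi' _ _),
      intervalIntegral.integral_comp_add_right (sinPowDiv k),
      intervalIntegral.integral_add_adjacent_intervals (hi _ _) (hi _ _)]
    congr 1; push_cast; ring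
  rw [h1]
  apply intervalIntegral.intervalIntegral_pos_of_pos_on
  · exact (hi _ _).add (hi' _ _)
  · intro x hx
    have h0 : 0 ≤ (j : ℝ) * Real.pi := by positivity
    refine sinPowDiv_add_pos hk (by linarith [hx.1]) ?_
    have : Real.sin (2 * x) = Real.sin (2 * x - j * (2 * Real.pi)) := by
      rw [Real.sin_sub_nat_mul_two_pi]
    rw [this]
    apply Real.sin_pos_of_pos_of_lt_pi <;> linarith [hx.1, hx.2]
  · linarith

/-- The integrals up to multiples of π increase, starting with a positive one. A nonzero limit is
what permits division by it in the asymptotic equivalence. -/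
theorem limit_sinPowDiv_pos {k : ℕ} (hk : 3 ≤ k) {L : ℝ}
    (hL : Tendsto (fun B => ∫ x in (0 : ℝ)..B, sinPowDiv k x) atTop (𝓝 L)) : 0 < L := by
  have hi : ∀ a b, IntervalIntegrable (sinPowDiv k) MeasureTheory.volume a b :=
    fun a b => (continuous_sinPowDiv hk).intervalIntegrable a b
  have hmono : Monotone fun j : ℕ => ∫ x in (0 : ℝ)..j * Real.pi, sinPowDiv k x := by
    refine monotone_nat_of_le_succ fun j => ?_
    rw [← intervalIntegral.integral_add_adjacent_intervals (hi 0 (j * Real.pi))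
      (hi _ ((j + 1 : ℕ) * Real.pi))]
    linarith [integral_sinPowDiv_period_pos hk j]
  have ht : Tendsto (fun j : ℕ => (j : ℝ) * Real.pi) atTop atTop :=
    tendsto_natCast_atTop_atTop.atTop_mul_const Real.pi_pos
  have := hmono.ge_of_tendsto (hL.comp ht) 1
  have h1 := integral_sinPowDiv_period_pos hk 0
  simp only [Nat.cast_zero, zero_mul, zero_add] at h1
  exact h1.trans_le this

theorem tendsto_improper_sinPowDiv {k : ℕ} (hk : 3 ≤ k) {L : ℝ}
    (hL : Tendsto (fun B => ∫ x in (0 : ℝ)..B, sinPowDiv k x) atTop (𝓝 L)) :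
    Tendsto (fun p : ℝ × ℝ => ∫ x in p.1..p.2, sinPowDiv k x) (atBot ×ˢ atTop) (𝓝 (2 * L)) := by
  have hi : ∀ a b, IntervalIntegrable (sinPowDiv k) MeasureTheory.volume a b :=
    fun a b => (continuous_sinPowDiv hk).intervalIntegrable a b
  have h1 : ∀ p : ℝ × ℝ, ∫ x in p.1..p.2, sinPowDiv k x =
      (∫ x in (0 : ℝ)..p.2, sinPowDiv k x) + ∫ x in (0 : ℝ)..-p.1, sinPowDiv k x := by
    intro p
    have h2 : ∫ x in (0 : ℝ)..-p.1, sinPowDiv k x = ∫ x in p.1..0, sinPowDiv k x := by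
      have := intervalIntegral.integral_comp_neg (sinPowDiv k) (a := p.1) (b := 0)
      simp only [sinPowDiv_neg hk, neg_zero] at this
      exact this.symm
    rw [h2, add_comm, intervalIntegral.integral_add_adjacent_intervals (hi _ _) (hi _ _)]
  simp only [h1]
  rw [two_mul]
  exact (hL.comp tendsto_snd).add (hL.comp (tendsto_neg_atBot_atTop.comp tendsto_fst))

/-! ### The rescaled weight -/

/-- The weight that replaces `1 / u ^ p` in the rescaled integral for the number of
triangulations. -/
noncomputable def scaledWeight (p N : ℕ) (n u : ℝ) : ℝ :=
  Real.cos (2 / n * u) ^ N / (n / 2 * Real.sin (2 / n * u)) ^ p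

section scaled

variable {p N : ℕ} {n u : ℝ}

/-- Jordan's inequality on [0, π/2]. It bounds the weight independently of `n` and `N`. -/
theorem scaled_bounds (hn : 0 < n) (hu : 0 < u) (hun : u ≤ n * Real.pi / 4) :
    0 ≤ Real.cos (2 / n * u) ∧ 0 < 2 * u / Real.pi ∧
      2 * u / Real.pi ≤ n / 2 * Real.sin (2 / n * u) := by
  have hpi := Real.pi_pos
  have hx0 : 0 ≤ 2 / n * u := by positivity
  have hx1 : 2 / n * u ≤ Real.pi / 2 := by
    rw [div_mul_eq_mul_div, div_le_iff₀ hn]; linarith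
  refine ⟨Real.cos_nonneg_of_neg_pi_div_two_le_of_le (by linarith) hx1, by positivity, ?_⟩
  have := mul_le_mul_of_nonneg_left (Real.mul_le_sin hx0 hx1) (show 0 ≤ n / 2 by positivity)
  refine le_of_eq_of_le ?_ this
  field_simp

theorem scaledWeight_nonneg (hn : 0 < n) (hu : 0 < u) (hun : u ≤ n * Real.pi / 4) :
    0 ≤ scaledWeight p N n u := by
  obtain ⟨h1, h2, h3⟩ := scaled_bounds hn hu hun
  have := h2.trans_le h3
  unfold scaledWeight
  positivity

theorem scaledWeight_le (hn : 0 < n) (hu : 0 < u) (hun : u ≤ n * Real.pi / 4) :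
    scaledWeight p N n u ≤ (Real.pi / 2 / u) ^ p := by
  obtain ⟨h1, h2, h3⟩ := scaled_bounds hn hu hun
  have hpi := Real.pi_pos
  unfold scaledWeight
  calc Real.cos (2 / n * u) ^ N / (n / 2 * Real.sin (2 / n * u)) ^ p
      ≤ 1 / (2 * u / Real.pi) ^ p := by
        gcongr
        exact pow_le_one₀ h1 (Real.cos_le_one _)
    _ = (Real.pi / 2 / u) ^ p := by
        rw [← one_div_pow]; congr 1; field_simp

/-- Near 0 the factor |sin(2u)| ≤ 2u compensates the pole of the weight; the constant dominates
uniformly in `n` and `N`. -/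
theorem abs_sin_pow_mul_scaledWeight_le {k : ℕ} (hk : 2 ≤ k) (hn : 0 < n) (hu : 0 < u)
    (hun : u ≤ n * Real.pi / 4) :
    |Real.sin (2 * u) ^ k * scaledWeight (k - 2) N n u| ≤ Real.pi ^ (k - 2) := by
  have hpi := Real.pi_pos
  rw [abs_mul, abs_of_nonneg (scaledWeight_nonneg hn hu hun), abs_pow]
  have h1 : |Real.sin (2 * u)| ≤ 2 * u := by
    have := Real.abs_sin_le_abs (x := 2 * u)
    rwa [abs_of_pos (show 0 < 2 * u by linarith)] at this
  calc |Real.sin (2 * u)| ^ k * scaledWeight (k - 2) N n u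
      ≤ |Real.sin (2 * u)| ^ (k - 2) * (Real.pi / 2 / u) ^ (k - 2) := by
        refine mul_le_mul ?_ (scaledWeight_le hn hu hun) (scaledWeight_nonneg hn hu hun)
          (by positivity)
        exact pow_le_pow_of_le_one (abs_nonneg _) (Real.abs_sin_le_one _) (by omega)
    _ ≤ (2 * u) ^ (k - 2) * (Real.pi / 2 / u) ^ (k - 2) := by gcongr
    _ = Real.pi ^ (k - 2) := by rw [← mul_pow]; congr 1; field_simp

theorem measurable_scaledWeight : Measurable (scaledWeight p N n) := by
  unfold scaledWeight; fun_prop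

theorem abs_integral_scaledWeight_le {k : ℕ} (hk : 3 ≤ k) (hn : 0 < n) {A : ℝ} (hA : 1 ≤ A)
    (hAn : A ≤ n * Real.pi / 4) :
    |∫ u in A..n * Real.pi / 4, Real.sin (2 * u) ^ k * scaledWeight (k - 2) N n u| ≤
      2 * (Real.pi / 2) ^ (k - 2) / A := by
  have hx0 : ∀ x ∈ Set.Icc A (n * Real.pi / 4), 0 < x := fun x hx => by linarith [hx.1]
  have hs0 : ∀ x ∈ Set.Icc A (n * Real.pi / 4), n / 2 * Real.sin (2 / n * x) ≠ 0 := fun x hx => by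
    obtain ⟨-, h2, h3⟩ := scaled_bounds hn (hx0 x hx) hx.2
    exact (h2.trans_le h3).ne'
  refine abs_integral_sin_pow_mul_le hk hA hAn (by linarith [Real.pi_gt_three])
    (fun x hx => scaledWeight_nonneg hn (hx0 x hx) hx.2)
    (fun x hx => scaledWeight_le hn (hx0 x hx) hx.2) ?_
  rintro rfl
  -- The quotient rule; the weight decreases because the cosine power decreases and the sine
  -- increases.
  refine ⟨fun x => (N * Real.cos (2 / n * x) ^ (N - 1) * (-Real.sin (2 / n * x) * (2 / n)) *
    (n / 2 * Real.sin (2 / n * x)) - Real.cos (2 / n * x) ^ N *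
      (n / 2 * (Real.cos (2 / n * x) * (2 / n)))) / (n / 2 * Real.sin (2 / n * x)) ^ 2,
    fun x hx => ?_, ?_, fun x hx => ?_⟩
  · have hl : HasDerivAt (fun x : ℝ => 2 / n * x) (2 / n) x := by
      simpa using (hasDerivAt_id' x).const_mul (2 / n)
    have h1 := (hl.cos.pow N).div (hl.sin.const_mul (n / 2)) (hs0 x hx)
    have h2 : scaledWeight (3 - 2) N n = ((fun x => Real.cos (2 / n * x)) ^ N) /
        fun x => n / 2 * Real.sin (2 / n * x) := by
      ext y; simp [scaledWeight]
    rw [h2]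
    exact h1
  · refine ContinuousOn.div (by fun_prop) (by fun_prop) fun x hx => pow_ne_zero 2 (hs0 x hx)
  · obtain ⟨h1, h2, h3⟩ := scaled_bounds hn (hx0 x hx) hx.2
    have h4 := h2.trans_le h3
    have h5 : 0 ≤ Real.sin (2 / n * x) := by
      by_contra hc
      push Not at hc
      have := mul_neg_of_pos_of_neg (show 0 < n / 2 by positivity) hc
      linarith
    refine div_nonpos_of_nonpos_of_nonneg ?_ (by positivity)
    have e1 : 0 ≤ N * Real.cos (2 / n * x) ^ (N - 1) * (Real.sin (2 / n * x) * (2 / n)) *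
      (n / 2 * Real.sin (2 / n * x)) := by positivity
    have e2 : 0 ≤ Real.cos (2 / n * x) ^ N * (n / 2 * (Real.cos (2 / n * x) * (2 / n))) := by
      positivity
    linarith

/-- Bernoulli's inequality and cos x ≥ 1 - x^2/2: the exponent grows like r while x^2 is of order
1/r^2. -/
theorem tendsto_cos_pow {k : ℕ} (u : ℝ) :
    Tendsto (fun r : ℕ => Real.cos (2 / ((r : ℝ) + 1) * u) ^ (k * r - 4)) atTop (𝓝 1) := by
  have hinv : Tendsto (fun r : ℕ => 1 / ((r : ℝ) + 1)) atTop (𝓝 0) :=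
    tendsto_one_div_add_atTop_nhds_zero_nat
  have hx : Tendsto (fun r : ℕ => 2 / ((r : ℝ) + 1) * u) atTop (𝓝 0) := by
    have := hinv.mul_const (2 * u)
    rw [zero_mul] at this
    refine this.congr fun r => by ring
  have hlow : Tendsto (fun r : ℕ => 1 - 2 * k * u ^ 2 * (1 / ((r : ℝ) + 1))) atTop (𝓝 1) := by
    have := (hinv.const_mul (2 * k * u ^ 2)).const_sub 1
    simpa using this
  refine tendsto_of_tendsto_of_tendsto_of_le_of_le' hlow tendsto_const_nhds ?_ ?_
  · have hev : ∀ᶠ r : ℕ in atTop, |2 / ((r : ℝ) + 1) * u| < 1 :=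
      (hx.abs.eventually_lt_const (by simp))
    filter_upwards [hev] with r hr
    set x := 2 / ((r : ℝ) + 1) * u with hxd
    have hx2 : x ^ 2 ≤ 1 := by rw [← sq_abs]; exact pow_le_one₀ (abs_nonneg _) hr.le
    have h1 : 1 + ((k * r - 4 : ℕ) : ℝ) * (-(x ^ 2 / 2)) ≤ (1 + -(x ^ 2 / 2)) ^ (k * r - 4) :=
      one_add_mul_le_pow (by linarith) _
    have h2 : (1 + -(x ^ 2 / 2)) ^ (k * r - 4) ≤ Real.cos x ^ (k * r - 4) :=
      pow_le_pow_left₀ (by linarith) (by linarith [Real.one_sub_sq_div_two_le_cos (x := x)]) _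
    refine le_trans ?_ (h1.trans h2)
    have h3 : ((k * r - 4 : ℕ) : ℝ) ≤ k * ((r : ℝ) + 1) := by
      have : k * r - 4 ≤ k * (r + 1) := by
        have : k * (r + 1) = k * r + k := by ring
        omega
      exact_mod_cast this
    have h4 : k * ((r : ℝ) + 1) * (x ^ 2 / 2) = 2 * k * u ^ 2 * (1 / ((r : ℝ) + 1)) := by
      rw [hxd]; field_simp
    have := mul_le_mul_of_nonneg_right h3 (show 0 ≤ x ^ 2 / 2 by positivity)
    linarith
  · have hev : ∀ᶠ r : ℕ in atTop, |2 / ((r : ℝ) + 1) * u| < 1 :=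
      (hx.abs.eventually_lt_const (by simp))
    filter_upwards [hev] with r hr
    have := abs_lt.1 hr
    exact pow_le_one₀ (Real.cos_nonneg_of_neg_pi_div_two_le_of_le
      (by linarith [Real.pi_gt_three]) (by linarith [Real.pi_gt_three])) (Real.cos_le_one _)

theorem tendsto_scaledWeight {k : ℕ} (hu : u ≠ 0) :
    Tendsto (fun r : ℕ => scaledWeight p (k * r - 4) ((r : ℝ) + 1) u) atTop (𝓝 (1 / u ^ p)) := by
  have hinv : Tendsto (fun r : ℕ => 1 / ((r : ℝ) + 1)) atTop (𝓝 0) :=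
    tendsto_one_div_add_atTop_nhds_zero_nat
  have hx : Tendsto (fun r : ℕ => 2 / ((r : ℝ) + 1) * u) atTop (𝓝 0) := by
    have := hinv.mul_const (2 * u)
    rw [zero_mul] at this
    refine this.congr fun r => by ring
  have h1 : Tendsto (fun r : ℕ => ((r : ℝ) + 1) / 2 * Real.sin (2 / ((r : ℝ) + 1) * u)) atTop
      (𝓝 u) := by
    have h2 := ((Real.continuous_sinc.tendsto 0).comp hx).const_mul u
    rw [Real.sinc_zero, mul_one] at h2
    refine h2.congr fun r => ?_
    have hr : (r : ℝ) + 1 ≠ 0 := by positivity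
    simp only [Function.comp_apply]
    rw [Real.sinc_of_ne_zero (by positivity)]
    field_simp
  exact (tendsto_cos_pow u).div (h1.pow p) (pow_ne_zero _ hu)

end scaled

/-! ### Passage to the limit -/

section limit

variable {k : ℕ}

/-- The rescaled integral for the number of triangulations. -/
noncomputable def scaledIntegral (k r : ℕ) : ℝ :=
  ∫ u in (0 : ℝ)..((r : ℝ) + 1) * Real.pi / 4,
    Real.sin (2 * u) ^ k * scaledWeight (k - 2) (k * r - 4) ((r : ℝ) + 1) u

theorem eventually_le_scaled (A : ℝ) : ∀ᶠ r : ℕ in atTop, A ≤ ((r : ℝ) + 1) * Real.pi / 4 := by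
  have : Tendsto (fun r : ℕ => ((r : ℝ) + 1) * Real.pi / 4) atTop atTop :=
    ((tendsto_atTop_add_const_right _ 1 tendsto_natCast_atTop_atTop).atTop_mul_const
      Real.pi_pos).atTop_div_const (by norm_num)
  exact this.eventually_ge_atTop A

theorem measurable_sin_pow_mul_scaledWeight {p N : ℕ} {n : ℝ} :
    Measurable fun u => Real.sin (2 * u) ^ k * scaledWeight p N n u :=
  Measurable.mul (by fun_prop) measurable_scaledWeight

theorem tendsto_integral_scaled (hk : 3 ≤ k) {A : ℝ} (hA : 0 ≤ A) :
    Tendsto (fun r : ℕ => ∫ u in (0 : ℝ)..A,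
      Real.sin (2 * u) ^ k * scaledWeight (k - 2) (k * r - 4) ((r : ℝ) + 1) u) atTop
      (𝓝 (∫ u in (0 : ℝ)..A, sinPowDiv k u)) := by
  refine intervalIntegral.tendsto_integral_filter_of_dominated_convergence
    (fun _ => Real.pi ^ (k - 2)) ?_ ?_ (by simp) ?_
  · exact Eventually.of_forall fun r => measurable_sin_pow_mul_scaledWeight.aestronglyMeasurable
  · filter_upwards [eventually_le_scaled A] with r hr
    refine MeasureTheory.ae_of_all _ fun u hu => ?_
    rw [Set.uIoc_of_le hA] at hu
    exact abs_sin_pow_mul_scaledWeight_le (by omega) (by positivity) hu.1 (hu.2.trans hr)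
  · refine MeasureTheory.ae_of_all _ fun u hu => ?_
    rw [Set.uIoc_of_le hA] at hu
    have := (tendsto_scaledWeight (p := k - 2) (k := k) hu.1.ne').const_mul (Real.sin (2 * u) ^ k)
    rwa [mul_one_div] at this

/-- First fix `A` so large that the tail of the limit and, for all large r at once, the tail of the
rescaled integral are below ε/3; then dominated convergence on [0, A] gives the last third. -/
theorem tendsto_scaledIntegral (hk : 3 ≤ k) {L : ℝ}
    (hL : Tendsto (fun B => ∫ x in (0 : ℝ)..B, sinPowDiv k x) atTop (𝓝 L)) :
    Tendsto (fun r : ℕ => scaledIntegral k r) atTop (𝓝 L) := by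
  rw [Metric.tendsto_atTop']
  intro ε hε
  have hC : 0 < 2 * (Real.pi / 2) ^ (k - 2) := by have := Real.pi_pos; positivity
  set C := 2 * (Real.pi / 2) ^ (k - 2) with hCd
  obtain ⟨A, hA1, hA2, hA3⟩ := ((Metric.tendsto_nhds.1 hL (ε / 3) (by linarith)).and
    ((eventually_ge_atTop 1).and (eventually_gt_atTop (3 * C / ε)))).exists
  have hA0 : 0 < A := by linarith
  have h1 := Metric.tendsto_nhds.1 (tendsto_integral_scaled hk hA0.le) (ε / 3) (by linarith)
  obtain ⟨R, hR⟩ := eventually_atTop.1 (h1.and (eventually_le_scaled A))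
  refine ⟨R, fun r hr => ?_⟩
  obtain ⟨h2, h3⟩ := hR r hr.le
  have hn : 0 < (r : ℝ) + 1 := by positivity
  have h4 := abs_integral_scaledWeight_le (N := k * r - 4) hk hn hA2 h3
  have hi : ∀ a b, 0 ≤ a → a ≤ b → b ≤ ((r : ℝ) + 1) * Real.pi / 4 → IntervalIntegrable
      (fun u => Real.sin (2 * u) ^ k * scaledWeight (k - 2) (k * r - 4) ((r : ℝ) + 1) u)
      MeasureTheory.volume a b := by
    intro a b ha hab hb
    refine (intervalIntegrable_const (c := Real.pi ^ (k - 2))).mono_fun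
      measurable_sin_pow_mul_scaledWeight.aestronglyMeasurable ?_
    rw [EventuallyLE, MeasureTheory.ae_restrict_iff' measurableSet_uIoc]
    refine MeasureTheory.ae_of_all _ fun u hu => ?_
    rw [Set.uIoc_of_le hab] at hu
    exact (abs_sin_pow_mul_scaledWeight_le (by omega) hn (ha.trans_lt hu.1)
      (hu.2.trans hb)).trans (le_abs_self _)
  rw [scaledIntegral, ← intervalIntegral.integral_add_adjacent_intervals
    (hi 0 A le_rfl hA0.le h3) (hi A _ hA0.le h3 le_rfl)]
  have h5 : C / A < ε / 3 := by
    rw [div_lt_iff₀ hε] at hA3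
    rw [div_lt_iff₀ hA0]; linarith
  rw [Real.dist_eq] at *
  rw [← hCd] at h4
  have h6 := h4.trans_lt h5
  rw [abs_lt] at *
  constructor <;> linarith

theorem tr_eq_scaledIntegral {r : ℕ} (hk : 3 ≤ k) (hr : 2 < r) : (tr k r : ℝ) =
    2 ^ ((r - 1) * k) * ((r : ℝ) + 1) ^ (k - 3) / Real.pi * (2 * scaledIntegral k r) := by
  have hn : (r : ℝ) + 1 ≠ 0 := by positivity
  -- The substitution x = 2u/(r+1). Its factor 2/(r+1) lowers the power of (r+1)/2 from k-2 to k-3.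
  have h1 := intervalIntegral.mul_integral_comp_mul_left (a := 0)
    (b := ((r : ℝ) + 1) * Real.pi / 4) (c := 2 / ((r : ℝ) + 1)) (f := fun x : ℝ =>
      Real.cos x ^ (k * r - 4) * Real.sin ((r + 1) * x) ^ k / Real.sin x ^ (k - 2))
  have h2 : 2 / ((r : ℝ) + 1) * (((r : ℝ) + 1) * Real.pi / 4) = Real.pi / 2 := by
    field_simp; norm_num
  rw [mul_zero, h2] at h1
  rw [tr_eq_integral hk hr, ← h1]
  have h3 : ∀ u : ℝ, Real.cos (2 / ((r : ℝ) + 1) * u) ^ (k * r - 4) *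
      Real.sin ((r + 1) * (2 / ((r : ℝ) + 1) * u)) ^ k /
        Real.sin (2 / ((r : ℝ) + 1) * u) ^ (k - 2) =
      (((r : ℝ) + 1) / 2) ^ (k - 2) *
        (Real.sin (2 * u) ^ k * scaledWeight (k - 2) (k * r - 4) ((r : ℝ) + 1) u) := by
    intro u
    rw [show ((r : ℝ) + 1) * (2 / ((r : ℝ) + 1) * u) = 2 * u by field_simp, scaledWeight,
      mul_pow (((r : ℝ) + 1) / 2)]
    have : (((r : ℝ) + 1) / 2) ^ (k - 2) ≠ 0 := by positivity
    field_simp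
  simp only [h3]
  rw [intervalIntegral.integral_const_mul, ← scaledIntegral]
  obtain ⟨l, rfl⟩ : ∃ l, k = l + 3 := ⟨k - 3, by omega⟩
  obtain ⟨m, rfl⟩ : ∃ m, r = m + 3 := ⟨r - 3, by omega⟩
  rw [show l + 3 - 2 = l + 1 by omega, show l + 3 - 3 = l by omega, show m + 3 - 1 = m + 2 by omega]
  have h4 : (l + 3) * (m + 3) - 4 = (m + 2) * (l + 3) + l - 1 := by
    have : (l + 3) * (m + 3) = (m + 2) * (l + 3) + l + 3 := by ring
    omega
  have h5 : (2 : ℝ) ^ ((l + 3) * (m + 3) - 4) * 2 = 2 ^ ((m + 2) * (l + 3)) * 2 ^ l := by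
    rw [← pow_succ, ← pow_add]; congr 1
    have : 0 < (m + 2) * (l + 3) := by positivity
    omega
  have hpi := Real.pi_ne_zero
  rw [pow_succ, div_pow]
  have h6 : (2 : ℝ) ^ l ≠ 0 := by positivity
  field_simp
  linear_combination scaledIntegral (l + 3) (m + 3) * 2 * h5

end limit

theorem theorem6p2 (k : ℕ) (hk : 3 ≤ k) :
    ∃ J : ℝ,
      Tendsto (fun p : ℝ × ℝ => ∫ u in p.1..p.2, Real.sin (2 * u) ^ k / u ^ (k - 2))
        (atBot ×ˢ atTop) (𝓝 J) ∧
      (fun r : ℕ => (tr k r : ℝ)) ~[atTop]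
        (fun r : ℕ => (2 : ℝ) ^ ((r - 1) * k) * (r : ℝ) ^ (k - 3) / Real.pi * J) := by
  obtain ⟨L, hL⟩ := exists_tendsto_integral_sinPowDiv hk
  have hL0 := limit_sinPowDiv_pos hk hL
  refine ⟨2 * L, tendsto_improper_sinPowDiv hk hL, ?_⟩
  have hne : ∀ᶠ r : ℕ in atTop,
      (2 : ℝ) ^ ((r - 1) * k) * (r : ℝ) ^ (k - 3) / Real.pi * (2 * L) ≠ 0 := by
    filter_upwards [eventually_gt_atTop 0] with r hr
    have := Real.pi_pos
    positivity
  rw [isEquivalent_iff_tendsto_one hne]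
  -- The exact formula has (r+1)^(k-3) in place of r^(k-3); their ratio tends to 1.
  have h1 : Tendsto (fun r : ℕ => (1 + 1 / (r : ℝ)) ^ (k - 3) * (scaledIntegral k r / L)) atTop
      (𝓝 1) := by
    have h2 := ((tendsto_one_div_atTop_nhds_zero_nat (𝕜 := ℝ)).const_add 1).pow (k - 3)
    have h3 := (tendsto_scaledIntegral hk hL).div_const L
    rw [div_self hL0.ne'] at h3
    simpa using h2.mul h3
  refine h1.congr' ?_
  filter_upwards [eventually_gt_atTop 2] with r hr
  have hr0 : (r : ℝ) ≠ 0 := by positivity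
  rw [Pi.div_apply, tr_eq_scaledIntegral hk hr, show 1 + 1 / (r : ℝ) = ((r : ℝ) + 1) / r by
    field_simp, div_pow]
  have := Real.pi_ne_zero
  have := hL0.ne'
  field_simp
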